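/- Let $\Omega\subseteq\mathbb{C}$ be a simply connected domain and let $c\ge 0$ be a real number. A locally univalent self-map of $\Omega$ is a holomorphic map $\phi:\Omega\to\Omega$ with $\phi'(z)\neq 0$ for all $z\in\Omega$. Let $\Lambda_c(\Omega)$ be the set of all positive $C^2$ functions $\lambda:\Omega\to\mathbb{R}$ such that the conformal metric $\lambda(z)\,|dz|$ has constant Gauss curvature $c$, that is, $$-\frac{\Delta\log\lambda(z)}{\lambda(z)^2}=c\qquad\text{for all } z\in\Omega,$$ equipped with the topology of locally uniform convergence on $\Omega$. For $\lambda\in\Lambda_c(\Omega)$ and a locally univalent self-map $\phi$ of $\Omega$ put $\phi^*\lambda(z):=\lambda(\phi(z))\,|\phi'(z)|$; then $\phi^*\lambda\in\Lambda_c(\Omega)$. Let $\Phi$ be a family of locally univalent self-maps of $\Omega$ that contains a sequence $(\phi_n)$ with the following two properties: (i) (run-away) for every compact set $K\subseteq\Omega$ there is $n\in\mathbb{N}$ with $\phi_n(K)\cap K=\emptyset$; (ii) (eventually injective) for every compact set $K\subseteq\Omega$ there is $N\in\mathbb{N}$ such that $\phi_n|_K$ is injective for all $n\ge N$. Then there exists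 a $\Phi$-universal $\Lambda\in\Lambda_c(\Omega)$, that is, some $\Lambda\in\Lambda_c(\Omega)$ for which the set $\{\phi^*\Lambda:\phi\in\Phi\}$ is dense in $\Lambda_c(\Omega)$. -/

import Mathlib

open TopologicalSpace

/-- A locally univalent self-map of the open set `Ω ⊆ ℂ`: a holomorphic map of `Ω` into itself
whose derivative vanishes nowhere on `Ω`. The values of `toFun` outside `Ω` play no role. -/
structure LocUnivSelfMap (Ω : Opens ℂ) where
  toFun : ℂ → ℂ
  holo : DifferentiableOn ℂ toFun Ω
  mapsTo : Set.MapsTo toFun Ω Ω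
  deriv_ne_zero : ∀ z ∈ Ω, deriv toFun z ≠ 0

namespace LocUnivSelfMap

/-- The pullback `φ^*u (z) = u (φ z) * |φ' z|` of a continuous function `u` on `Ω`. -/
noncomputable def pullback {Ω : Opens ℂ} (φ : LocUnivSelfMap Ω) (u : C(Ω, ℝ)) : C(Ω, ℝ) where
  toFun z := u ⟨φ.toFun z, φ.mapsTo z.2⟩ * ‖deriv φ.toFun z‖
  continuous_toFun := by
    have h1 : Continuous fun z : Ω => (⟨φ.toFun z, φ.mapsTo z.2⟩ : Ω) :=
      (continuousOn_iff_continuous_domRestrict.mp φ.holo.continuousOn).subtype_mk _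
    have h2 : Continuous fun z : Ω => deriv φ.toFun z :=
      continuousOn_iff_continuous_domRestrict.mp (φ.holo.deriv Ω.isOpen).continuousOn
    exact (u.continuous.comp h1).mul h2.norm

end LocUnivSelfMap

/-- `φ n` is run-away: every compact `K ⊆ Ω` is disjoint from `φ n (K)` for some `n`. -/
def IsRunAway {Ω : Opens ℂ} (φ : ℕ → LocUnivSelfMap Ω) : Prop :=
  ∀ K : Set ℂ, K ⊆ Ω → IsCompact K → ∃ n, (φ n).toFun '' K ∩ K = ∅

/-- `φ n` is eventually injective on every compact `K ⊆ Ω`. -/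
def IsEventuallyInjective {Ω : Opens ℂ} (φ : ℕ → LocUnivSelfMap Ω) : Prop :=
  ∀ K : Set ℂ, K ⊆ Ω → IsCompact K → ∃ N, ∀ n ≥ N, Set.InjOn (φ n).toFun K

/-- `l` is the density of a regular conformal metric `l(z) |dz|` on `Ω`: positive and `C²`. -/
def IsRegularConformalDensity (Ω : Opens ℂ) (l : ℂ → ℝ) : Prop :=
  (∀ z ∈ Ω, 0 < l z) ∧ ContDiffOn ℝ 2 l Ω

/-- The Gauss curvature `-Δ (log l) / l²` of the metric `l(z) |dz|` at `z`. -/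
noncomputable def gaussCurvature (l : ℂ → ℝ) (z : ℂ) : ℝ :=
  -(Laplacian.laplacian (fun w : ℂ => Real.log (l w)) z) / (l z) ^ 2

/-- The set of densities of regular conformal metrics on `Ω` of constant curvature `c`, as a
subset of the space `C(Ω, ℝ)` with its compact-open topology. Since `Ω` is open, positivity,
regularity and curvature on `Ω` do not depend on how the function is continued outside `Ω`. -/
def constCurvatureDensities (Ω : Opens ℂ) (c : ℝ) : Set C(Ω, ℝ) :=
  {u | ∃ l : ℂ → ℝ, (∀ z : Ω, u z = l z) ∧ IsRegularConformalDensity Ω l ∧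
    ∀ z ∈ Ω, gaussCurvature l z = c}

/-- `L` is `Φ`-universal among the densities of constant curvature `c`: it is such a density, and
its pullbacks under the members of `Φ` form a dense subset of the set of all such densities. -/
def IsUniversalDensity (Ω : Opens ℂ) (c : ℝ) (Φ : Set (LocUnivSelfMap Ω)) (L : C(Ω, ℝ)) : Prop :=
  L ∈ constCurvatureDensities Ω c ∧
    (fun φ : LocUnivSelfMap Ω => φ.pullback L) '' Φ ⊆ constCurvatureDensities Ω c ∧
    constCurvatureDensities Ω c ⊆ closure ((fun φ : LocUnivSelfMap Ω => φ.pullback L) '' Φ)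

/-! ### Plane sets with connected complement. -/

section PlaneTopology
open Set Metric Topology

/-! By the Riemann mapping theorem `Ω` may be replaced by the unit disc or the plane: pullback under
a conformal equivalence carries constant curvature densities to such densities and conjugates the
maps `φ n`. In these two models every compact set lies in a disc about `0`, and for a suitable `n`
the map `φ n` is injective on a slightly larger disc and moves it off itself.

Densities are parametrised by holomorphic data: `exp (Re h)` for `c = 0`, and for `c > 0`
(Liouville) `2 / (√c (|u₀|² + |u₁|²))` with holomorphic `u₀, u₁` of Wronskian `1`, that is, two
solutions of one equation `u'' = q u`. The data form a closed, hence complete, hence Baire space.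
Birkhoff's category argument (`exists_pullback_dense`) then asks only for the following: given data
`u` and `w`, find data close to `u` on a disc `D` whose pullback under `φ n` is close to `w` on `D`.

For `c = 0` this is Runge's theorem on `D ∪ φ n (D)`, whose complement is connected
(`exists_polynomial_log_near`). For `c > 0` the Wronskian condition is not linear, so Runge's
theorem is applied to the potential `q` instead. The solutions started in `D` must then also arrive
at `φ n (D)` with the right values and derivatives (`exists_steering`). This is achieved by adding
three approximate point masses to `q` on a segment from `D` to `φ n (D)`. A point mass acts on `(u,
u')` by a lower unipotent matrix, and three of these, interlaced with the transport matrices between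
them, reach every matrix of determinant `1` up to a small error (`exists_shear_approx`). A point
mass is approximated by a Poisson kernel, a combination of two simple poles, and the latter by
polynomials which are small on both discs; here the disc, the segment and the copy together must
have connected complement.

It remains to see that unit pairs approximate every density of curvature `c > 0` on discs. The
Schwarzian of a merely `C²` density is holomorphic by Morera's theorem (`exists_schwarzian`), and `1
/ l` is governed by a linear system whose only coefficient is this Schwarzian; approximating it by a
polynomial gives entire solutions. -/

/-- A closed set `E₀ ∪ K` has preconnected complement if `K` has and if any two points of
`E₀ \ K` can be linked by a preconnected set that fills the complement near both of them. -/
theorem isPreconnected_compl_union {E₀ K : Set ℂ} (hE : IsClosed (E₀ ∪ K))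
    (hK : IsPreconnected Kᶜ) (hne : (E₀ \ K).Nonempty)
    (H : ∀ p ∈ E₀ \ K, ∀ p' ∈ E₀ \ K, ∃ T : Set ℂ, IsPreconnected T ∧ T ⊆ (E₀ ∪ K)ᶜ ∧
      (∃ N ∈ 𝓝 p, N ∩ (E₀ ∪ K)ᶜ ⊆ T) ∧ ∃ N ∈ 𝓝 p', N ∩ (E₀ ∪ K)ᶜ ⊆ T) :
    IsPreconnected (E₀ ∪ K)ᶜ := by
  set E := E₀ ∪ K with hEdef
  -- Each component of the complement accumulates at some point of `E₀ \ K`: otherwise it is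
  -- relatively clopen in the preconnected set `Kᶜ`, hence equal to it, although it misses `E₀ \ K`.
  -- The sets `T` then link any two components.
  have hcomp : ∀ x ∈ Eᶜ, ∃ p ∈ E₀ \ K, p ∈ closure (connectedComponentIn Eᶜ x) := by
    intro x hx
    by_contra! hcon
    set V := connectedComponentIn Eᶜ x with hV
    have hVo : IsOpen V := hE.isOpen_compl.connectedComponentIn
    have hVE : V ⊆ Eᶜ := connectedComponentIn_subset _ _
    have hcl : closure V ∩ Eᶜ ⊆ V := by
      rintro y ⟨hy, hyE⟩
      have h1 : IsPreconnected (insert y V) :=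
        isPreconnected_connectedComponentIn.subset_closure (subset_insert _ _)
          (insert_subset hy subset_closure)
      exact h1.subset_connectedComponentIn (mem_insert_of_mem _ (mem_connectedComponentIn hx))
        (insert_subset hyE hVE) (mem_insert _ _)
    have hclK : closure V ∩ Kᶜ ⊆ V := by
      rintro y ⟨hy, hyK⟩
      refine hcl ⟨hy, fun hyE => ?_⟩
      rcases hyE with h | h
      · exact hcon y ⟨h, hyK⟩ hy
      · exact hyK h
    have hVK : V ⊆ Kᶜ := fun y hy hyK => hVE hy (Or.inr hyK)
    have hsub : Kᶜ ⊆ V := by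
      apply hK.subset_left_of_subset_union hVo (isClosed_closure (s := V)).isOpen_compl
        (disjoint_compl_right.mono_left subset_closure)
      · intro y hy
        by_cases h : y ∈ closure V
        · exact Or.inl (hclK ⟨h, hy⟩)
        · exact Or.inr h
      · exact ⟨x, hVK (mem_connectedComponentIn hx), mem_connectedComponentIn hx⟩
    obtain ⟨p, hp, hpK⟩ := hne
    exact hVE (hsub hpK) (Or.inl hp)
  apply isPreconnected_of_forall_pair
  intro x hx y hy
  obtain ⟨p, hp, hpx⟩ := hcomp x hx
  obtain ⟨p', hp', hpy⟩ := hcomp y hy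
  obtain ⟨T, hT, hTE, ⟨N, hN, hNT⟩, N', hN', hNT'⟩ := H p hp p' hp'
  obtain ⟨a, ha, haV⟩ := mem_closure_iff_nhds.1 hpx N hN
  obtain ⟨b, hb, hbV⟩ := mem_closure_iff_nhds.1 hpy N' hN'
  have haT : a ∈ T := hNT ⟨ha, connectedComponentIn_subset _ _ haV⟩
  have hbT : b ∈ T := hNT' ⟨hb, connectedComponentIn_subset _ _ hbV⟩
  refine ⟨connectedComponentIn Eᶜ x ∪ T ∪ connectedComponentIn Eᶜ y,
    union_subset (union_subset (connectedComponentIn_subset _ _) hTE)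
      (connectedComponentIn_subset _ _), Or.inl (Or.inl (mem_connectedComponentIn hx)),
      Or.inr (mem_connectedComponentIn hy), ?_⟩
  refine IsPreconnected.union b (Or.inr hbT) hbV ?_ isPreconnected_connectedComponentIn
  exact IsPreconnected.union a haV haT isPreconnected_connectedComponentIn hT

/-- An open annulus is preconnected. -/
theorem isPreconnected_ball_diff_closedBall {r R : ℝ} (hr : 0 < r) :
    IsPreconnected (ball (0 : ℂ) R \ closedBall 0 r) := by
  have : ball (0 : ℂ) R \ closedBall 0 r =
      (fun p : ℝ × ℝ => (p.1 : ℂ) * Complex.exp (p.2 * Complex.I)) '' (Ioo r R ×ˢ univ) := by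
    ext z
    simp only [mem_sdiff, mem_ball_zero_iff, mem_closedBall_zero_iff, not_le, mem_image,
      mem_prod, mem_Ioo, mem_univ, and_true, Prod.exists]
    constructor
    · rintro ⟨h1, h2⟩
      exact ⟨‖z‖, z.arg, ⟨h2, h1⟩, Complex.norm_mul_exp_arg_mul_I z⟩
    · rintro ⟨ρ, θ, ⟨h1, h2⟩, rfl⟩
      have : ‖(ρ : ℂ) * Complex.exp (θ * Complex.I)‖ = ρ := by
        rw [norm_mul, Complex.norm_exp_ofReal_mul_I, mul_one, Complex.norm_real,
          Real.norm_of_nonneg (hr.trans h1).le]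
      rw [this]; exact ⟨h2, h1⟩
  rw [this]
  exact (isPreconnected_Ioo.prod isPreconnected_univ).image _ (by fun_prop)

/-- The image of a closed disc under a map that is continuous, open and injective on a larger open
disc has preconnected complement. -/
theorem isPreconnected_compl_image_closedBall {φ : ℂ → ℂ} {r R : ℝ} (hr : 0 < r) (hrR : r < R)
    (hc : ContinuousOn φ (ball 0 R)) (hinj : InjOn φ (ball 0 R))
    (hopen : ∀ U ⊆ ball (0 : ℂ) R, IsOpen U → IsOpen (φ '' U)) :
    IsPreconnected (φ '' closedBall 0 r)ᶜ := by
  have hsub : closedBall (0 : ℂ) r ⊆ ball 0 R := closedBall_subset_ball hrR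
  have hcl : IsClosed (φ '' closedBall 0 r) :=
    ((isCompact_closedBall 0 r).image_of_continuousOn (hc.mono hsub)).isClosed
  -- With `K = ∅` the complement of `K` is the plane. The linking set is the image of the annulus
  -- between the radii `r` and `R`.
  have := isPreconnected_compl_union (E₀ := φ '' closedBall 0 r) (K := ∅) (by simpa using hcl)
    (by simpa using isPreconnected_univ) ⟨φ 0, ⟨0, by simp [hr.le], rfl⟩, by simp⟩ ?_
  · simpa using this
  · intro p hp p' hp'
    have hN : ∀ p ∈ φ '' closedBall 0 r, φ '' ball 0 R ∈ 𝓝 p := fun p hp =>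
      (hopen _ subset_rfl isOpen_ball).mem_nhds (image_mono hsub hp)
    have hT : φ '' ball 0 R ∩ (φ '' closedBall 0 r ∪ ∅)ᶜ ⊆ φ '' (ball 0 R \ closedBall 0 r) := by
      rintro _ ⟨⟨z, hz, rfl⟩, h⟩
      refine ⟨z, ⟨hz, fun hz' => h (Or.inl ⟨z, hz', rfl⟩)⟩, rfl⟩
    refine ⟨φ '' (ball 0 R \ closedBall 0 r),
      (isPreconnected_ball_diff_closedBall hr).image _ (hc.mono sdiff_subset), ?_,
      ⟨_, hN p hp.1, hT⟩, ⟨_, hN p' hp'.1, hT⟩⟩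
    rintro _ ⟨z, hz, rfl⟩ h
    simp only [union_empty] at h
    obtain ⟨w, hw, hwz⟩ := h
    exact hz.2 (hinj (hsub hw) hz.1 hwz ▸ hw)

/-- A closed disc together with a disjoint closed set with preconnected complement has preconnected
complement. -/
theorem isPreconnected_compl_closedBall_union {K : Set ℂ} {r : ℝ} (hr : 0 < r) (hK : IsClosed K)
    (hKc : IsPreconnected Kᶜ) (hd : Disjoint (closedBall 0 r) K) :
    IsPreconnected (closedBall 0 r ∪ K)ᶜ := by
  obtain ⟨δ, hδ, hδK⟩ := (isCompact_closedBall (0 : ℂ) r).exists_cthickening_subset_open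
    hK.isOpen_compl hd.subset_compl_right
  rw [cthickening_closedBall hδ.le hr.le] at hδK
  have hN : ∀ p ∈ closedBall (0 : ℂ) r, ball (0 : ℂ) (r + δ) ∈ 𝓝 p := fun p hp =>
    isOpen_ball.mem_nhds (closedBall_subset_ball (by linarith) hp)
  apply isPreconnected_compl_union (isClosed_closedBall.union hK) hKc
    ⟨0, by simp [hr.le], fun h => hd.le_bot ⟨mem_closedBall_self hr.le, h⟩⟩
  intro p hp p' hp'
  have hT : ball (0 : ℂ) (r + δ) ∩ (closedBall 0 r ∪ K)ᶜ ⊆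
      ball (0 : ℂ) (r + δ) \ closedBall 0 r := fun z hz => ⟨hz.1, fun h => hz.2 (Or.inl h)⟩
  refine ⟨_, isPreconnected_ball_diff_closedBall (R := r + δ) hr, ?_,
    ⟨_, hN p hp.1, hT⟩, ⟨_, hN p' hp'.1, hT⟩⟩
  rintro z ⟨hz, hzr⟩ (h | h)
  · exact hzr h
  · exact hδK (by rw [add_comm]; exact ball_subset_closedBall hz) h

end PlaneTopology
-- Complement of a disc, a compact set and a slit joining them.
section SlitTopology
open Set Metric Topology

/-- A circle minus one point is preconnected. -/
theorem isPreconnected_sphere_diff_ray {b : ℂ} (hb : b ≠ 0) {ρ : ℝ} (hρ : 0 < ρ) :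
    IsPreconnected {z : ℂ | ‖z‖ = ρ ∧ ∀ t : ℝ, 0 ≤ t → z ≠ t * b} := by
  have hb' : ‖b‖ ≠ 0 := by simpa using hb
  have hbc : (‖b‖ : ℂ) ≠ 0 := by exact_mod_cast hb'
  -- The angle is measured from the point opposite to `b`, so the omitted point corresponds to `θ =
  -- ±π`.
  have : {z : ℂ | ‖z‖ = ρ ∧ ∀ t : ℝ, 0 ≤ t → z ≠ t * b} =
      (fun θ : ℝ => -(ρ / ‖b‖ : ℂ) * b * Complex.exp (θ * Complex.I)) ''
        Ioo (-Real.pi) Real.pi := by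
    ext z
    simp only [mem_ofPred_eq, mem_image, mem_Ioo]
    constructor
    · rintro ⟨hz, ht⟩
      have hz0 : z ≠ 0 := by rintro rfl; simp at hz; exact hρ.ne hz
      have hne : (-(z / b)).arg ≠ Real.pi := by
        intro h
        rw [Complex.arg_eq_pi_iff] at h
        apply ht (z / b).re (by have := h.1; simp at this; exact this.le)
        have h2 : ((z / b).re : ℂ) = z / b := by
          apply Complex.ext
          · simp
          · have := h.2; simp at this; simp [this]
        rw [h2]; field_simp
      refine ⟨(-(z / b)).arg, ⟨Complex.neg_pi_lt_arg _,
        lt_of_le_of_ne (Complex.arg_le_pi _) hne⟩, ?_⟩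
      have h := Complex.norm_mul_exp_arg_mul_I (-(z / b))
      have hn : ‖-(z / b)‖ = ρ / ‖b‖ := by rw [norm_neg, norm_div, hz]
      rw [hn] at h
      push_cast at h
      rw [mul_right_comm, neg_mul, h]
      field_simp
    · rintro ⟨θ, ⟨h1, h2⟩, rfl⟩
      constructor
      · rw [norm_mul, norm_mul, Complex.norm_exp_ofReal_mul_I, norm_neg, norm_div]
        simp only [Complex.norm_real, norm_norm]
        rw [Real.norm_of_nonneg hρ.le]; field_simp
      · intro t ht h
        have h3 : Complex.exp (θ * Complex.I) = ((-(t * ‖b‖ / ρ) : ℝ) : ℂ) := by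
          have hρc : (ρ : ℂ) ≠ 0 := by exact_mod_cast hρ.ne'
          push_cast
          apply mul_left_cancel₀ (mul_ne_zero (neg_ne_zero.2 (div_ne_zero hρc hbc)) hb)
          rw [h]; field_simp
        have h4 : (Complex.exp (θ * Complex.I)).arg = θ := by
          rw [Complex.arg_exp_mul_I, toIocMod_eq_self]
          constructor <;> linarith
        have h5 : t * ‖b‖ / ρ ≠ 0 := by
          intro h0; rw [h0] at h3; simp at h3
        have h6 : 0 < t * ‖b‖ / ρ := lt_of_le_of_ne (by positivity) h5.symm
        rw [h3, Complex.arg_ofReal_of_neg (by linarith)] at h4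
        linarith
  rw [this]
  exact isPreconnected_Ioo.image _ (by fun_prop)

/-- The complement of a closed disc, a disjoint compact set with preconnected complement, and a
radial segment joining them, is preconnected. -/
theorem isPreconnected_compl_closedBall_union_segment_union {K : Set ℂ} {r : ℝ} {b : ℂ}
    (hr : 0 < r) (hK : IsClosed K) (hKc : IsPreconnected Kᶜ) (hd : Disjoint (closedBall 0 r) K)
    (hbK : b ∈ K) (hbt : ∀ t : ℝ, 0 ≤ t → t < 1 → (t : ℂ) * b ∉ K) :
    IsPreconnected (closedBall 0 r ∪ (fun t : ℝ => (t : ℂ) * b) '' Icc 0 1 ∪ K)ᶜ := by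
  have hb : r < ‖b‖ := by
    by_contra! h
    exact hd.le_bot ⟨by simpa using h, hbK⟩
  have hb0 : b ≠ 0 := by rintro rfl; simp at hb; linarith
  have hb0' : 0 < ‖b‖ := hr.trans hb
  have hsegc : ∀ s : ℝ, IsCompact ((fun t : ℝ => (t : ℂ) * b) '' Icc 0 s) := fun s =>
    isCompact_Icc.image (by fun_prop)
  apply isPreconnected_compl_union
    ((isClosed_closedBall.union (hsegc 1).isClosed).union hK) hKc
    ⟨0, Or.inl (by simp [hr.le]), fun h => hd.le_bot ⟨mem_closedBall_self hr.le, h⟩⟩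
  -- Every relevant point already lies on the disc with a shortened slit, which is compact and
  -- disjoint from `K` and so has a neighbourhood avoiding `K`.
  have hpt : ∀ p ∈ (closedBall 0 r ∪ (fun t : ℝ => (t : ℂ) * b) '' Icc 0 1) \ K,
      ∃ s : ℝ, s < 1 ∧ ∀ s', s ≤ s' → p ∈ closedBall 0 r ∪
        (fun t : ℝ => (t : ℂ) * b) '' Icc 0 s' := by
    rintro p ⟨hp | ⟨t, ht, rfl⟩, hpK⟩
    · exact ⟨0, one_pos, fun _ _ => Or.inl hp⟩
    · refine ⟨t, lt_of_le_of_ne ht.2 ?_, fun s' hs' => Or.inr ⟨t, ⟨ht.1, hs'⟩, rfl⟩⟩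
      rintro rfl
      exact hpK (by simpa using hbK)
  intro p hp p' hp'
  obtain ⟨s₁, hs₁, h₁⟩ := hpt p hp
  obtain ⟨s₂, hs₂, h₂⟩ := hpt p' hp'
  obtain ⟨s, hs1, hs, hsr⟩ : ∃ s, s < 1 ∧ (s₁ ≤ s ∧ s₂ ≤ s) ∧ r ≤ s * ‖b‖ := by
    refine ⟨max (max s₁ s₂) (r / ‖b‖), ?_, ⟨by simp, by simp⟩, ?_⟩
    · simp [hs₁, hs₂, div_lt_one hb0', hb]
    · have := le_max_right (max s₁ s₂) (r / ‖b‖)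
      rwa [div_le_iff₀ hb0'] at this
  have hs0 : 0 < s := by
    by_contra! h
    nlinarith
  set C : Set ℂ := closedBall 0 r ∪ (fun t : ℝ => (t : ℂ) * b) '' Icc 0 s with hC
  have hCc : IsCompact C := (isCompact_closedBall 0 r).union (hsegc s)
  have hCK : C ⊆ Kᶜ := by
    rintro z (hz | ⟨t, ht, rfl⟩)
    · exact hd.subset_compl_right hz
    · exact hbt t ht.1 (ht.2.trans_lt hs1)
  obtain ⟨δ₀, hδ₀, hδK₀⟩ := hCc.exists_thickening_subset_open hK.isOpen_compl hCK
  -- The second term keeps the neighbourhood inside `‖z‖ < ‖b‖`, where the ray through `b` and the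
  -- slit coincide outside the disc.
  set δ := min δ₀ ((1 - s) * ‖b‖)
  have hδ : 0 < δ := lt_min hδ₀ (mul_pos (by linarith) hb0')
  have hδK : thickening δ C ⊆ Kᶜ := (thickening_mono (min_le_left _ _) _).trans hδK₀
  have hNs : ∀ z ∈ thickening δ C, ∀ t : ℝ, 0 < t → t ≤ 1 → (t : ℂ) * z ∈ thickening δ C := by
    intro z hz t ht ht1
    rw [mem_thickening_iff] at hz ⊢
    obtain ⟨c, hc, hzc⟩ := hz
    refine ⟨t * c, ?_, ?_⟩
    · rcases hc with hc | ⟨τ, hτ, rfl⟩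
      · left
        simp only [mem_closedBall_zero_iff, norm_mul, Complex.norm_real,
          Real.norm_of_nonneg ht.le] at hc ⊢
        nlinarith [norm_nonneg c]
      · right
        exact ⟨t * τ, ⟨mul_nonneg ht.le hτ.1, by nlinarith [hτ.1, hτ.2]⟩, by push_cast; ring⟩
    · rw [dist_eq_norm, ← mul_sub, norm_mul, Complex.norm_real, Real.norm_of_nonneg ht.le,
        ← dist_eq_norm]
      nlinarith [dist_nonneg (x := z) (y := c)]
  have hball : ∀ z : ℂ, ‖z‖ < r + δ → z ∈ thickening δ C := by
    intro z hz
    apply thickening_subset_of_subset δ (subset_union_left : closedBall 0 r ⊆ C)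
    rw [thickening_closedBall hδ hr.le, mem_ball_zero_iff]
    linarith
  set T : Set ℂ := {z | z ∈ thickening δ C ∧ r < ‖z‖ ∧ ∀ t : ℝ, 0 ≤ t → z ≠ t * b} with hT
  set ρ := r + δ / 2
  have hρ : 0 < ρ := by positivity
  have hcirc : {z : ℂ | ‖z‖ = ρ ∧ ∀ t : ℝ, 0 ≤ t → z ≠ t * b} ⊆ T := fun z hz =>
    ⟨hball z (by rw [hz.1]; simp only [ρ]; linarith), by rw [hz.1]; simp only [ρ]; linarith, hz.2⟩
  have hTp : IsPreconnected T := by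
    have hscale : ∀ z ∈ T, ∀ c : ℝ, 0 < c → ∀ t : ℝ, 0 ≤ t → (c : ℂ) * z ≠ t * b := by
      intro z hz c hc t ht h
      apply hz.2.2 (t / c) (by positivity)
      have : (c : ℂ) ≠ 0 := by exact_mod_cast hc.ne'
      push_cast; field_simp; linear_combination h
    -- Each point of `T` slides radially to the circle of radius `ρ`: inwards this stays in the
    -- neighbourhood because the latter is stable under scaling by `t ≤ 1`, outwards because norms
    -- up to `ρ` belong to it anyway. The ray is never crossed.
    have key : ∀ z ∈ T, ∃ U ⊆ T, IsPreconnected U ∧ z ∈ U ∧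
        {z : ℂ | ‖z‖ = ρ ∧ ∀ t : ℝ, 0 ≤ t → z ≠ t * b} ⊆ U := by
      intro z hz
      have hz0 : 0 < ‖z‖ := hr.trans hz.2.1
      set c := ρ / ‖z‖ with hc
      have hc0 : 0 < c := by positivity
      have hcz : c * ‖z‖ = ρ := by rw [hc]; field_simp
      refine ⟨(fun t : ℝ => (t : ℂ) * z) '' uIcc c 1 ∪
        {z : ℂ | ‖z‖ = ρ ∧ ∀ t : ℝ, 0 ≤ t → z ≠ t * b}, union_subset ?_ hcirc, ?_,
        Or.inl ⟨1, right_mem_uIcc, by simp⟩, subset_union_right⟩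
      · rintro _ ⟨t, ht, rfl⟩
        have ht0 : 0 < t := lt_of_lt_of_le (lt_min hc0 one_pos) (by simpa [uIcc] using ht.1)
        have htn : ‖(t : ℂ) * z‖ = t * ‖z‖ := by
          rw [norm_mul, Complex.norm_real, Real.norm_of_nonneg ht0.le]
        refine ⟨?_, ?_, hscale z hz t ht0⟩
        · rcases le_or_gt t 1 with h | h
          · exact hNs z hz.1 t ht0 h
          · apply hball
            rw [htn]
            have : t ≤ c := by
              rcases (mem_uIcc.1 ht) with h' | h'
              · exact absurd h'.2 (not_le.2 h)
              · exact h'.2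
            have h3 : t * ‖z‖ ≤ ρ := by rw [← hcz]; gcongr
            exact h3.trans_lt (by simp only [ρ]; linarith)
        · change r < ‖(t : ℂ) * z‖
          rw [htn]
          rcases (mem_uIcc.1 ht) with h' | h'
          · have h3 : ρ ≤ t * ‖z‖ := by rw [← hcz]; gcongr; exact h'.1
            exact lt_of_lt_of_le (by simp only [ρ]; linarith) h3
          · nlinarith [hz.2.1]
      · refine IsPreconnected.union (c * z) ⟨c, left_mem_uIcc, rfl⟩ ⟨?_, hscale z hz c hc0⟩
          (isPreconnected_uIcc.image _ (by fun_prop)) (isPreconnected_sphere_diff_ray hb0 hρ)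
        rw [norm_mul, Complex.norm_real, Real.norm_of_nonneg hc0.le, hcz]
    apply isPreconnected_of_forall_pair
    intro x hx y hy
    obtain ⟨U, hUT, hU, hxU, hUc⟩ := key x hx
    obtain ⟨U', hUT', hU', hyU, hUc'⟩ := key y hy
    have hne : (-(ρ / ‖b‖ : ℝ) * b : ℂ) ∈ {z : ℂ | ‖z‖ = ρ ∧ ∀ t : ℝ, 0 ≤ t → z ≠ t * b} := by
      constructor
      · rw [norm_mul, norm_neg, Complex.norm_real, Real.norm_of_nonneg (by positivity)]
        field_simp
      · intro t ht h
        have h1 := mul_right_cancel₀ hb0 h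
        have h2 : -(ρ / ‖b‖) = t := by exact_mod_cast h1
        have : 0 < ρ / ‖b‖ := by positivity
        linarith
    exact ⟨U ∪ U', union_subset hUT hUT', Or.inl hxU, Or.inr hyU,
      hU.union _ (hUc hne) (hUc' hne) hU'⟩
  have hmax : ∀ z ∈ thickening δ C, ‖z‖ < ‖b‖ := by
    intro z hz
    rw [mem_thickening_iff] at hz
    obtain ⟨c, hc, hzc⟩ := hz
    have hcn : ‖c‖ ≤ s * ‖b‖ := by
      rcases hc with hc | ⟨τ, hτ, rfl⟩
      · exact (mem_closedBall_zero_iff.1 hc).trans hsr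
      · rw [norm_mul, Complex.norm_real, Real.norm_of_nonneg hτ.1]
        exact mul_le_mul_of_nonneg_right hτ.2 hb0'.le
    have h1 : ‖z‖ ≤ ‖z - c‖ + ‖c‖ := by simpa using norm_add_le (z - c) c
    rw [dist_eq_norm] at hzc
    have h2 : δ ≤ (1 - s) * ‖b‖ := min_le_right _ _
    linarith
  have hNT : thickening δ C ∩
      (closedBall 0 r ∪ (fun t : ℝ => (t : ℂ) * b) '' Icc 0 1 ∪ K)ᶜ ⊆ T := by
    rintro z ⟨hz, hzE⟩
    refine ⟨hz, ?_, ?_⟩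
    · by_contra! h
      exact hzE (Or.inl (Or.inl (by simpa using h)))
    · rintro t ht rfl
      refine hzE (Or.inl (Or.inr ⟨t, ⟨ht, ?_⟩, rfl⟩))
      have := hmax _ hz
      rw [norm_mul, Complex.norm_real, Real.norm_of_nonneg ht] at this
      nlinarith
  have hTE : T ⊆ (closedBall 0 r ∪ (fun t : ℝ => (t : ℂ) * b) '' Icc 0 1 ∪ K)ᶜ := by
    rintro z ⟨hz, hzr, hzt⟩ ((h | ⟨t, ht, rfl⟩) | h)
    · simp at h; linarith
    · exact hzt t ht.1 rfl
    · exact hδK hz h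
  exact ⟨T, hTp, hTE,
    ⟨_, isOpen_thickening.mem_nhds (self_subset_thickening hδ C (h₁ s hs.1)), hNT⟩,
    ⟨_, isOpen_thickening.mem_nhds (self_subset_thickening hδ C (h₂ s hs.2)), hNT⟩⟩

end SlitTopology
-- Runge's theorem by spectra in the closed algebra of polynomials.
section Runge
open Set Metric Topology Polynomial

/-- Functions on `E` that are uniform limits of polynomials. -/
def IsPolyApprox (E : Set ℂ) (f : ℂ → ℂ) : Prop :=
  ∀ ε > 0, ∃ p : ℂ[X], ∀ z ∈ E, ‖p.eval z - f z‖ < ε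

/-- The closed subspace of `C(E, ℂ)` spanned by polynomials. -/
noncomputable def polyClosure (E : Set ℂ) [CompactSpace E] : Subalgebra ℂ C(E, ℂ) :=
  (polynomialFunctions E).topologicalClosure

theorem mem_polyClosure_iff {E : Set ℂ} [CompactSpace E] (f : C(E, ℂ)) (g : ℂ → ℂ)
    (hfg : ∀ z : E, f z = g z) : f ∈ polyClosure E ↔ IsPolyApprox E g := by
  rw [polyClosure, ← SetLike.mem_coe, Subalgebra.topologicalClosure_coe, Metric.mem_closure_iff]
  constructor
  · intro h ε hε
    obtain ⟨_, ⟨p, -, rfl⟩, hp⟩ := h ε hε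
    refine ⟨p, fun z hz => ?_⟩
    rw [ContinuousMap.dist_lt_iff hε] at hp
    have := hp ⟨z, hz⟩
    rw [hfg, dist_comm, dist_eq_norm] at this
    simpa using this
  · intro h ε hε
    obtain ⟨p, hp⟩ := h ε hε
    refine ⟨p.toContinuousMapOn E, ⟨p, by simp, rfl⟩, ?_⟩
    rw [ContinuousMap.dist_lt_iff hε]
    intro z
    have := hp z z.2
    rw [hfg, dist_comm, dist_eq_norm]
    simpa using this

/-- Runge's theorem for simple poles. -/
theorem isPolyApprox_inv_sub {E : Set ℂ} (hE : IsCompact E) (hEc : IsPreconnected Eᶜ) {w : ℂ}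
    (hw : w ∉ E) : IsPolyApprox E fun z => (w - z)⁻¹ := by
  have : CompactSpace E := isCompact_iff_compactSpace.1 hE
  let x : C(E, ℂ) := ⟨Subtype.val, continuous_subtype_val⟩
  have hx : x ∈ polyClosure E := by
    rw [mem_polyClosure_iff x id (fun z => rfl)]
    intro ε hε
    exact ⟨X, fun z _ => by simpa using hε⟩
  have hσ : spectrum ℂ x = E := by
    rw [ContinuousMap.spectrum_eq_range]
    simp [x]
  have : IsClosed (polyClosure E : Set C(E, ℂ)) := Subalgebra.isClosed_topologicalClosure _
  -- Passing to a closed subalgebra can only fill bounded components of the complement of the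
  -- spectrum. As there are none, `w - z` stays invertible inside the closure of the polynomials.
  have h1 := Subalgebra.spectrum_eq_of_isPreconnected_compl (𝕜 := ℂ) (polyClosure E) ⟨x, hx⟩
    (by rw [hσ]; exact hEc)
  have h2 : w ∉ spectrum ℂ (⟨x, hx⟩ : polyClosure E) := by rw [h1, hσ]; exact hw
  rw [spectrum.notMem_iff] at h2
  obtain ⟨⟨u, v, huv, -⟩, rfl : u = _⟩ := h2
  refine (mem_polyClosure_iff v.1 _ fun z => ?_).1 v.2
  have h3 := congrArg (fun f : polyClosure E => f.1 z) huv
  simp only [MulMemClass.coe_mul, ContinuousMap.mul_apply] at h3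
  exact eq_inv_of_mul_eq_one_right h3

/-- Integrals over a circle of functions that are uniform limits of polynomials are again such. -/
theorem isPolyApprox_circleIntegral {E : Set ℂ} (hE : IsCompact E) {c : ℂ} {ρ : ℝ}
    (k : ℂ → ℂ → ℂ)
    (hk : ContinuousOn (fun p : ℂ × ℂ => k p.1 p.2) (sphere c |ρ| ×ˢ E))
    (hp : ∀ ζ ∈ sphere c |ρ|, IsPolyApprox E (k ζ)) :
    IsPolyApprox E fun z => ∮ ζ in C(c, ρ), k ζ z := by
  have : CompactSpace E := isCompact_iff_compactSpace.1 hE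
  have hcont : Continuous fun p : ℝ × E => k (circleMap c ρ p.1) p.2 := by
    have : Continuous fun p : ℝ × E => ((circleMap c ρ p.1, (p.2 : ℂ)) : ℂ × ℂ) := by fun_prop
    exact hk.comp_continuous this fun p => ⟨circleMap_mem_sphere' c ρ p.1, p.2.2⟩
  let κ : ℝ → C(E, ℂ) := fun θ => ⟨fun z => k (circleMap c ρ θ) z,
    hcont.comp (Continuous.prodMk_right θ)⟩
  have hκ : Continuous κ := ContinuousMap.continuous_of_continuous_uncurry _ hcont
  let F : ℝ → C(E, ℂ) := fun θ => deriv (circleMap c ρ) θ • κ θ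
  have hF : Continuous F := by
    have : Continuous fun θ => deriv (circleMap c ρ) θ := by
      simp only [deriv_circleMap]; fun_prop
    exact this.smul hκ
  have hFi := hF.intervalIntegrable 0 (2 * Real.pi) (μ := MeasureTheory.volume)
  have hmem : (∫ θ in (0)..(2 * Real.pi), F θ) ∈ polyClosure E := by
    have hcl : IsClosed ((polyClosure E).toSubmodule : Set C(E, ℂ)) :=
      Subalgebra.isClosed_topologicalClosure _
    have := hcl
    -- The quotient map by the closed subspace commutes with the integral and annihilates the
    -- integrand.
    have h0 : (polyClosure E).toSubmodule.mkQL (∫ θ in (0)..(2 * Real.pi), F θ) = 0 := by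
      rw [← ContinuousLinearMap.intervalIntegral_comp_comm _ hFi]
      have : ∀ θ, (polyClosure E).toSubmodule.mkQL (F θ) = 0 := by
        intro θ
        rw [Submodule.mkQL_apply, Submodule.mkQ_apply, Submodule.Quotient.mk_eq_zero]
        exact (polyClosure E).smul_mem ((mem_polyClosure_iff (κ θ) _ fun z => rfl).2
          (hp _ (circleMap_mem_sphere' c ρ θ))) _
      simp [this]
    rw [Submodule.mkQL_apply, Submodule.mkQ_apply, Submodule.Quotient.mk_eq_zero] at h0
    exact h0
  refine (mem_polyClosure_iff _ _ fun z => ?_).1 hmem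
  rw [circleIntegral, ← ContinuousMap.evalCLM_apply ℂ z,
    ← ContinuousLinearMap.intervalIntegral_comp_comm _ hFi]
  rfl

end Runge
-- Polynomial approximation on a disc and on a conformal copy of it.
section RungePair
open Set Metric Topology Polynomial

/-- A holomorphic injective map has nowhere vanishing difference quotients. -/
theorem dslope_ne_zero_of_injOn {φ : ℂ → ℂ} {U : Set ℂ} (hinj : InjOn φ U)
    (hd : ∀ z ∈ U, deriv φ z ≠ 0) {z ζ : ℂ} (hz : z ∈ U) (hζ : ζ ∈ U) : dslope φ z ζ ≠ 0 := by
  rcases eq_or_ne ζ z with rfl | h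
  · rw [dslope_same]; exact hd _ hζ
  · rw [dslope_of_ne _ h, slope_def_field]
    exact div_ne_zero (sub_ne_zero.2 fun h' => h (hinj hζ hz h')) (sub_ne_zero.2 h)

/-- Cauchy's integral formula on the image of a disc under an injective holomorphic map. -/
theorem circleIntegral_image_eq {φ h : ℂ → ℂ} {ρ R : ℝ} (hρR : ρ < R)
    (hφ : DifferentiableOn ℂ φ (ball 0 R)) (hinj : InjOn φ (ball 0 R))
    (hd : ∀ z ∈ ball (0 : ℂ) R, deriv φ z ≠ 0) (hh : DifferentiableOn ℂ h (ball 0 R))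
    {z : ℂ} (hz : z ∈ ball (0 : ℂ) ρ) :
    ∮ ζ in C(0, ρ), h ζ * deriv φ ζ * (φ ζ - φ z)⁻¹ = 2 * Real.pi * Complex.I * h z := by
  have hzR : z ∈ ball (0 : ℂ) R := ball_subset_ball hρR.le hz
  have hsub : closedBall (0 : ℂ) ρ ⊆ ball 0 R := closedBall_subset_ball hρR
  have hρ : 0 < ρ := pos_of_mem_ball hz
  -- Dividing by the zero-free function `dslope φ z` turns the kernel `1 / (φ ζ - φ z)` into `1 / (ζ
  -- - z)`; the new numerator takes the value `h z` at `z`.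
  have hF : DifferentiableOn ℂ (fun ζ => h ζ * deriv φ ζ / dslope φ z ζ) (ball 0 R) :=
    (hh.mul (hφ.deriv isOpen_ball)).div
      ((Complex.differentiableOn_dslope (isOpen_ball.mem_nhds hzR)).2 hφ)
      fun ζ hζ => dslope_ne_zero_of_injOn hinj hd hzR hζ
  have := Complex.circleIntegral_sub_inv_smul_of_differentiable_on_off_countable
    (f := fun ζ => h ζ * deriv φ ζ / dslope φ z ζ) (s := ∅) (by simp) hz
    (hF.continuousOn.mono hsub)
    (fun ζ hζ => hF.differentiableAt (isOpen_ball.mem_nhds (hsub (ball_subset_closedBall hζ.1))))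
  rw [dslope_same, mul_div_cancel_right₀ _ (hd z hzR), smul_eq_mul] at this
  rw [← this]
  refine circleIntegral.integral_congr hρ.le fun ζ hζ => ?_
  have hne : ζ ≠ z := by
    rintro rfl
    simp at hz hζ
    linarith
  have hζR : ζ ∈ ball (0 : ℂ) R := hsub (sphere_subset_closedBall hζ)
  have h1 : φ ζ - φ z ≠ 0 := sub_ne_zero.2 fun h' => hne (hinj hζR hzR h')
  have h2 : ζ - z ≠ 0 := sub_ne_zero.2 hne
  simp only [dslope_of_ne _ hne, slope_def_field, smul_eq_mul]
  field_simp

theorem circleIntegral_image_eq_zero {φ h : ℂ → ℂ} {ρ R : ℝ} (hρ : 0 ≤ ρ) (hρR : ρ < R)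
    (hφ : DifferentiableOn ℂ φ (ball 0 R)) (hh : DifferentiableOn ℂ h (ball 0 R))
    {w : ℂ} (hw : w ∉ φ '' closedBall 0 ρ) :
    ∮ ζ in C(0, ρ), h ζ * deriv φ ζ * (φ ζ - w)⁻¹ = 0 := by
  have hsub : closedBall (0 : ℂ) ρ ⊆ ball 0 R := closedBall_subset_ball hρR
  have hF : ∀ ζ ∈ closedBall (0 : ℂ) ρ,
      DifferentiableAt ℂ (fun ζ => h ζ * deriv φ ζ * (φ ζ - w)⁻¹) ζ := by
    intro ζ hζ
    have hn := isOpen_ball.mem_nhds (hsub hζ)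
    refine ((hh.differentiableAt hn).mul ((hφ.deriv isOpen_ball).differentiableAt hn)).mul
      (((hφ.differentiableAt hn).sub_const w).inv (sub_ne_zero.2 fun h' => hw ⟨ζ, hζ, h'⟩))
  exact Complex.circleIntegral_eq_zero_of_differentiable_on_off_countable hρ (s := ∅) (by simp)
    (fun ζ hζ => (hF ζ hζ).continuousAt.continuousWithinAt)
    (fun ζ hζ => hF ζ (ball_subset_closedBall hζ.1))

/-- The open mapping property of holomorphic maps with nonvanishing derivative. -/
theorem isOpen_image_of_deriv_ne_zero {φ : ℂ → ℂ} {U : Set ℂ} (hU : IsOpen U)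
    (hφ : DifferentiableOn ℂ φ U) (hd : ∀ z ∈ U, deriv φ z ≠ 0) : IsOpen (φ '' U) := by
  rw [isOpen_iff_mem_nhds]
  rintro _ ⟨z, hz, rfl⟩
  have h := ((hφ.analyticAt (hU.mem_nhds hz)).hasStrictDerivAt).map_nhds_eq (hd z hz)
  rw [← h]
  exact Filter.image_mem_map (hU.mem_nhds hz)

theorem isPreconnected_compl_image_closedBall_of_holo {φ : ℂ → ℂ} {r R : ℝ} (hr : 0 < r)
    (hrR : r < R) (hφ : DifferentiableOn ℂ φ (ball 0 R)) (hinj : InjOn φ (ball 0 R))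
    (hd : ∀ z ∈ ball (0 : ℂ) R, deriv φ z ≠ 0) : IsPreconnected (φ '' closedBall 0 r)ᶜ :=
  isPreconnected_compl_image_closedBall hr hrR hφ.continuousOn hinj fun _ hU hUo =>
    isOpen_image_of_deriv_ne_zero hUo (hφ.mono hU) fun z hz => hd z (hU hz)

/-- Approximation on the image of a disc by polynomials that are small on a compact set. -/
theorem exists_polynomial_image_approx {φ h : ℂ → ℂ} {E : Set ℂ} {r ρ R : ℝ} (hr : 0 < r)
    (hrρ : r < ρ) (hρR : ρ < R)
    (hφ : DifferentiableOn ℂ φ (ball 0 R)) (hinj : InjOn φ (ball 0 R))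
    (hd : ∀ z ∈ ball (0 : ℂ) R, deriv φ z ≠ 0) (hh : DifferentiableOn ℂ h (ball 0 R))
    (hE : IsCompact E) (hEc : IsPreconnected (E ∪ φ '' closedBall 0 r)ᶜ)
    (hEφ : Disjoint E (φ '' closedBall 0 ρ)) {ε : ℝ} (hε : 0 < ε) :
    ∃ p : ℂ[X], (∀ z ∈ E, ‖p.eval z‖ < ε) ∧
      ∀ z ∈ closedBall (0 : ℂ) r, ‖p.eval (φ z) - h z‖ < ε := by
  have hsub : closedBall (0 : ℂ) ρ ⊆ ball 0 R := closedBall_subset_ball hρR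
  have hrsub : closedBall (0 : ℂ) r ⊆ ball 0 ρ := closedBall_subset_ball hrρ
  have hρ : 0 < ρ := hr.trans hrρ
  set K := φ '' closedBall 0 r
  have hK : IsCompact K := (isCompact_closedBall 0 r).image_of_continuousOn
    (hφ.continuousOn.mono (hrsub.trans (ball_subset_ball hρR.le)))
  have hne : ∀ ζ ∈ sphere (0 : ℂ) |ρ|, φ ζ ∉ E ∪ K := by
    rw [abs_of_pos hρ]
    rintro ζ hζ (h | ⟨z, hz, hzζ⟩)
    · exact hEφ.le_bot ⟨h, ζ, sphere_subset_closedBall hζ, rfl⟩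
    · have h1 := hinj (hsub (ball_subset_closedBall (hrsub hz)))
        (hsub (sphere_subset_closedBall hζ)) hzζ
      rw [h1] at hz
      simp at hz hζ
      linarith
  have hk : ContinuousOn (fun p : ℂ × ℂ => h p.1 * deriv φ p.1 * (φ p.1 - p.2)⁻¹)
      (sphere (0 : ℂ) |ρ| ×ˢ (E ∪ K)) := by
    have h1 : MapsTo Prod.fst (sphere (0 : ℂ) |ρ| ×ˢ (E ∪ K)) (ball 0 R) := by
      rintro p ⟨hp, -⟩
      rw [abs_of_pos hρ] at hp
      exact hsub (sphere_subset_closedBall hp)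
    refine ((hh.continuousOn.comp continuousOn_fst h1).mul
      ((hφ.deriv isOpen_ball).continuousOn.comp continuousOn_fst h1)).mul
      (((hφ.continuousOn.comp continuousOn_fst h1).sub continuousOn_snd).inv₀ ?_)
    rintro p ⟨hp1, hp2⟩ h0
    have h2 : φ p.1 = p.2 := sub_eq_zero.1 h0
    exact hne p.1 hp1 (h2 ▸ hp2)
  -- The Cauchy integral over the circle of radius `ρ` equals `2πi h z` at `φ z` and `0` on `E`, so
  -- a polynomial close to it serves both purposes. Its kernels are simple poles off `E ∪ K`.
  have hpa := isPolyApprox_circleIntegral (hE.union hK)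
    (fun ζ z => h ζ * deriv φ ζ * (φ ζ - z)⁻¹) hk ?_
  · have hpi : 0 < 2 * Real.pi := by positivity
    obtain ⟨p, hp⟩ := hpa (2 * Real.pi * ε) (by positivity)
    have hc : ‖(2 * Real.pi * Complex.I : ℂ)⁻¹‖ * (2 * Real.pi * ε) = ε := by
      simp [abs_of_pos Real.pi_pos]; field_simp
    have hc0 : 0 < ‖(2 * Real.pi * Complex.I : ℂ)⁻¹‖ := by
      simp [Real.pi_ne_zero]
    refine ⟨C (2 * Real.pi * Complex.I : ℂ)⁻¹ * p, fun z hz => ?_, fun z hz => ?_⟩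
    · have := hp z (Or.inl hz)
      beta_reduce at this
      rw [circleIntegral_image_eq_zero hρ.le hρR hφ hh
        (fun h' => hEφ.le_bot ⟨hz, h'⟩), sub_zero] at this
      rw [eval_mul, eval_C, norm_mul, ← hc]
      gcongr
    · have := hp (φ z) (Or.inr ⟨z, hz, rfl⟩)
      beta_reduce at this
      rw [circleIntegral_image_eq hρR hφ hinj hd hh (hrsub hz)] at this
      have h3 : eval (φ z) (C (2 * Real.pi * Complex.I : ℂ)⁻¹ * p) - h z =
          (2 * Real.pi * Complex.I : ℂ)⁻¹ * (eval (φ z) p - 2 * Real.pi * Complex.I * h z) := by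
        rw [eval_mul, eval_C, mul_sub, ← mul_assoc, inv_mul_cancel₀, one_mul]
        simp [Real.pi_ne_zero]
      rw [h3, norm_mul, ← hc]
      gcongr
  · intro ζ hζ ε' hε'
    set a := h ζ * deriv φ ζ
    obtain ⟨p, hp⟩ := isPolyApprox_inv_sub (hE.union hK) hEc (hne ζ hζ) (ε' / (‖a‖ + 1))
      (by positivity)
    refine ⟨C a * p, fun z hz => ?_⟩
    rw [eval_mul, eval_C, ← mul_sub, norm_mul]
    have h1 := hp z hz
    have h2 : (‖a‖ + 1) * (ε' / (‖a‖ + 1)) = ε' := by field_simp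
    nlinarith [norm_nonneg a, norm_nonneg (eval z p - (φ ζ - z)⁻¹)]

/-- Holomorphic functions on a disc are uniform limits of polynomials on smaller discs. -/
theorem exists_polynomial_closedBall_approx {h : ℂ → ℂ} {r R : ℝ} (hr : 0 < r) (hrR : r < R)
    (hh : DifferentiableOn ℂ h (ball 0 R)) {ε : ℝ} (hε : 0 < ε) :
    ∃ p : ℂ[X], ∀ z ∈ closedBall (0 : ℂ) r, ‖p.eval z - h z‖ < ε := by
  obtain ⟨ρ, h1, h2⟩ := exists_between hrR
  obtain ⟨p, -, hp⟩ := exists_polynomial_image_approx (φ := id) (h := h) (E := ∅) hr h1 h2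
    differentiableOn_id (injOn_id _) (by simp) hh isCompact_empty
    (by
      rw [empty_union]
      exact isPreconnected_compl_image_closedBall_of_holo hr hrR differentiableOn_id (injOn_id _)
        (by simp)) (by simp) hε
  exact ⟨p, hp⟩

/-- Simultaneous polynomial approximation on a disc and on a disjoint conformal image of it. -/
theorem exists_polynomial_pair_approx {φ h₀ h₁ : ℂ → ℂ} {r ρ R : ℝ} (hr : 0 < r)
    (hrρ : r < ρ) (hρR : ρ < R)
    (hφ : DifferentiableOn ℂ φ (ball 0 R)) (hinj : InjOn φ (ball 0 R))
    (hd : ∀ z ∈ ball (0 : ℂ) R, deriv φ z ≠ 0) (hh₀ : DifferentiableOn ℂ h₀ (ball 0 R))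
    (hh₁ : DifferentiableOn ℂ h₁ (ball 0 R))
    (hdisj : Disjoint (closedBall 0 r) (φ '' closedBall 0 ρ)) {ε : ℝ} (hε : 0 < ε) :
    ∃ p : ℂ[X], (∀ z ∈ closedBall (0 : ℂ) r, ‖p.eval z - h₀ z‖ < ε) ∧
      ∀ z ∈ closedBall (0 : ℂ) r, ‖p.eval (φ z) - h₁ z‖ < ε := by
  have hrR := hrρ.trans hρR
  obtain ⟨p₀, hp₀⟩ := exists_polynomial_closedBall_approx hr hrR hh₀ (half_pos hε)
  have hcl : IsClosed (φ '' closedBall 0 r) := ((isCompact_closedBall 0 r).image_of_continuousOn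
    (hφ.continuousOn.mono (closedBall_subset_ball hrR))).isClosed
  -- The correction `p₁` is small on the disc and repairs the error of `p₀` on the copy.
  obtain ⟨p₁, h1, h2⟩ := exists_polynomial_image_approx (h := fun z => h₁ z - p₀.eval (φ z))
    hr hrρ hρR hφ hinj hd (hh₁.sub (p₀.differentiable.comp_differentiableOn hφ))
    (isCompact_closedBall (0 : ℂ) r)
    (isPreconnected_compl_closedBall_union hr hcl
      (isPreconnected_compl_image_closedBall_of_holo hr hrR hφ hinj hd)
      (hdisj.mono_right (image_mono (closedBall_subset_closedBall hrρ.le)))) hdisj (half_pos hε)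
  refine ⟨p₀ + p₁, fun z hz => ?_, fun z hz => ?_⟩
  · calc ‖(p₀ + p₁).eval z - h₀ z‖ = ‖(p₀.eval z - h₀ z) + p₁.eval z‖ := by
          rw [eval_add]; ring_nf
      _ ≤ _ := norm_add_le _ _
      _ < ε := by linarith [hp₀ z hz, h1 z hz]
  · have := h2 z hz
    have h3 : (p₀ + p₁).eval (φ z) - h₁ z = p₁.eval (φ z) - (h₁ z - p₀.eval (φ z)) := by
      rw [eval_add]; ring
    rw [h3]; linarith

end RungePair
-- Entire solutions of linear second order equations.
section LinearODE
open Set Metric Topology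

/-- Integration along the radius. The gained factor `1 / (n + 1)` produces the factorials in the
Picard iteration below. -/
theorem norm_le_of_hasDerivAt_of_norm_le_pow {f g : ℂ → ℂ} {A ρ : ℝ} {n : ℕ} (h0 : g 0 = 0)
    (hg : ∀ z, HasDerivAt g (f z) z) (hf : ∀ z : ℂ, ‖z‖ ≤ ρ → ‖f z‖ ≤ A * ‖z‖ ^ n) {z : ℂ}
    (hz : ‖z‖ ≤ ρ) : ‖g z‖ ≤ A * ‖z‖ ^ (n + 1) / (n + 1) := by
  have hd : ∀ t : ℝ, HasDerivAt (fun t : ℝ => g (t * z)) (f (t * z) * z) t := by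
    intro t
    have h1 : HasDerivAt (fun t : ℝ => (t : ℂ) * z) (1 * z) t :=
      (Complex.ofRealCLM.hasDerivAt (x := t)).mul_const z
    rw [one_mul] at h1
    exact (hg _).comp t h1
  have hB : ∀ t : ℝ, HasDerivAt (fun t : ℝ => A * ‖z‖ ^ (n + 1) / (n + 1) * t ^ (n + 1))
      (A * ‖z‖ ^ (n + 1) * t ^ n) t := by
    intro t
    have := (hasDerivAt_pow (n + 1) t).const_mul (A * ‖z‖ ^ (n + 1) / (n + 1))
    refine this.congr_deriv ?_
    have : (n : ℝ) + 1 ≠ 0 := by positivity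
    rw [Nat.add_sub_cancel]
    push_cast
    field_simp
  have := image_norm_le_of_norm_deriv_right_le_deriv_boundary (a := 0) (b := 1)
    (f := fun t : ℝ => g (t * z)) (f' := fun t => f (t * z) * z)
    (fun t _ => (hd t).continuousAt.continuousWithinAt) (fun t _ => (hd t).hasDerivWithinAt)
    (B := fun t : ℝ => A * ‖z‖ ^ (n + 1) / (n + 1) * t ^ (n + 1)) (by simp [h0]) hB
    (fun t ht => ?_) (right_mem_Icc.2 zero_le_one)
  · simpa using this
  · have hn : ‖(t : ℂ) * z‖ = t * ‖z‖ := by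
      rw [norm_mul, Complex.norm_real, Real.norm_of_nonneg ht.1]
    rw [norm_mul]
    have := hf (t * z) (by rw [hn]; nlinarith [ht.1, ht.2, norm_nonneg z])
    rw [hn] at this
    calc ‖f (t * z)‖ * ‖z‖ ≤ A * (t * ‖z‖) ^ n * ‖z‖ := by gcongr
      _ = _ := by ring

/-- Picard iteration: starting from `α + β z`, each term is the twofold primitive of `q` times the
preceding one, and the sum is differentiated term by term under a factorial majorant. -/
theorem exists_entire_ode_solution_zero {q : ℂ → ℂ} (hq : Differentiable ℂ q) (α β : ℂ) :
    ∃ u v : ℂ → ℂ, u 0 = α ∧ v 0 = β ∧ (∀ z, HasDerivAt u (v z) z) ∧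
      ∀ z, HasDerivAt v (q z * u z) z := by
  have hprim : ∀ f : ℂ → ℂ, ∃ g : ℂ → ℂ, Differentiable ℂ f →
      g 0 = 0 ∧ ∀ z, HasDerivAt g (f z) z := by
    intro f
    by_cases hf : Differentiable ℂ f
    · obtain ⟨g, hg0, hg⟩ := hf.isExactOn_univ.with_val_at 0 0
      exact ⟨g, fun _ => ⟨hg0, fun z => hg z (mem_univ z)⟩⟩
    · exact ⟨0, fun h => absurd h hf⟩
  choose P hP using hprim
  let V : ℕ → ℂ → ℂ := fun n => Nat.rec (fun z => α + β * z) (fun _ W => P (P (q * W))) n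
  -- `D n` and `E n` are the first and second derivatives of `V n`. Since `E 0 = 0` and `E (n + 1) =
  -- q * V n`, summation gives the equation.
  let D : ℕ → ℂ → ℂ := fun n => Nat.casesOn n (fun _ => β) (fun m => P (q * V m))
  let E : ℕ → ℂ → ℂ := fun n => Nat.casesOn n (fun _ => 0) (fun m => q * V m)
  have hVs : ∀ n, V (n + 1) = P (P (q * V n)) := fun n => rfl
  have hVd : ∀ n, Differentiable ℂ (V n) := by
    intro n
    induction n with
    | zero => simp only [V]; fun_prop
    | succ n ih =>
      have h1 := (hP _ (hq.mul ih)).2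
      have h2 : Differentiable ℂ (P (q * V n)) := fun z => (h1 z).differentiableAt
      exact fun z => ((hP _ h2).2 z).differentiableAt
  have hPd : ∀ n, Differentiable ℂ (P (q * V n)) := fun n z =>
    ((hP _ (hq.mul (hVd n))).2 z).differentiableAt
  have hV : ∀ n z, HasDerivAt (V n) (D n z) z := by
    rintro (_ | n) z
    · simpa [V, D] using ((hasDerivAt_id z).const_mul β).const_add α
    · exact (hP _ (hPd n)).2 z
  have hD : ∀ n z, HasDerivAt (D n) (E n z) z := by
    rintro (_ | n) z
    · exact hasDerivAt_const z β
    · exact (hP _ (hq.mul (hVd n))).2 z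
  have hbound : ∀ ρ : ℝ, 0 < ρ → ∃ M C K : ℝ, 0 ≤ M ∧ 0 ≤ C ∧ 0 ≤ K ∧
      (∀ z : ℂ, ‖z‖ ≤ ρ → ‖q z‖ ≤ M) ∧
      ∀ n, ∀ z : ℂ, ‖z‖ ≤ ρ → ‖V n z‖ ≤ C * K ^ n / n.factorial * ‖z‖ ^ n := by
    intro ρ hρ
    obtain ⟨M, hM⟩ := (isCompact_closedBall (0 : ℂ) ρ).exists_bound_of_continuousOn
      hq.continuous.continuousOn
    have hM' : ∀ z : ℂ, ‖z‖ ≤ ρ → ‖q z‖ ≤ M := fun z hz => hM z (by simpa using hz)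
    have hM0 : 0 ≤ M := (norm_nonneg _).trans (hM' 0 (by simpa using hρ.le))
    -- Only the inner of the two primitives is credited with `1 / (n + 1)`. The outer one costs a
    -- factor `‖z‖ ≤ ρ`, absorbed in `K = M * ρ`.
    refine ⟨M, ‖α‖ + ‖β‖ * ρ, M * ρ, hM0, by positivity, by positivity, hM', fun n => ?_⟩
    induction n with
    | zero =>
      intro z hz
      simp only [V, pow_zero, Nat.factorial_zero, Nat.cast_one, div_one, mul_one]
      refine (norm_add_le _ _).trans ?_
      rw [norm_mul]; gcongr
    | succ n ih =>
      intro z hz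
      have h1 : ∀ z : ℂ, ‖z‖ ≤ ρ → ‖P (q * V n) z‖ ≤
          M * ((‖α‖ + ‖β‖ * ρ) * (M * ρ) ^ n / n.factorial) * ‖z‖ ^ (n + 1) / (n + 1) :=
        fun z hz => norm_le_of_hasDerivAt_of_norm_le_pow (hP _ (hq.mul (hVd n))).1
          (hP _ (hq.mul (hVd n))).2 (fun w hw => by
            rw [Pi.mul_apply, norm_mul, mul_assoc]
            exact mul_le_mul (hM' w hw) (ih w hw) (norm_nonneg _) hM0) hz
      have h2 : ‖V (n + 1) z‖ ≤
          (M * ((‖α‖ + ‖β‖ * ρ) * (M * ρ) ^ n / n.factorial) * ‖z‖ ^ (n + 1) / (n + 1))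
            * ‖z‖ ^ (0 + 1) / ((0 : ℕ) + 1) := by
        refine norm_le_of_hasDerivAt_of_norm_le_pow (ρ := ‖z‖) (hP _ (hPd n)).1
          (hP _ (hPd n)).2 (fun w hw => ?_) le_rfl
        rw [pow_zero, mul_one]
        refine (h1 w (hw.trans hz)).trans ?_
        gcongr
      refine h2.trans ?_
      rw [Nat.factorial_succ]
      push_cast
      have : M * ((‖α‖ + ‖β‖ * ρ) * (M * ρ) ^ n / n.factorial) * ‖z‖ ^ (n + 1) / (n + 1)
            * ‖z‖ ^ (0 + 1) / (0 + 1) =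
          M * (‖α‖ + ‖β‖ * ρ) * (M * ρ) ^ n / (n.factorial * (n + 1)) * ‖z‖ ^ (n + 1) * ‖z‖ := by
        field_simp; simp
      rw [this]
      calc _ ≤ M * (‖α‖ + ‖β‖ * ρ) * (M * ρ) ^ n / (n.factorial * (n + 1)) *
            ‖z‖ ^ (n + 1) * ρ := by gcongr
        _ = _ := by field_simp; ring
  have hsumm : ∀ C x : ℝ, Summable fun n : ℕ => C * (x ^ n / n.factorial) := fun C x =>
    (Real.summable_pow_div_factorial x).mul_left C
  have hVE : ∀ ρ : ℝ, 0 < ρ → ∃ a : ℕ → ℝ, Summable a ∧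
      (∀ n, ∀ z ∈ ball (0 : ℂ) ρ, ‖V n z‖ ≤ a n) ∧ (∀ n, ∀ z ∈ ball (0 : ℂ) ρ, ‖D n z‖ ≤ a n) ∧
      ∀ n, ∀ z ∈ ball (0 : ℂ) ρ, ‖E n z‖ ≤ a n := by
    intro ρ hρ
    obtain ⟨M, C, K, hM, hC, hK, hq', hb⟩ := hbound ρ hρ
    have hb' : ∀ n, ∀ z ∈ ball (0 : ℂ) ρ, ‖V n z‖ ≤ C * ((K * ρ) ^ n / n.factorial) := by
      intro n z hz
      rw [mem_ball_zero_iff] at hz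
      refine (hb n z hz.le).trans ?_
      calc _ ≤ C * K ^ n / n.factorial * ρ ^ n := by gcongr
        _ = _ := by rw [mul_pow]; ring
    have hE' : ∀ n, ∀ z ∈ ball (0 : ℂ) ρ, ‖E (n + 1) z‖ ≤ M * C * ((K * ρ) ^ n / n.factorial) := by
      intro n z hz
      simp only [E, Pi.mul_apply, norm_mul]
      rw [mul_assoc]
      exact mul_le_mul (hq' z (by simpa using (mem_ball_zero_iff.1 hz).le)) (hb' n z hz)
        (norm_nonneg _) hM
    have hD' : ∀ n, ∀ z ∈ ball (0 : ℂ) ρ,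
        ‖D (n + 1) z‖ ≤ ρ * (M * C * ((K * ρ) ^ n / n.factorial)) := by
      intro n z hz
      have := norm_le_of_hasDerivAt_of_norm_le_pow (n := 0) (ρ := ‖z‖)
        (A := M * C * ((K * ρ) ^ n / n.factorial)) (hP _ (hq.mul (hVd n))).1
        (hP _ (hq.mul (hVd n))).2 (fun w hw => by
          rw [pow_zero, mul_one]
          exact hE' n w (mem_ball_zero_iff.2 (hw.trans_lt (mem_ball_zero_iff.1 hz)))) le_rfl
      refine this.trans ?_
      simp only [zero_add, pow_one, Nat.cast_zero, div_one]
      rw [mul_comm]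
      gcongr
      exact (mem_ball_zero_iff.1 hz).le
    set b : ℕ → ℝ := fun n => Nat.casesOn n ‖β‖
      (fun m => (ρ + 1) * (M * C * ((K * ρ) ^ m / m.factorial)))
    have hbs : Summable b := by
      rw [← summable_nat_add_iff 1]
      simpa [b, mul_assoc] using hsumm ((ρ + 1) * (M * C)) (K * ρ)
    have hb0 : ∀ n, 0 ≤ b n := by
      rintro (_ | n)
      · simp [b]
      · simp only [b]; positivity
    refine ⟨fun n => C * ((K * ρ) ^ n / n.factorial) + b n, (hsumm C (K * ρ)).add hbs,
      fun n z hz => (hb' n z hz).trans (by simp [hb0 n]), ?_, ?_⟩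
    · rintro (_ | n) z hz
      · simp [D, b, hC]
      · refine (hD' n z hz).trans ?_
        have h1 : 0 ≤ C * ((K * ρ) ^ (n + 1) / (n + 1).factorial) := by positivity
        have h2 : 0 ≤ M * C * ((K * ρ) ^ n / n.factorial) := by positivity
        simp only [b]
        linarith
    · rintro (_ | n) z hz
      · have h1 : E 0 z = 0 := rfl
        rw [h1, norm_zero]
        have := hb0 0
        positivity
      · refine (hE' n z hz).trans ?_
        have h1 : 0 ≤ C * ((K * ρ) ^ (n + 1) / (n + 1).factorial) := by positivity
        have h2 : 0 ≤ ρ * (M * C * ((K * ρ) ^ n / n.factorial)) := by positivity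
        simp only [b]
        linarith
  have hderiv : ∀ z, HasDerivAt (fun z => ∑' n, V n z) (∑' n, D n z) z ∧
      HasDerivAt (fun z => ∑' n, D n z) (∑' n, E n z) z ∧
      ∑' n, E n z = q z * ∑' n, V n z := by
    intro z
    obtain ⟨a, ha, h1, h2, h3⟩ := hVE (‖z‖ + 1) (by positivity)
    have h0 : (0 : ℂ) ∈ ball (0 : ℂ) (‖z‖ + 1) := mem_ball_self (by positivity)
    have hz : z ∈ ball (0 : ℂ) (‖z‖ + 1) := by simp
    refine ⟨hasDerivAt_tsum_of_isPreconnected ha isOpen_ball (convex_ball _ _).isPreconnected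
      (fun n y _ => hV n y) h2 h0 (Summable.of_norm_bounded ha fun n => h1 n 0 h0) hz,
      hasDerivAt_tsum_of_isPreconnected ha isOpen_ball (convex_ball _ _).isPreconnected
      (fun n y _ => hD n y) h3 h0 (Summable.of_norm_bounded ha fun n => h2 n 0 h0) hz, ?_⟩
    rw [(Summable.of_norm_bounded ha fun n => h3 n z hz).tsum_eq_zero_add]
    have h4 : E 0 z = 0 := rfl
    rw [h4, zero_add]
    exact tsum_mul_left
  refine ⟨fun z => ∑' n, V n z, fun z => ∑' n, D n z, ?_, ?_, fun z => (hderiv z).1, fun z => ?_⟩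
  · beta_reduce
    rw [tsum_eq_single 0]
    · simp [V]
    · rintro (_ | n) hn
      · exact absurd rfl hn
      · exact (hP _ (hPd n)).1
  · beta_reduce
    rw [tsum_eq_single 0]
    · rfl
    rintro (_ | n) hn
    · exact absurd rfl hn
    · exact (hP _ (hq.mul (hVd n))).1
  · rw [← (hderiv z).2.2]
    exact (hderiv z).2.1

/-- Entire solutions of `u'' = q u` with given initial data at a given point. -/
theorem exists_entire_ode_solution {q : ℂ → ℂ} (hq : Differentiable ℂ q) (p α β : ℂ) :
    ∃ u v : ℂ → ℂ, u p = α ∧ v p = β ∧ (∀ z, HasDerivAt u (v z) z) ∧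
      ∀ z, HasDerivAt v (q z * u z) z := by
  obtain ⟨u, v, hu, hv, hu', hv'⟩ := exists_entire_ode_solution_zero
    (q := fun z => q (z + p)) (by fun_prop) α β
  refine ⟨fun z => u (z - p), fun z => v (z - p), by simpa, by simpa, fun z => ?_, fun z => ?_⟩
  · exact (hu' (z - p)).comp_sub_const z p
  · have := (hv' (z - p)).comp_sub_const z p
    simpa using this

end LinearODE
-- Stability of linear equations and limits of potentials with jumps.
section OdeStability
open Set Metric Topology Filter

/-- Grönwall's inequality; `1 ≤ K` allows the inhomogeneous term `ε / K` to be replaced by `ε`. -/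
theorem norm_le_of_norm_deriv_le {F : Type*} [NormedAddCommGroup F] [NormedSpace ℝ F]
    {f f' : ℝ → F} {a b δ K ε : ℝ} (hab : a ≤ b) (hf : ∀ t ∈ Icc a b, HasDerivAt f (f' t) t)
    (hK : 1 ≤ K) (hε : 0 ≤ ε) (ha : ‖f a‖ ≤ δ)
    (hb : ∀ t ∈ Icc a b, ‖f' t‖ ≤ K * ‖f t‖ + ε) :
    ‖f b‖ ≤ (δ + ε) * Real.exp (K * (b - a)) := by
  refine (norm_le_gronwallBound_of_norm_deriv_right_le
    (fun t ht => (hf t ht).continuousAt.continuousWithinAt)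
    (fun t ht => (hf t (Ico_subset_Icc_self ht)).hasDerivWithinAt) ha
    (fun t ht => hb t (Ico_subset_Icc_self ht)) b (right_mem_Icc.2 hab)).trans ?_
  rw [gronwallBound_of_K_ne_0 (by positivity)]
  have h1 : ε / K ≤ ε := div_le_self hε hK
  have h2 : 0 ≤ ε / K := by positivity
  have h3 := Real.exp_pos (K * (b - a))
  nlinarith

/-- Stability of solutions of `u'' = q u` on convex compact sets. -/
theorem ode_stability {S : Set ℂ} (hS : Convex ℝ S) (hSc : IsCompact S) {w dw q₂ : ℂ → ℂ}
    (hw : ∀ z ∈ S, HasDerivAt w (dw z) z) (hdw : ∀ z ∈ S, HasDerivAt dw (q₂ z * w z) z)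
    (hq₂ : ContinuousOn q₂ S) {p : ℂ} (hp : p ∈ S) {ε : ℝ} (hε : 0 < ε) :
    ∃ η > 0, ∀ u du q : ℂ → ℂ, (∀ z ∈ S, HasDerivAt u (du z) z) →
      (∀ z ∈ S, HasDerivAt du (q z * u z) z) → (∀ z ∈ S, ‖q z - q₂ z‖ ≤ η) →
      ‖u p - w p‖ ≤ η → ‖du p - dw p‖ ≤ η →
      ∀ z ∈ S, ‖u z - w z‖ ≤ ε ∧ ‖du z - dw z‖ ≤ ε := by
  obtain ⟨M, hM⟩ := hSc.exists_bound_of_continuousOn hq₂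
  obtain ⟨B, hB⟩ := hSc.exists_bound_of_continuousOn
    (fun z hz => (hw z hz).continuousAt.continuousWithinAt)
  obtain ⟨L, hL⟩ := hSc.exists_bound_of_continuousOn (f := fun z => z - p) (by fun_prop)
  have hM0 : 0 ≤ M := (norm_nonneg _).trans (hM p hp)
  have hB0 : 0 ≤ B := (norm_nonneg _).trans (hB p hp)
  have hL0 : 0 ≤ L := (norm_nonneg _).trans (hL p hp)
  set K := L * (M + 1) + L + 1 with hK
  have hex := Real.exp_pos K
  -- Along a segment from `p` the difference of the two states starts at size `η` and is forced by
  -- at most `L * (η * B)`; Grönwall multiplies the sum by `exp K`.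
  refine ⟨min 1 (ε / ((1 + L * B) * Real.exp K)), by positivity, ?_⟩
  set η := min 1 (ε / ((1 + L * B) * Real.exp K)) with hη
  intro u du q hu hdu hq hup hdup z hz
  have hη1 : η ≤ 1 := min_le_left _ _
  have hη0 : 0 < η := by positivity
  have hη2 : (η + L * (η * B)) * Real.exp K ≤ ε := by
    have := min_le_right 1 (ε / ((1 + L * B) * Real.exp K))
    rw [← hη, le_div_iff₀ (by positivity)] at this
    linarith
  set γ : ℝ → ℂ := fun t => p + t * (z - p) with hγ
  have hγS : ∀ t ∈ Icc (0 : ℝ) 1, γ t ∈ S := by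
    intro t ht
    have := hS.add_smul_sub_mem hp hz ht
    simpa [hγ, Complex.real_smul] using this
  have hγd : ∀ t, HasDerivAt γ (z - p) t := by
    intro t
    refine (((Complex.ofRealCLM.hasDerivAt (x := t)).mul_const (z - p)).const_add p).congr_deriv ?_
    simp
  let f : ℝ → ℂ × ℂ := fun t => (u (γ t) - w (γ t), du (γ t) - dw (γ t))
  have hf : ∀ t ∈ Icc (0 : ℝ) 1, HasDerivAt f
      ((du (γ t) * (z - p) - dw (γ t) * (z - p)),
        (q (γ t) * u (γ t) * (z - p) - q₂ (γ t) * w (γ t) * (z - p))) t := fun t ht =>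
    (((hu _ (hγS t ht)).comp t (hγd t)).sub ((hw _ (hγS t ht)).comp t (hγd t))).prodMk
      (((hdu _ (hγS t ht)).comp t (hγd t)).sub ((hdw _ (hγS t ht)).comp t (hγd t)))
  have hzp : ‖z - p‖ ≤ L := hL z hz
  have key := norm_le_of_norm_deriv_le zero_le_one hf (K := K) (δ := η) (ε := L * (η * B))
    (by rw [hK]; nlinarith) (by positivity) ?_ ?_
  · rw [sub_zero, mul_one] at key
    have h1 := key.trans hη2
    have hγ1 : γ 1 = z := by simp [hγ]
    simp only [f, hγ1] at h1
    exact ⟨(norm_fst_le _).trans h1, (norm_snd_le _).trans h1⟩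
  · simp only [f, hγ, Complex.ofReal_zero, zero_mul, add_zero]
    exact norm_prod_le_iff.2 ⟨hup, hdup⟩
  · intro t ht
    have h1 : ‖u (γ t) - w (γ t)‖ ≤ ‖f t‖ := norm_fst_le (f t)
    have h2 : ‖du (γ t) - dw (γ t)‖ ≤ ‖f t‖ := norm_snd_le (f t)
    have hf0 := norm_nonneg (f t)
    have hq1 := hq _ (hγS t ht)
    have hq3 : ‖q (γ t)‖ ≤ M + 1 := by
      calc ‖q (γ t)‖ = ‖(q (γ t) - q₂ (γ t)) + q₂ (γ t)‖ := by ring_nf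
        _ ≤ _ := norm_add_le _ _
        _ ≤ M + 1 := by linarith [hM _ (hγS t ht)]
    have hw1 := hB _ (hγS t ht)
    refine norm_prod_le_iff.2 ⟨?_, ?_⟩
    · rw [← sub_mul, norm_mul, hK]
      have : ‖du (γ t) - dw (γ t)‖ * ‖z - p‖ ≤ ‖f t‖ * L := by gcongr
      have : 0 ≤ L * (η * B) := by positivity
      nlinarith [mul_nonneg (mul_nonneg hL0 (by linarith : 0 ≤ M + 1)) hf0]
    · have : q (γ t) * u (γ t) * (z - p) - q₂ (γ t) * w (γ t) * (z - p) =
          (q (γ t) * (u (γ t) - w (γ t)) + (q (γ t) - q₂ (γ t)) * w (γ t)) * (z - p) := by ring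
      dsimp only
      rw [this, norm_mul]
      have h3 : ‖q (γ t) * (u (γ t) - w (γ t)) + (q (γ t) - q₂ (γ t)) * w (γ t)‖ ≤
          (M + 1) * ‖f t‖ + η * B := by
        refine (norm_add_le _ _).trans ?_
        rw [norm_mul, norm_mul]
        gcongr
      calc _ ≤ ((M + 1) * ‖f t‖ + η * B) * L := by gcongr
        _ ≤ _ := by rw [hK]; nlinarith

/-- Limits of solutions of `y'' = (Q + P' + e) y`, where `P` converges boundedly to a constant `κ`
and `e` to zero: the pairs `(y, y' - P y)` converge as if `P` were equal to `κ`. -/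
theorem tendsto_ode_of_potential_jump {α β : ℝ} (hαβ : α ≤ β) {Q : ℝ → ℂ} (hQ : Continuous Q)
    {y dy : ℝ → ℂ} (hy : ∀ t, HasDerivAt y (dy t) t) (hdy : ∀ t, HasDerivAt dy (Q t * y t) t)
    {κ : ℂ} {P dP e u du : ℕ → ℝ → ℂ} (hP : ∀ n t, HasDerivAt (P n) (dP n t) t)
    (hec : ∀ n, Continuous (e n)) {ε : ℕ → ℝ} (hε : Tendsto ε atTop (𝓝 0)) (hε1 : ∀ n, ε n ≤ 1)
    (he : ∀ n, ∀ t ∈ Icc α β, ‖e n t‖ ≤ ε n)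
    (hu : ∀ n t, HasDerivAt (u n) (du n t) t)
    (hdu : ∀ n t, HasDerivAt (du n) ((Q t + dP n t + e n t) * u n t) t)
    {B : ℝ} (hPB : ∀ n t, ‖P n t‖ ≤ B)
    (hPκ : ∀ t ∈ Ioo α β, Tendsto (fun n => P n t) atTop (𝓝 κ))
    (h0 : Tendsto (fun n => u n α) atTop (𝓝 (y α)))
    (h1 : Tendsto (fun n => du n α - P n α * u n α) atTop (𝓝 (dy α - κ * y α))) :
    Tendsto (fun n => u n β) atTop (𝓝 (y β)) ∧
      Tendsto (fun n => du n β - P n β * u n β) atTop (𝓝 (dy β - κ * y β)) := by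
  have hyc : Continuous y := continuous_iff_continuousAt.2 fun t => (hy t).continuousAt
  have hdyc : Continuous dy := continuous_iff_continuousAt.2 fun t => (hdy t).continuousAt
  have hPc : ∀ n, Continuous (P n) := fun n =>
    continuous_iff_continuousAt.2 fun t => (hP n t).continuousAt
  obtain ⟨MQ, hMQ⟩ := isCompact_Icc.exists_bound_of_continuousOn (hQ.continuousOn (s := Icc α β))
  have hMQ0 : 0 ≤ MQ := (norm_nonneg _).trans (hMQ α (left_mem_Icc.2 hαβ))
  have hB0 : 0 ≤ B := (norm_nonneg _).trans (hPB 0 α)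
  let z : ℝ → ℂ := fun t => dy t - κ * y t
  have hzc : Continuous z := by fun_prop
  let g : ℕ → ℝ → ℂ × ℂ := fun n t => ((P n t - κ) * y t,
    (e n t - P n t ^ 2 + κ ^ 2) * y t - (P n t - κ) * z t)
  have hgc : ∀ n, Continuous (g n) := by
    intro n
    have := hPc n
    have := hec n
    fun_prop
  -- In the variables `(u, u' - P u)` the system contains `P` but no longer `P'`, so bounded
  -- pointwise convergence of `P` is enough.
  let D : ℕ → ℝ → ℂ × ℂ := fun n t => (u n t - y t, (du n t - P n t * u n t) - z t)
  let AD : ℕ → ℝ → ℂ × ℂ := fun n t => (P n t * (D n t).1 + (D n t).2,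
    (Q t + e n t - P n t ^ 2) * (D n t).1 - P n t * (D n t).2)
  have hD : ∀ n t, HasDerivAt (D n) (AD n t + g n t) t := by
    intro n t
    have h1 := (hu n t).sub (hy t)
    have h2 := ((hdu n t).sub ((hP n t).mul (hu n t))).sub
      ((hdy t).sub ((hy t).const_mul κ))
    refine (h1.prodMk h2).congr_deriv ?_
    simp only [AD, D, g, z, Prod.mk_add_mk, Prod.mk.injEq]
    constructor <;> ring
  -- The forcing term `g n` tends to zero only in mean, not uniformly. Its primitive, which is
  -- uniformly small, is therefore subtracted before Grönwall's inequality is used.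
  let G : ℕ → ℝ → ℂ × ℂ := fun n t => ∫ s in α..t, g n s
  have hG : ∀ n t, HasDerivAt (G n) (g n t) t := fun n t =>
    intervalIntegral.integral_hasDerivAt_right ((hgc n).intervalIntegrable _ _)
      (hgc n).stronglyMeasurable.stronglyMeasurableAtFilter (hgc n).continuousAt
  set η : ℕ → ℝ := fun n => ∫ s in α..β, ‖g n s‖ with hη
  have hη0 : ∀ n, 0 ≤ η n := fun n => intervalIntegral.integral_nonneg hαβ fun t _ => norm_nonneg _
  have hGη : ∀ n, ∀ t ∈ Icc α β, ‖G n t‖ ≤ η n := by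
    intro n t ht
    refine (intervalIntegral.norm_integral_le_integral_norm ht.1).trans ?_
    exact intervalIntegral.integral_mono_interval le_rfl ht.1 ht.2
      (Eventually.of_forall fun s => norm_nonneg _) ((hgc n).norm.intervalIntegrable _ _)
  have hηlim : Tendsto η atTop (𝓝 0) := by
    obtain ⟨By, hBy⟩ := isCompact_Icc.exists_bound_of_continuousOn (hyc.continuousOn (s := Icc α β))
    obtain ⟨Bz, hBz⟩ := isCompact_Icc.exists_bound_of_continuousOn (hzc.continuousOn (s := Icc α β))
    have hBy0 : 0 ≤ By := (norm_nonneg _).trans (hBy α (left_mem_Icc.2 hαβ))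
    have hBz0 : 0 ≤ Bz := (norm_nonneg _).trans (hBz α (left_mem_Icc.2 hαβ))
    have h0' : (0 : ℝ) = ∫ s in α..β, (0 : ℝ) := by simp
    rw [hη, h0']
    refine intervalIntegral.tendsto_integral_filter_of_dominated_convergence
      (fun _ => (B + ‖κ‖) * By + ((1 + B ^ 2 + ‖κ‖ ^ 2) * By + (B + ‖κ‖) * Bz))
      (Eventually.of_forall fun n => (hgc n).norm.aestronglyMeasurable)
      (Eventually.of_forall fun n => Eventually.of_forall fun t ht => ?_)
      intervalIntegrable_const ?_
    · rw [uIoc_of_le hαβ] at ht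
      have ht' := Ioc_subset_Icc_self ht
      have e1 : ‖P n t - κ‖ ≤ B + ‖κ‖ := (norm_sub_le _ _).trans (by linarith [hPB n t])
      have e2 : ‖e n t - P n t ^ 2 + κ ^ 2‖ ≤ 1 + B ^ 2 + ‖κ‖ ^ 2 := by
        refine (norm_add_le _ _).trans ?_
        rw [norm_pow]
        gcongr
        refine (norm_sub_le _ _).trans ?_
        rw [norm_pow]
        gcongr
        · exact (he n t ht').trans (hε1 n)
        · exact hPB n t
      have e3 := hBy t ht'
      have e4 := hBz t ht'
      have n1 : 0 ≤ (B + ‖κ‖) * By := by positivity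
      have n2 : 0 ≤ (1 + B ^ 2 + ‖κ‖ ^ 2) * By + (B + ‖κ‖) * Bz := by positivity
      rw [norm_norm]
      refine norm_prod_le_iff.2 ⟨?_, ?_⟩
      · simp only [g, norm_mul]
        have : ‖P n t - κ‖ * ‖y t‖ ≤ (B + ‖κ‖) * By := by gcongr
        linarith
      · simp only [g]
        have a1 : ‖(e n t - P n t ^ 2 + κ ^ 2) * y t‖ ≤ (1 + B ^ 2 + ‖κ‖ ^ 2) * By := by
          rw [norm_mul]; gcongr
        have a2 : ‖(P n t - κ) * z t‖ ≤ (B + ‖κ‖) * Bz := by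
          rw [norm_mul]; gcongr
        exact (norm_sub_le _ _).trans (by linarith)
    · have hne : ∀ᵐ t : ℝ, t ≠ β := by
        simp [MeasureTheory.ae_iff]
      filter_upwards [hne] with t htβ ht
      rw [uIoc_of_le hαβ] at ht
      have htI : t ∈ Ioo α β := ⟨ht.1, lt_of_le_of_ne ht.2 htβ⟩
      have l1 := hPκ t htI
      have l2 : Tendsto (fun n => e n t) atTop (𝓝 0) :=
        squeeze_zero_norm (fun n => he n t (Ioo_subset_Icc_self htI)) hε
      have l3 : Tendsto (fun n => P n t - κ) atTop (𝓝 0) := by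
        simpa using l1.sub_const κ
      have l4 : Tendsto (fun n => e n t - P n t ^ 2 + κ ^ 2) atTop (𝓝 0) := by
        have := (l2.sub (l1.pow 2)).add_const (κ ^ 2)
        rwa [zero_sub, neg_add_cancel] at this
      have l5 : Tendsto (fun n => g n t) atTop (𝓝 0) := by
        have := (l3.mul_const (y t)).prodMk_nhds
          ((l4.mul_const (y t)).sub (l3.mul_const (z t)))
        rwa [zero_mul, zero_mul, sub_zero] at this
      simpa using l5.norm
  set M := B + 1 + (MQ + 1 + B ^ 2 + B) with hM
  have hM1 : 1 ≤ M := by rw [hM]; nlinarith [sq_nonneg B]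
  have hDlim : Tendsto (fun n => ‖D n α‖) atTop (𝓝 0) := by
    have a1 : Tendsto (fun n => u n α - y α) atTop (𝓝 0) := by simpa using h0.sub_const (y α)
    have a2 : Tendsto (fun n => (du n α - P n α * u n α) - z α) atTop (𝓝 0) := by
      simpa [z] using h1.sub_const (z α)
    have := (a1.prodMk_nhds a2).norm
    rwa [Prod.mk_zero_zero, norm_zero] at this
  have hfin : ∀ n, ‖D n β‖ ≤ (‖D n α‖ + M * η n) * Real.exp (M * (β - α)) + η n := by
    intro n
    have hE := norm_le_of_norm_deriv_le (f := fun t => D n t - G n t) (f' := AD n) hαβ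
      (fun t _ => ((hD n t).sub (hG n t)).congr_deriv (add_sub_cancel_right _ _)) hM1
      (mul_nonneg (by linarith) (hη0 n) : 0 ≤ M * η n) (δ := ‖D n α‖) (by simp [G]) ?_
    · have : D n β = (D n β - G n β) + G n β := by abel
      rw [this]
      exact (norm_add_le _ _).trans (add_le_add hE (hGη n β (right_mem_Icc.2 hαβ)))
    · intro t ht
      have d0 : ‖D n t‖ ≤ ‖D n t - G n t‖ + η n := by
        have : D n t = (D n t - G n t) + G n t := by abel
        calc ‖D n t‖ = ‖(D n t - G n t) + G n t‖ := by rw [← this]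
          _ ≤ _ := (norm_add_le _ _).trans (by linarith [hGη n t ht])
      have d1 : ‖(D n t).1‖ ≤ ‖D n t‖ := norm_fst_le _
      have d2 : ‖(D n t).2‖ ≤ ‖D n t‖ := norm_snd_le _
      have hADn : ‖AD n t‖ ≤ M * ‖D n t‖ := by
        have p1 := hPB n t
        have p2 : ‖Q t + e n t - P n t ^ 2‖ ≤ MQ + 1 + B ^ 2 := by
          refine (norm_sub_le _ _).trans ?_
          rw [norm_pow]
          have := norm_add_le (Q t) (e n t)
          have : ‖P n t‖ ^ 2 ≤ B ^ 2 := by gcongr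
          linarith [hMQ t ht, he n t ht, hε1 n]
        have nn := norm_nonneg (D n t)
        refine norm_prod_le_iff.2 ⟨?_, ?_⟩
        · simp only [AD]
          refine (norm_add_le _ _).trans ?_
          rw [norm_mul]
          have : ‖P n t‖ * ‖(D n t).1‖ ≤ B * ‖D n t‖ := by gcongr
          rw [hM]
          nlinarith [mul_nonneg (by positivity : 0 ≤ MQ + 1 + B ^ 2 + B) nn]
        · simp only [AD]
          refine (norm_sub_le _ _).trans ?_
          rw [norm_mul, norm_mul]
          have a1 : ‖P n t‖ * ‖(D n t).2‖ ≤ B * ‖D n t‖ := by gcongr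
          have a2 : ‖Q t + e n t - P n t ^ 2‖ * ‖(D n t).1‖ ≤ (MQ + 1 + B ^ 2) * ‖D n t‖ := by
            gcongr
          rw [hM]
          nlinarith [mul_nonneg (by positivity : 0 ≤ B + 1) nn]
      refine hADn.trans ?_
      rw [← mul_add]
      exact mul_le_mul_of_nonneg_left d0 (by linarith)
  have hlim : Tendsto (fun n => D n β) atTop (𝓝 0) := by
    refine squeeze_zero_norm hfin ?_
    simpa using ((hDlim.add (hηlim.const_mul M)).mul_const (Real.exp (M * (β - α)))).add hηlim
  rw [Prod.tendsto_iff] at hlim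
  constructor
  · simpa [D] using hlim.1.add_const (y β)
  · simpa [D, z] using hlim.2.add_const (z β)

end OdeStability
-- Factorisation in `SL₂` and approximate point masses.
section Control
open Set Metric Topology Filter

/-- The lower unipotent matrix describing the effect of a point mass `τ` in the potential. -/
def shear (τ : ℂ) : Matrix (Fin 2) (Fin 2) ℂ := !![1, 0; τ, 1]

/-- The outer shears leave the upper right entry of the product unchanged, so `τ₂` is determined by
that entry. Then `τ₁` and `τ₃` adjust the two diagonal entries, and the last entry follows from the
determinant. -/
theorem exists_shear_factorization {T₂ T₃ A : Matrix (Fin 2) (Fin 2) ℂ} (h₂ : T₂.det = 1)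
    (h₃ : T₃.det = 1) (hA : A.det = 1) (hT₂ : T₂ 0 1 ≠ 0) (hT₃ : T₃ 0 1 ≠ 0) (hA01 : A 0 1 ≠ 0) :
    ∃ τ₁ τ₂ τ₃, shear τ₃ * T₃ * shear τ₂ * T₂ * shear τ₁ = A := by
  set τ₂ : ℂ := (A 0 1 - T₃ 0 0 * T₂ 0 1 - T₃ 0 1 * T₂ 1 1) / (T₃ 0 1 * T₂ 0 1) with hτ₂
  set M := T₃ * shear τ₂ * T₂ with hM
  have hMdet : M.det = 1 := by
    rw [hM, Matrix.det_mul, Matrix.det_mul, h₂, h₃]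
    simp [shear, Matrix.det_fin_two]
  have hM01 : M 0 1 = A 0 1 := by
    simp only [hM, shear, Matrix.mul_apply, Fin.sum_univ_two, hτ₂, Matrix.of_apply,
      Matrix.cons_val', Matrix.cons_val_zero, Matrix.cons_val_one, Matrix.cons_val_fin_one]
    field_simp
    ring
  rw [Matrix.det_fin_two] at hMdet hA
  set τ₁ := (A 0 0 - M 0 0) / A 0 1 with hτ₁
  set τ₃ := (A 1 1 - M 1 1) / A 0 1 with hτ₃
  refine ⟨τ₁, τ₂, τ₃, ?_⟩
  have e1 : τ₁ * A 0 1 = A 0 0 - M 0 0 := by rw [hτ₁]; field_simp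
  have e3 : τ₃ * A 0 1 = A 1 1 - M 1 1 := by rw [hτ₃]; field_simp
  have : shear τ₃ * T₃ * shear τ₂ * T₂ * shear τ₁ = shear τ₃ * M * shear τ₁ := by
    rw [hM]; simp only [Matrix.mul_assoc]
  rw [this]
  have f00 : (shear τ₃ * M * shear τ₁) 0 0 = M 0 0 + M 0 1 * τ₁ := by
    simp only [shear, Matrix.mul_apply, Fin.sum_univ_two, Matrix.of_apply, Matrix.cons_val',
      Matrix.cons_val_zero, Matrix.cons_val_one, Matrix.cons_val_fin_one]
    ring
  have f01 : (shear τ₃ * M * shear τ₁) 0 1 = M 0 1 := by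
    simp only [shear, Matrix.mul_apply, Fin.sum_univ_two, Matrix.of_apply, Matrix.cons_val',
      Matrix.cons_val_zero, Matrix.cons_val_one, Matrix.cons_val_fin_one]
    ring
  have f10 : (shear τ₃ * M * shear τ₁) 1 0 = τ₃ * M 0 0 + M 1 0 + (τ₃ * M 0 1 + M 1 1) * τ₁ := by
    simp only [shear, Matrix.mul_apply, Fin.sum_univ_two, Matrix.of_apply, Matrix.cons_val',
      Matrix.cons_val_zero, Matrix.cons_val_one, Matrix.cons_val_fin_one]
    ring
  have f11 : (shear τ₃ * M * shear τ₁) 1 1 = τ₃ * M 0 1 + M 1 1 := by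
    simp only [shear, Matrix.mul_apply, Fin.sum_univ_two, Matrix.of_apply, Matrix.cons_val',
      Matrix.cons_val_zero, Matrix.cons_val_one, Matrix.cons_val_fin_one]
    ring
  ext i j
  fin_cases i <;> fin_cases j
  · change (shear τ₃ * M * shear τ₁) 0 0 = A 0 0
    rw [f00, hM01]; linear_combination e1
  · change (shear τ₃ * M * shear τ₁) 0 1 = A 0 1
    rw [f01, hM01]
  · change (shear τ₃ * M * shear τ₁) 1 0 = A 1 0
    rw [f10, hM01]
    rw [hM01] at hMdet
    apply mul_left_cancel₀ hA01
    linear_combination M 0 0 * e3 + (A 1 1 - M 1 1 + M 1 1) * e1 + A 0 1 * τ₁ * e3 + hA - hMdet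
  · change (shear τ₃ * M * shear τ₁) 1 1 = A 1 1
    rw [f11, hM01]; linear_combination e3

/-- Solving for the middle factor gives a matrix `A` of determinant `1`. If its upper right entry
vanishes, the exact factorisation may fail, so `A` is first multiplied by a small upper unipotent
matrix; hence the error `ε`. -/
theorem exists_shear_approx {T₁ T₂ T₃ T₄ Y B : Matrix (Fin 2) (Fin 2) ℂ} (h₁ : T₁.det = 1)
    (h₂ : T₂.det = 1) (h₃ : T₃.det = 1) (h₄ : T₄.det = 1) (hY : Y.det ≠ 0)
    (hB : B.det = Y.det) (hT₂ : T₂ 0 1 ≠ 0) (hT₃ : T₃ 0 1 ≠ 0) {ε : ℝ} (hε : 0 < ε) :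
    ∃ τ₁ τ₂ τ₃, ∀ i j,
      ‖(T₄ * (shear τ₃ * T₃ * shear τ₂ * T₂ * shear τ₁) * T₁ * Y - B) i j‖ < ε := by
  have inv : ∀ M : Matrix (Fin 2) (Fin 2) ℂ, M.det = 1 → M * M.adjugate = 1 ∧
      M.adjugate * M = 1 ∧ M.adjugate.det = 1 := fun M hM => by
    refine ⟨by rw [Matrix.mul_adjugate, hM, one_smul], by rw [Matrix.adjugate_mul, hM, one_smul],
      by rw [Matrix.det_adjugate, hM, one_pow]⟩
  obtain ⟨a1, a2, a3⟩ := inv T₁ h₁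
  obtain ⟨d1, d2, d3⟩ := inv T₄ h₄
  have y2 : Y⁻¹ * Y = 1 := Matrix.nonsing_inv_mul Y (isUnit_iff_ne_zero.2 hY)
  set A := T₄.adjugate * B * Y⁻¹ * T₁.adjugate with hA
  have hAdet : A.det = 1 := by
    simp only [hA, Matrix.det_mul, a3, d3, hB, Matrix.det_nonsing_inv, one_mul, mul_one]
    exact Ring.mul_inverse_cancel _ (isUnit_iff_ne_zero.2 hY)
  let U : ℂ → Matrix (Fin 2) (Fin 2) ℂ := fun η => !![1, η; 0, 1]
  have hU : Continuous fun η => T₄ * (A * U η) * T₁ * Y := by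
    have : Continuous U := by
      refine continuous_matrix fun i j => ?_
      fin_cases i <;> fin_cases j <;> simp [U] <;> fun_prop
    fun_prop
  have hU0 : T₄ * (A * U 0) * T₁ * Y = B := by
    have : U 0 = 1 := by simp [U, Matrix.one_fin_two]
    rw [this, mul_one, hA]
    calc T₄ * (T₄.adjugate * B * Y⁻¹ * T₁.adjugate) * T₁ * Y
        = (T₄ * T₄.adjugate) * B * Y⁻¹ * (T₁.adjugate * T₁) * Y := by
          simp only [Matrix.mul_assoc]
      _ = B * (Y⁻¹ * Y) := by rw [d1, a2]; simp only [Matrix.mul_assoc, one_mul]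
      _ = B := by rw [y2, mul_one]
  have hev : ∀ᶠ η in 𝓝 (0 : ℂ), ∀ i j, ‖(T₄ * (A * U η) * T₁ * Y - B) i j‖ < ε := by
    rw [eventually_all]; intro i
    rw [eventually_all]; intro j
    have hc : Continuous fun η => ‖(T₄ * (A * U η) * T₁ * Y - B) i j‖ :=
      ((hU.sub continuous_const).matrix_elem i j).norm
    have := hc.tendsto 0
    simp only [hU0, sub_self, Matrix.zero_apply, norm_zero] at this
    exact this.eventually (gt_mem_nhds hε)
  obtain ⟨η, hη, hη01⟩ : ∃ η, (∀ i j, ‖(T₄ * (A * U η) * T₁ * Y - B) i j‖ < ε) ∧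
      (A * U η) 0 1 ≠ 0 := by
    have hform : ∀ η, (A * U η) 0 1 = A 0 0 * η + A 0 1 := fun η => by
      simp [U, Matrix.mul_apply, Fin.sum_univ_two]
    by_cases h : A 0 1 = 0
    · have h00 : A 0 0 ≠ 0 := by
        intro h00
        rw [Matrix.det_fin_two, h, h00] at hAdet
        simp at hAdet
      obtain ⟨η, h1, h2⟩ :=
        ((hev.filter_mono nhdsWithin_le_nhds).and (self_mem_nhdsWithin (s := {(0 : ℂ)}ᶜ))).exists
      exact ⟨η, h1, by rw [hform, h, add_zero]; exact mul_ne_zero h00 h2⟩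
    · exact ⟨0, hev.self_of_nhds, by rw [hform]; simpa using h⟩
  obtain ⟨τ₁, τ₂, τ₃, hτ⟩ := exists_shear_factorization h₂ h₃ (A := A * U η)
    (by rw [Matrix.det_mul, hAdet]; simp [U, Matrix.det_fin_two]) hT₂ hT₃ hη01
  exact ⟨τ₁, τ₂, τ₃, by rw [hτ]; exact hη⟩

/-- A smooth approximation of the Heaviside function. -/
noncomputable def smoothStep (δ x : ℝ) : ℝ := Real.arctan (x / δ) / Real.pi + 1 / 2

/-- The derivative of `smoothStep`: an approximation of the point mass at zero. -/
noncomputable def smoothBump (δ x : ℝ) : ℝ := δ / (x ^ 2 + δ ^ 2) / Real.pi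

theorem hasDerivAt_smoothStep {δ : ℝ} (hδ : 0 < δ) (x : ℝ) :
    HasDerivAt (smoothStep δ) (smoothBump δ x) x := by
  have := ((((hasDerivAt_id x).div_const δ).arctan).div_const Real.pi).add_const (1 / 2)
  refine this.congr_deriv ?_
  have hπ := Real.pi_ne_zero
  have h2 : x ^ 2 + δ ^ 2 ≠ 0 := by positivity
  have h3 : 1 + (x / δ) ^ 2 ≠ 0 := by positivity
  simp only [smoothBump, id]
  field_simp
  ring

theorem abs_smoothStep_le (δ x : ℝ) : |smoothStep δ x| ≤ 1 := by
  have h1 := Real.arctan_lt_pi_div_two (x / δ)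
  have h2 := Real.neg_pi_div_two_lt_arctan (x / δ)
  have h3 : Real.arctan (x / δ) / Real.pi ≤ 1 / 2 := by
    rw [div_le_iff₀ Real.pi_pos]; linarith
  have h4 : -(1 / 2) ≤ Real.arctan (x / δ) / Real.pi := by
    rw [le_div_iff₀ Real.pi_pos]; linarith
  rw [smoothStep, abs_le]
  constructor <;> linarith

theorem tendsto_smoothStep_of_pos {δ : ℕ → ℝ} (hδ : ∀ n, 0 < δ n) (hδ0 : Tendsto δ atTop (𝓝 0))
    {x : ℝ} (hx : 0 < x) : Tendsto (fun n => smoothStep (δ n) x) atTop (𝓝 1) := by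
  have h1 : Tendsto (fun n => x / δ n) atTop atTop := by
    have : Tendsto δ atTop (𝓝[>] 0) :=
      tendsto_nhdsWithin_iff.2 ⟨hδ0, Eventually.of_forall hδ⟩
    simpa [div_eq_mul_inv] using (tendsto_inv_nhdsGT_zero.comp this).const_mul_atTop hx
  have h2 := (Real.tendsto_arctan_atTop.mono_right nhdsWithin_le_nhds).comp h1
  have h3 := (h2.div_const Real.pi).add_const (1 / 2)
  have h4 : Real.pi / 2 / Real.pi + 1 / 2 = 1 := by have := Real.pi_ne_zero; field_simp; norm_num
  rw [h4] at h3
  exact h3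

theorem tendsto_smoothStep_of_neg {δ : ℕ → ℝ} (hδ : ∀ n, 0 < δ n) (hδ0 : Tendsto δ atTop (𝓝 0))
    {x : ℝ} (hx : x < 0) : Tendsto (fun n => smoothStep (δ n) x) atTop (𝓝 0) := by
  have h := (tendsto_smoothStep_of_pos hδ hδ0 (neg_pos.2 hx)).const_sub 1
  refine (h.congr fun n => ?_).trans (by simp)
  simp only [smoothStep, neg_div, Real.arctan_neg]
  ring

/-- The fundamental system of `u'' = Q u` at a point. -/
theorem exists_fundamental_system {Q : ℂ → ℂ} (hQ : Differentiable ℂ Q) (s : ℂ) :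
    ∃ C dC S dS : ℂ → ℂ, C s = 1 ∧ dC s = 0 ∧ S s = 0 ∧ dS s = 1 ∧
      (∀ z, HasDerivAt C (dC z) z) ∧ (∀ z, HasDerivAt dC (Q z * C z) z) ∧
      (∀ z, HasDerivAt S (dS z) z) ∧ (∀ z, HasDerivAt dS (Q z * S z) z) ∧
      ∀ z, C z * dS z - dC z * S z = 1 := by
  obtain ⟨C, dC, h1, h2, h3, h4⟩ := exists_entire_ode_solution hQ s 1 0
  obtain ⟨S, dS, k1, k2, k3, k4⟩ := exists_entire_ode_solution hQ s 0 1
  refine ⟨C, dC, S, dS, h1, h2, k1, k2, h3, h4, k3, k4, fun z => ?_⟩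
  have hW : ∀ z, HasDerivAt (fun z => C z * dS z - dC z * S z) 0 z := fun z =>
    (((h3 z).mul (k4 z)).sub ((h4 z).mul (k3 z))).congr_deriv (by ring)
  have := is_const_of_deriv_eq_zero (fun z => (hW z).differentiableAt) (fun z => (hW z).deriv) z s
  simpa [h1, h2, k1, k2] using this

end Control
-- Control of solutions along a segment.
section SegmentControl
open Set Metric Topology Filter
open scoped Matrix

/-- Transport matrices of `u'' = Q u` along the real axis. -/
theorem exists_transport {Q : ℂ → ℂ} (hQ : Differentiable ℂ Q) (s : ℝ) :
    ∃ T : ℝ → Matrix (Fin 2) (Fin 2) ℂ, (∀ t, (T t).det = 1) ∧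
      (∀ᶠ t in 𝓝[>] s, T t 0 1 ≠ 0) ∧
      ∀ a : Fin 2 → ℂ, ∃ y dy : ℝ → ℂ, (∀ t, HasDerivAt y (dy t) t) ∧
        (∀ t : ℝ, HasDerivAt dy (Q t * y t) t) ∧ y s = a 0 ∧ dy s = a 1 ∧
        ∀ t, y t = (T t *ᵥ a) 0 ∧ dy t = (T t *ᵥ a) 1 := by
  obtain ⟨C, dC, S, dS, h1, h2, h3, h4, h5, h6, h7, h8, h9⟩ := exists_fundamental_system hQ s
  refine ⟨fun t => !![C t, S t; dC t, dS t], fun t => ?_, ?_, fun a => ?_⟩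
  · rw [Matrix.det_fin_two_of]; linear_combination h9 t
  -- The upper right entry is the solution `S` with `S s = 0` and `S' s = 1`, which has no zeros
  -- just after `s`.
  · have := ((h7 s).comp_ofReal).eventually_ne (c := 0) (by rw [h4]; exact one_ne_zero)
    exact this.filter_mono (nhdsWithin_mono _ fun t ht => ne_of_gt ht)
  · refine ⟨fun t => C t * a 0 + S t * a 1, fun t => dC t * a 0 + dS t * a 1, fun t => ?_,
      fun t => ?_, by simp [h1, h3], by simp [h2, h4], fun t => ?_⟩
    · exact ((h5 t).comp_ofReal.mul_const _).add ((h7 t).comp_ofReal.mul_const _)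
    · exact (((h6 t).comp_ofReal.mul_const _).add ((h8 t).comp_ofReal.mul_const _)).congr_deriv
        (by ring)
    · simp [Matrix.mulVec, dotProduct, Fin.sum_univ_two]

/-- Three point masses in the potential steer a pair of solutions on `[0, 1]`
approximately to any other pair of end states with the same Wronskian. -/
theorem exists_segment_control {Q : ℂ → ℂ} (hQ : Differentiable ℂ Q)
    {X B : Matrix (Fin 2) (Fin 2) ℂ} (hX : X.det ≠ 0) (hB : B.det = X.det) {ε : ℝ} (hε : 0 < ε) :
    ∃ t₁ t₂ t₃ : ℝ, 0 < t₁ ∧ t₁ < t₂ ∧ t₂ < t₃ ∧ t₃ < 1 ∧ ∃ τ₁ τ₂ τ₃ : ℂ,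
      ∃ B' : Matrix (Fin 2) (Fin 2) ℂ, (∀ i j, ‖B' i j - B i j‖ < ε) ∧
      ∀ δ : ℕ → ℝ, (∀ n, 0 < δ n) → Tendsto δ atTop (𝓝 0) →
      ∀ (e : ℕ → ℝ → ℂ) (η : ℕ → ℝ), (∀ n, Continuous (e n)) → Tendsto η atTop (𝓝 0) →
      (∀ n, η n ≤ 1) → (∀ n, ∀ t ∈ Icc (0 : ℝ) 1, ‖e n t‖ ≤ η n) →
      ∀ (j : Fin 2) (u du : ℕ → ℝ → ℂ), (∀ n t, HasDerivAt (u n) (du n t) t) →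
      (∀ n, ∀ t : ℝ, HasDerivAt (du n) ((Q t + (τ₁ * smoothBump (δ n) (t - t₁) +
        τ₂ * smoothBump (δ n) (t - t₂) + τ₃ * smoothBump (δ n) (t - t₃)) + e n t) * u n t) t) →
      Tendsto (fun n => u n 0) atTop (𝓝 (X 0 j)) → Tendsto (fun n => du n 0) atTop (𝓝 (X 1 j)) →
      Tendsto (fun n => u n 1) atTop (𝓝 (B' 0 j)) ∧
        Tendsto (fun n => du n 1) atTop (𝓝 (B' 1 j)) := by
  obtain ⟨T₁, hd₁, -, hT₁⟩ := exists_transport hQ 0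
  obtain ⟨T₂, hd₂, hn₂, hT₂⟩ := exists_transport hQ (1 / 4)
  obtain ⟨t₂, ht₂, ht₂l, ht₂u⟩ :=
    (hn₂.and (Ioo_mem_nhdsGT (show (1 / 4 : ℝ) < 1 / 2 by norm_num))).exists
  obtain ⟨T₃, hd₃, hn₃, hT₃⟩ := exists_transport hQ t₂
  obtain ⟨t₃, ht₃, ht₃l, ht₃u⟩ := (hn₃.and (Ioo_mem_nhdsGT (show t₂ < 1 by linarith))).exists
  obtain ⟨T₄, hd₄, -, hT₄⟩ := exists_transport hQ t₃
  obtain ⟨τ₁, τ₂, τ₃, hτ⟩ := exists_shear_approx (hd₁ (1 / 4)) (hd₂ t₂) (hd₃ t₃) (hd₄ 1) hX hB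
    ht₂ ht₃ hε
  refine ⟨1 / 4, t₂, t₃, by norm_num, ht₂l, ht₃l, ht₃u, τ₁, τ₂, τ₃, _, hτ, ?_⟩
  intro δ hδ hδ0 e η hec hη hη1 he j u du hu hdu h0 h1
  let P : ℕ → ℝ → ℂ := fun n t => τ₁ * smoothStep (δ n) (t - 1 / 4) +
    τ₂ * smoothStep (δ n) (t - t₂) + τ₃ * smoothStep (δ n) (t - t₃)
  let dP : ℕ → ℝ → ℂ := fun n t => τ₁ * smoothBump (δ n) (t - 1 / 4) +
    τ₂ * smoothBump (δ n) (t - t₂) + τ₃ * smoothBump (δ n) (t - t₃)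
  have hP : ∀ n t, HasDerivAt (P n) (dP n t) t := by
    intro n t
    have h : ∀ s : ℝ, HasDerivAt (fun t : ℝ => (smoothStep (δ n) (t - s) : ℂ))
        (smoothBump (δ n) (t - s)) t := fun s =>
      ((hasDerivAt_smoothStep (hδ n) (t - s)).comp_sub_const t s).ofReal_comp
    exact (((h (1 / 4)).const_mul τ₁).add ((h t₂).const_mul τ₂)).add ((h t₃).const_mul τ₃)
  have hPB : ∀ n t, ‖P n t‖ ≤ ‖τ₁‖ + ‖τ₂‖ + ‖τ₃‖ := by
    intro n t
    have h : ∀ (τ : ℂ) (x : ℝ), ‖τ * smoothStep (δ n) x‖ ≤ ‖τ‖ := fun τ x => by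
      rw [norm_mul, Complex.norm_real, Real.norm_eq_abs]
      exact mul_le_of_le_one_right (norm_nonneg _) (abs_smoothStep_le _ _)
    exact (norm_add₃_le).trans (add_le_add (add_le_add (h _ _) (h _ _)) (h _ _))
  have hpos : ∀ (τ : ℂ) (x : ℝ), 0 < x →
      Tendsto (fun n => τ * (smoothStep (δ n) x : ℂ)) atTop (𝓝 τ) := fun τ x hx => by
    have := ((Complex.continuous_ofReal.tendsto _).comp
      (tendsto_smoothStep_of_pos hδ hδ0 hx)).const_mul τ
    simpa using this
  have hneg : ∀ (τ : ℂ) (x : ℝ), x < 0 →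
      Tendsto (fun n => τ * (smoothStep (δ n) x : ℂ)) atTop (𝓝 0) := fun τ x hx => by
    have := ((Complex.continuous_ofReal.tendsto _).comp
      (tendsto_smoothStep_of_neg hδ hδ0 hx)).const_mul τ
    simpa using this
  -- The state `a` at `α` is taken after the mass there: its second entry is the limit of `u' - P
  -- u`, increased by `κ` times that of `u`, where `κ` is the limit of `P` on the interval. The
  -- quantity `u' - P u` is continuous across `β`, so replacing `κ` by the next value `κ'`
  -- multiplies the state by a shear.
  have step : ∀ (α β : ℝ) (κ : ℂ), 0 ≤ α → α ≤ β → β ≤ 1 →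
      ∀ T : ℝ → Matrix (Fin 2) (Fin 2) ℂ, (∀ a : Fin 2 → ℂ, ∃ y dy : ℝ → ℂ,
        (∀ t, HasDerivAt y (dy t) t) ∧
        (∀ t : ℝ, HasDerivAt dy (Q t * y t) t) ∧ y α = a 0 ∧ dy α = a 1 ∧
        ∀ t, y t = (T t *ᵥ a) 0 ∧ dy t = (T t *ᵥ a) 1) →
      (∀ t ∈ Ioo α β, Tendsto (fun n => P n t) atTop (𝓝 κ)) → ∀ a : Fin 2 → ℂ,
      Tendsto (fun n => u n α) atTop (𝓝 (a 0)) →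
      Tendsto (fun n => du n α - P n α * u n α) atTop (𝓝 (a 1 - κ * a 0)) →
      ∀ κ' : ℂ, Tendsto (fun n => u n β) atTop (𝓝 (((shear (κ' - κ) * T β) *ᵥ a) 0)) ∧
        Tendsto (fun n => du n β - P n β * u n β) atTop
          (𝓝 (((shear (κ' - κ) * T β) *ᵥ a) 1 - κ' * ((shear (κ' - κ) * T β) *ᵥ a) 0)) := by
    intro α β κ hα hαβ hβ T hT hPκ a ha0 ha1 κ'
    obtain ⟨y, dy, hy, hdy, hy0, hdy0, hyT⟩ := hT a
    have hQc : Continuous fun t : ℝ => Q t := hQ.continuous.comp Complex.continuous_ofReal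
    obtain ⟨r1, r2⟩ := tendsto_ode_of_potential_jump hαβ hQc hy hdy hP hec hη hη1
      (fun n t ht => he n t ⟨hα.trans ht.1, ht.2.trans hβ⟩) hu hdu hPB hPκ
      (by rw [hy0]; exact ha0) (by rw [hy0, hdy0]; exact ha1)
    rw [(hyT β).1] at r1
    rw [(hyT β).1, (hyT β).2] at r2
    have hs : ∀ b : Fin 2 → ℂ, (shear (κ' - κ) *ᵥ b) 0 = b 0 ∧
        (shear (κ' - κ) *ᵥ b) 1 = (κ' - κ) * b 0 + b 1 := fun b => by
      simp [shear, Matrix.mulVec, dotProduct, Fin.sum_univ_two]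
    rw [← Matrix.mulVec_mulVec, (hs _).1, (hs _).2]
    refine ⟨r1, ?_⟩
    convert r2 using 2
    ring
  have s1 := step 0 (1 / 4) 0 le_rfl (by norm_num) (by norm_num) T₁ (by simpa using hT₁)
    (fun t ht => by
      simpa [P] using ((hneg τ₁ _ (by linarith [ht.2] : t - 1 / 4 < 0)).add
        (hneg τ₂ _ (by linarith [ht.2] : t - t₂ < 0))).add
        (hneg τ₃ _ (by linarith [ht.2] : t - t₃ < 0)))
    (fun i => X i j) h0 ?_ τ₁
  · have s2 := step (1 / 4) t₂ τ₁ (by norm_num) ht₂l.le (by linarith) T₂ (by simpa using hT₂)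
      (fun t ht => by
        simpa [P] using ((hpos τ₁ _ (by linarith [ht.1] : 0 < t - 1 / 4)).add
          (hneg τ₂ _ (by linarith [ht.2] : t - t₂ < 0))).add
          (hneg τ₃ _ (by linarith [ht.2] : t - t₃ < 0))) _ s1.1 s1.2 (τ₁ + τ₂)
    have s3 := step t₂ t₃ (τ₁ + τ₂) (by linarith) ht₃l.le (by linarith) T₃ hT₃
      (fun t ht => by
        simpa [P] using ((hpos τ₁ _ (by linarith [ht.1] : 0 < t - 1 / 4)).add
          (hpos τ₂ _ (by linarith [ht.1] : 0 < t - t₂))).add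
          (hneg τ₃ _ (by linarith [ht.2] : t - t₃ < 0))) _ s2.1 s2.2 (τ₁ + τ₂ + τ₃)
    -- There is no mass at the endpoint, hence `κ' = κ` and the last shear is trivial.
    have s4 := step t₃ 1 (τ₁ + τ₂ + τ₃) (by linarith) ht₃u.le le_rfl T₄ hT₄
      (fun t ht => by
        simpa [P] using ((hpos τ₁ _ (by linarith [ht.1] : 0 < t - 1 / 4)).add
          (hpos τ₂ _ (by linarith [ht.1] : 0 < t - t₂))).add
          (hpos τ₃ _ (by linarith [ht.1] : 0 < t - t₃))) _ s3.1 s3.2 (τ₁ + τ₂ + τ₃)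
    have hP1 : Tendsto (fun n => P n 1) atTop (𝓝 (τ₁ + τ₂ + τ₃)) :=
      ((hpos τ₁ _ (by norm_num : (0 : ℝ) < 1 - 1 / 4)).add
          (hpos τ₂ _ (by linarith : 0 < 1 - t₂))).add (hpos τ₃ _ (by linarith : 0 < 1 - t₃))
    have hsh0 : shear 0 = 1 := by simp [shear, Matrix.one_fin_two]
    have hfin : ∀ i, (T₄ 1 * (shear τ₃ * T₃ t₃ * shear τ₂ * T₂ t₂ * shear τ₁) * T₁ (1 / 4) * X) i j
        = ((shear (τ₁ + τ₂ + τ₃ - (τ₁ + τ₂ + τ₃)) * T₄ 1) *ᵥ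
          (shear (τ₁ + τ₂ + τ₃ - (τ₁ + τ₂)) * T₃ t₃) *ᵥ
          (shear (τ₁ + τ₂ - τ₁) * T₂ t₂) *ᵥ (shear (τ₁ - 0) * T₁ (1 / 4)) *ᵥ fun i => X i j) i := by
      intro i
      rw [sub_self, hsh0, one_mul, sub_zero, add_sub_cancel_left, add_sub_cancel_left]
      simp only [Matrix.mulVec_mulVec, ← Matrix.mul_assoc]
      rfl
    rw [hfin 0, hfin 1]
    refine ⟨s4.1, ?_⟩
    have := s4.2.add (hP1.mul s4.1)
    simpa using this
  · have hP0 : Tendsto (fun n => P n 0) atTop (𝓝 0) := by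
      simpa [P] using ((hneg τ₁ _ (by norm_num : (0 : ℝ) - 1 / 4 < 0)).add
        (hneg τ₂ _ (by linarith : 0 - t₂ < 0))).add (hneg τ₃ _ (by linarith : 0 - t₃ < 0))
    simpa using h1.sub (hP0.mul h0)

end SegmentControl
-- Point masses approximated by polynomials.
section Steering
open Set Metric Topology Filter Polynomial
open scoped Matrix

theorem IsPolyApprox.add {E : Set ℂ} {f g : ℂ → ℂ} (hf : IsPolyApprox E f)
    (hg : IsPolyApprox E g) : IsPolyApprox E fun z => f z + g z := by
  intro ε hε
  obtain ⟨p, hp⟩ := hf (ε / 2) (half_pos hε)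
  obtain ⟨p', hp'⟩ := hg (ε / 2) (half_pos hε)
  refine ⟨p + p', fun z hz => ?_⟩
  have : (p + p').eval z - (f z + g z) = (p.eval z - f z) + (p'.eval z - g z) := by
    rw [eval_add]; ring
  rw [this]
  exact (norm_add_le _ _).trans_lt (by linarith [hp z hz, hp' z hz])

theorem IsPolyApprox.const_mul {E : Set ℂ} {f : ℂ → ℂ} (hf : IsPolyApprox E f) (c : ℂ) :
    IsPolyApprox E fun z => c * f z := by
  intro ε hε
  obtain ⟨p, hp⟩ := hf (ε / (‖c‖ + 1)) (by positivity)
  refine ⟨C c * p, fun z hz => ?_⟩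
  rw [eval_mul, eval_C, ← mul_sub, norm_mul]
  have h1 := hp z hz
  have h2 : (‖c‖ + 1) * (ε / (‖c‖ + 1)) = ε := by field_simp
  nlinarith [norm_nonneg c, norm_nonneg (p.eval z - f z)]

/-- Polynomials approximating a point mass on a segment and zero on the sets joined by it. -/
theorem exists_polynomial_bump {K : Set ℂ} {a b d : ℂ} {c t₀ : ℝ} (hK : IsCompact K)
    (hb : b ≠ 0) (hc : c ≠ 0) (hd : d = c * b) {σ : ℝ} (ha : a = σ * b)
    (hE : IsPreconnected (K ∪ (fun t : ℝ => (t : ℂ) * b) '' Icc 0 1)ᶜ)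
    (hseg : ∀ t ∈ Icc (0 : ℝ) 1, a + t * d ∈ (fun t : ℝ => (t : ℂ) * b) '' Icc 0 1)
    (ht₀ : a + t₀ * d ∉ K) {η : ℝ} (hη : 0 < η) :
    ∀ᶠ δ in 𝓝[>] (0 : ℝ), ∃ p : ℂ[X], (∀ z ∈ K, ‖p.eval z‖ ≤ η) ∧
      ∀ t ∈ Icc (0 : ℝ) 1, ‖p.eval (a + t * d) - smoothBump δ (t - t₀)‖ ≤ η := by
  have hd0 : d ≠ 0 := by rw [hd]; exact mul_ne_zero (by exact_mod_cast hc) hb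
  obtain ⟨m, hm, hmK⟩ : ∃ m > 0, ∀ z ∈ K, m ≤ ‖(z - (a + t₀ * d)) / d‖ := by
    rcases K.eq_empty_or_nonempty with rfl | hne
    · exact ⟨1, one_pos, by simp⟩
    obtain ⟨z₀, hz₀, hmin⟩ := hK.exists_isMinOn hne
      (f := fun z => ‖(z - (a + t₀ * d)) / d‖) (by fun_prop)
    refine ⟨_, norm_pos_iff.2 (div_ne_zero (sub_ne_zero.2 ?_) hd0), fun z hz => hmin hz⟩
    rintro rfl
    exact ht₀ hz₀
  have hδ₁ : ∀ᶠ δ in 𝓝[>] (0 : ℝ), δ < m / 2 :=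
    (gt_mem_nhds (half_pos hm)).filter_mono nhdsWithin_le_nhds
  -- On `K` the rescaled variable `x` has modulus at least `m`, so with `δ < m / 2` one gets `|x² +
  -- δ²| ≥ m² / 2`; this bound on `δ` then makes the kernel at most `η / 2` there.
  have hδ₂ : ∀ᶠ δ in 𝓝[>] (0 : ℝ), δ < η / 2 * m ^ 2 / 2 :=
    (gt_mem_nhds (by positivity)).filter_mono nhdsWithin_le_nhds
  filter_upwards [hδ₁, hδ₂, self_mem_nhdsWithin] with δ h1 h2 hδ
  replace hδ : 0 < δ := hδ
  set E := K ∪ (fun t : ℝ => (t : ℂ) * b) '' Icc 0 1 with hEdef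
  have hEc : IsCompact E := hK.union (isCompact_Icc.image (by fun_prop))
  -- The poles avoid `K` because `δ < m`, and avoid the segment because they have a nonreal
  -- coordinate with respect to `b`.
  have hw : ∀ s : ℝ, |s| = δ → a + t₀ * d + s * Complex.I * d ∉ E := by
    rintro s hs (h | ⟨t, -, h⟩)
    · have := hmK _ h
      rw [add_sub_cancel_left, mul_div_cancel_right₀ _ hd0, norm_mul, Complex.norm_I,
        Complex.norm_real, Real.norm_eq_abs, hs] at this
      linarith
    · have h3 : (t : ℂ) * b = (σ + t₀ * c + s * Complex.I * c) * b := by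
        beta_reduce at h; rw [h, ha, hd]; ring
      have h4 := congrArg Complex.im (mul_right_cancel₀ hb h3)
      simp at h4
      rcases h4 with h4 | h4
      · rw [h4] at hs; simp at hs; linarith
      · exact hc h4
  have hpa := ((isPolyApprox_inv_sub hEc hE (hw δ (abs_of_pos hδ))).const_mul
      (-(d / (2 * Real.pi * Complex.I)))).add
    ((isPolyApprox_inv_sub hEc hE (hw (-δ) (by rw [abs_neg, abs_of_pos hδ]))).const_mul
      (d / (2 * Real.pi * Complex.I)))
  -- The bump is a Poisson kernel, a combination of the two simple poles `x = ±iδ`, to which Runge's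
  -- theorem applies.
  have hval : ∀ x : ℂ, x - δ * Complex.I ≠ 0 → x + δ * Complex.I ≠ 0 →
      ∀ z, z = a + t₀ * d + x * d →
      -(d / (2 * Real.pi * Complex.I)) * (a + t₀ * d + (δ : ℝ) * Complex.I * d - z)⁻¹ +
        d / (2 * Real.pi * Complex.I) * (a + t₀ * d + ((-δ : ℝ) : ℂ) * Complex.I * d - z)⁻¹ =
      δ / (x ^ 2 + δ ^ 2) / Real.pi := by
    rintro x hx1 hx2 z rfl
    have e1 : a + t₀ * d + (δ : ℝ) * Complex.I * d - (a + t₀ * d + x * d) =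
        -((x - δ * Complex.I) * d) := by ring
    have e2 : a + t₀ * d + ((-δ : ℝ) : ℂ) * Complex.I * d - (a + t₀ * d + x * d) =
        -((x + δ * Complex.I) * d) := by push_cast; ring
    have e3 : x ^ 2 + (δ : ℂ) ^ 2 = (x - δ * Complex.I) * (x + δ * Complex.I) := by
      linear_combination ((δ : ℂ) ^ 2) * Complex.I_sq
    have e4 : (x + δ * Complex.I) - (x - δ * Complex.I) = 2 * δ * Complex.I := by ring
    rw [e1, e2, e3]
    generalize x - δ * Complex.I = A at *
    generalize x + δ * Complex.I = B at *
    have hπ : (Real.pi : ℂ) ≠ 0 := by exact_mod_cast Real.pi_ne_zero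
    have hI := Complex.I_ne_zero
    field_simp
    linear_combination e4
  obtain ⟨p, hp⟩ := hpa (η / 2) (half_pos hη)
  refine ⟨p, fun z hz => ?_, fun t ht => ?_⟩
  · set x := (z - (a + t₀ * d)) / d with hx
    have hxm : m ≤ ‖x‖ := hmK z hz
    have hδn : ‖(δ : ℂ) * Complex.I‖ = δ := by
      rw [norm_mul, Complex.norm_I, Complex.norm_real, Real.norm_of_nonneg hδ.le, mul_one]
    have hx1 : x - δ * Complex.I ≠ 0 := by
      intro h; rw [sub_eq_zero] at h; rw [h, hδn] at hxm; linarith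
    have hx2 : x + δ * Complex.I ≠ 0 := by
      intro h; rw [add_eq_zero_iff_eq_neg] at h; rw [h, norm_neg, hδn] at hxm; linarith
    have hpz := hp z (Or.inl hz)
    beta_reduce at hpz
    rw [hval x hx1 hx2 z (by rw [hx]; field_simp; ring)] at hpz
    have hden : m ^ 2 / 2 ≤ ‖x ^ 2 + (δ : ℂ) ^ 2‖ := by
      have := norm_sub_le_norm_add (x ^ 2) ((δ : ℂ) ^ 2)
      rw [norm_pow, norm_pow, Complex.norm_real, Real.norm_of_nonneg hδ.le] at this
      nlinarith
    have hb : ‖(δ : ℂ) / (x ^ 2 + (δ : ℂ) ^ 2) / Real.pi‖ ≤ η / 2 := by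
      rw [norm_div, norm_div, Complex.norm_real, Complex.norm_real, Real.norm_of_nonneg hδ.le,
        Real.norm_of_nonneg Real.pi_pos.le]
      have hm2 : 0 < m ^ 2 / 2 := by positivity
      have h3 : δ / ‖x ^ 2 + (δ : ℂ) ^ 2‖ ≤ η / 2 := by
        rw [div_le_iff₀ (hm2.trans_le hden)]
        nlinarith
      have h4 : 0 ≤ δ / ‖x ^ 2 + (δ : ℂ) ^ 2‖ := by positivity
      exact (div_le_self h4 (by linarith [Real.pi_gt_three])).trans h3
    have h5 := norm_add_le (p.eval z - δ / (x ^ 2 + (δ : ℂ) ^ 2) / Real.pi)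
      (δ / (x ^ 2 + (δ : ℂ) ^ 2) / Real.pi)
    rw [sub_add_cancel] at h5
    linarith
  · have hpz := hp _ (Or.inr (hseg t ht))
    beta_reduce at hpz
    have him : ∀ s : ℝ, s ≠ 0 → ((t - t₀ : ℝ) : ℂ) + s * Complex.I ≠ 0 := by
      intro s hs h
      have := congrArg Complex.im h
      simp at this
      exact hs this
    rw [hval ((t - t₀ : ℝ) : ℂ) (by simpa [sub_eq_add_neg] using him (-δ) (by linarith))
      (him δ hδ.ne') (a + t * d) (by push_cast; ring)] at hpz
    have : ((smoothBump δ (t - t₀) : ℝ) : ℂ) =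
        δ / (((t - t₀ : ℝ) : ℂ) ^ 2 + (δ : ℂ) ^ 2) / Real.pi := by
      simp [smoothBump]
    rw [this]
    linarith

end Steering
-- Steering solutions from a disc to a conformal copy.
section SteeringTheorem
open Set Metric Topology Filter Polynomial
open scoped Matrix

theorem wronskian_eq {u du v dv q : ℂ → ℂ} (hu : ∀ z, HasDerivAt u (du z) z)
    (hdu : ∀ z, HasDerivAt du (q z * u z) z) (hv : ∀ z, HasDerivAt v (dv z) z)
    (hdv : ∀ z, HasDerivAt dv (q z * v z) z) (z s : ℂ) :
    u z * dv z - du z * v z = u s * dv s - du s * v s := by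
  have hW : ∀ z, HasDerivAt (fun z => u z * dv z - du z * v z) 0 z := fun z =>
    (((hu z).mul (hdv z)).sub ((hdu z).mul (hv z))).congr_deriv (by ring)
  exact is_const_of_deriv_eq_zero (fun z => (hW z).differentiableAt) (fun z => (hW z).deriv) z s

/-- The least parameter at which the segment from `0` to `w` meets `K` yields a slit which touches
`K` only at its end. -/
theorem exists_first_hit {K : Set ℂ} (hK : IsClosed K) {w : ℂ} (hw : w ∈ K) (h0 : (0 : ℂ) ∉ K) :
    ∃ b ∈ K, ∀ t : ℝ, 0 ≤ t → t < 1 → (t : ℂ) * b ∉ K := by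
  set S : Set ℝ := Icc 0 1 ∩ (fun t : ℝ => (t : ℂ) * w) ⁻¹' K with hS
  have hSc : IsCompact S := isCompact_Icc.inter_right (hK.preimage (by fun_prop))
  obtain ⟨s, hsS, hs⟩ := hSc.exists_isLeast ⟨1, by simp [hS, hw]⟩
  have hs0 : 0 < s := by
    refine lt_of_le_of_ne hsS.1.1 ?_
    rintro rfl
    exact h0 (by simpa using hsS.2)
  refine ⟨s * w, hsS.2, fun t ht ht1 h => ?_⟩
  have hmem : t * s ∈ S := ⟨⟨by positivity, by nlinarith [hsS.1.2]⟩, by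
    simp only [mem_preimage]; push_cast; rwa [mul_assoc]⟩
  have := hs hmem
  nlinarith

theorem continuous_smoothBump {δ : ℝ} (hδ : 0 < δ) : Continuous (smoothBump δ) := by
  unfold smoothBump
  refine (continuous_const.div (by fun_prop) fun x => ?_).div_const _
  positivity

/-- A linear equation `u'' = q u` with entire `q` can be found such that `q` is prescribed up to a
small error on a closed disc and on a conformal copy of it, and such that the solutions with given
data at the centre of the disc have prescribed data at a point of the copy, up to a small error. -/
theorem exists_steering {φ : ℂ → ℂ} {r ρ R : ℝ} (hr : 0 < r)
    (hrρ : r < ρ) (hρR : ρ < R)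
    (hφ : DifferentiableOn ℂ φ (ball 0 R)) (hinj : InjOn φ (ball 0 R))
    (hd : ∀ z ∈ ball (0 : ℂ) R, deriv φ z ≠ 0)
    (hdisj : Disjoint (closedBall 0 r) (φ '' closedBall 0 ρ)) :
    ∃ ζ ∈ closedBall (0 : ℂ) r, ∀ q₀ q₁ : ℂ → ℂ, DifferentiableOn ℂ q₀ (ball 0 R) →
      DifferentiableOn ℂ q₁ (ball 0 R) → ∀ X B : Matrix (Fin 2) (Fin 2) ℂ, X.det = 1 →
      B.det = 1 → ∀ ε > 0, ∃ q : ℂ → ℂ, Differentiable ℂ q ∧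
        (∀ z ∈ closedBall (0 : ℂ) r, ‖q z - q₀ z‖ ≤ ε) ∧
        (∀ z ∈ closedBall (0 : ℂ) r, ‖q (φ z) - q₁ z‖ ≤ ε) ∧
        ∃ U dU : Fin 2 → ℂ → ℂ, (∀ j z, HasDerivAt (U j) (dU j z) z) ∧
          (∀ j z, HasDerivAt (dU j) (q z * U j z) z) ∧
          (∀ j, U j 0 = X 0 j ∧ dU j 0 = X 1 j) ∧
          ∀ j, ‖U j (φ ζ) - B 0 j‖ ≤ ε ∧ ‖dU j (φ ζ) - B 1 j‖ ≤ ε := by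
  have hrR := hrρ.trans hρR
  set K' := φ '' closedBall 0 r with hK'
  have hK'c : IsCompact K' := (isCompact_closedBall 0 r).image_of_continuousOn
    (hφ.continuousOn.mono (closedBall_subset_ball hrR))
  have hdK : Disjoint (closedBall 0 r) K' :=
    hdisj.mono_right (image_mono (closedBall_subset_closedBall hrρ.le))
  have hK'p : IsPreconnected K'ᶜ :=
    isPreconnected_compl_image_closedBall_of_holo hr hrR hφ hinj hd
  obtain ⟨b, hbK, hbt⟩ := exists_first_hit hK'c.isClosed (w := φ 0)
    ⟨0, mem_closedBall_self hr.le, rfl⟩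
    (fun h => hdK.le_bot ⟨mem_closedBall_self hr.le, h⟩)
  obtain ⟨ζ, hζ, hζb⟩ := id hbK
  refine ⟨ζ, hζ, ?_⟩
  intro q₀ q₁ hq₀ hq₁ X₀ B hX₀ hB ε hε
  have hrb : r < ‖b‖ := by
    by_contra! h
    exact hdK.le_bot ⟨by simpa using h, hbK⟩
  have hb0' : 0 < ‖b‖ := hr.trans hrb
  have hb0 : b ≠ 0 := norm_pos_iff.1 hb0'
  -- The segment `a + t d`, `0 ≤ t ≤ 1`, runs radially from the boundary of the disc to the first
  -- point `b = φ ζ` of the copy. The choice of `ζ` depends on the geometry alone, so it is made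
  -- before the potentials are given.
  set σ := r / ‖b‖ with hσ
  have hσ0 : 0 < σ := by positivity
  have hσ1 : σ < 1 := (div_lt_one hb0').2 hrb
  have hσb : σ * ‖b‖ = r := by rw [hσ]; field_simp
  set c := 1 - σ with hc
  have hc0 : 0 < c := by linarith
  set a : ℂ := σ * b with ha
  set d : ℂ := c * b with hdd
  have had : a + d = b := by rw [ha, hdd, hc]; push_cast; ring
  have hd0 : d ≠ 0 := mul_ne_zero (by exact_mod_cast hc0.ne') hb0
  have hγ : ∀ t : ℝ, a + t * d = ((σ + t * c : ℝ) : ℂ) * b := fun t => by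
    rw [ha, hdd]; push_cast; ring
  have hseg : ∀ t ∈ Icc (0 : ℝ) 1, a + t * d ∈ (fun t : ℝ => (t : ℂ) * b) '' Icc 0 1 :=
    fun t ht => ⟨σ + t * c, ⟨by nlinarith [ht.1], by nlinarith [ht.2]⟩, (hγ t).symm⟩
  have haK : a ∈ closedBall (0 : ℂ) r := by
    rw [mem_closedBall_zero_iff, ha, norm_mul, Complex.norm_real, Real.norm_of_nonneg hσ0.le, hσb]
  set K := closedBall (0 : ℂ) r ∪ K' with hKdef
  have hKc : IsCompact K := (isCompact_closedBall 0 r).union hK'c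
  have hoff : ∀ t : ℝ, 0 < t → t < 1 → a + t * d ∉ K := by
    rintro t ht ht1 (h | h)
    · rw [mem_closedBall_zero_iff, hγ, norm_mul, Complex.norm_real,
        Real.norm_of_nonneg (by positivity)] at h
      nlinarith [mul_pos (mul_pos ht hc0) hb0']
    · rw [hγ] at h
      exact hbt _ (by positivity) (by nlinarith) h
  have hEp : IsPreconnected (K ∪ (fun t : ℝ => (t : ℂ) * b) '' Icc 0 1)ᶜ := by
    rw [hKdef, union_right_comm]
    exact isPreconnected_compl_closedBall_union_segment_union hr hK'c.isClosed hK'p hdK hbK hbt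
  obtain ⟨qb, hqb0, hqb1⟩ := exists_polynomial_pair_approx hr hrρ hρR hφ hinj hd hq₀ hq₁ hdisj
    (half_pos hε)
  have hqbd : Differentiable ℂ fun z => qb.eval z := qb.differentiable
  choose V dV hV0 hdV0 hV hdV using fun j : Fin 2 =>
    exists_entire_ode_solution hqbd 0 (X₀ 0 j) (X₀ 1 j)
  -- States on the segment use derivatives with respect to `t`, whence the factor `d` in the second
  -- row, and `d ^ 2` in the potential.
  set X : Matrix (Fin 2) (Fin 2) ℂ :=
    Matrix.of fun i j => if i = 0 then V j a else d * dV j a with hX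
  set B₁ : Matrix (Fin 2) (Fin 2) ℂ :=
    Matrix.of fun i j => if i = 0 then B 0 j else d * B 1 j with hB₁
  have hXdet : X.det = d := by
    have hW := wronskian_eq (hV 0) (hdV 0) (hV 1) (hdV 1) a 0
    rw [hV0, hV0, hdV0, hdV0] at hW
    rw [Matrix.det_fin_two] at hX₀
    rw [Matrix.det_fin_two]
    simp only [hX, Matrix.of_apply, if_true, one_ne_zero, if_false]
    linear_combination d * (hW + hX₀)
  have hB₁det : B₁.det = d := by
    rw [Matrix.det_fin_two] at hB
    rw [Matrix.det_fin_two]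
    simp only [hB₁, Matrix.of_apply, if_true, one_ne_zero, if_false]
    linear_combination d * hB
  have hdn : 0 < ‖d‖ := norm_pos_iff.2 hd0
  obtain ⟨t₁, t₂, t₃, ht₁, ht₁₂, ht₂₃, ht₃, τ₁, τ₂, τ₃, B', hB', hctrl⟩ :=
    exists_segment_control (Q := fun t => d ^ 2 * qb.eval (a + t * d)) (by fun_prop)
      (X := X) (B := B₁) (by rw [hXdet]; exact hd0) (by rw [hXdet, hB₁det])
      (ε := min (ε / 2) (‖d‖ * (ε / 2))) (by positivity)
  set T := ‖τ₁‖ + ‖τ₂‖ + ‖τ₃‖ with hT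
  have hT0 : 0 ≤ T := by positivity
  have hbump : ∀ n : ℕ, ∃ δ : ℝ, ∃ p₁ p₂ p₃ : ℂ[X], 0 < δ ∧ δ < 1 / ((n : ℝ) + 1) ∧
      ∀ tp ∈ ([(t₁, p₁), (t₂, p₂), (t₃, p₃)] : List (ℝ × ℂ[X])),
      (∀ z ∈ K, ‖tp.2.eval z‖ ≤ 1 / ((n : ℝ) + 1) / (T + 1)) ∧
      ∀ t ∈ Icc (0 : ℝ) 1, ‖tp.2.eval (a + t * d) - smoothBump δ (t - tp.1)‖ ≤
        1 / ((n : ℝ) + 1) / (T + 1) := by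
    intro n
    have hb := fun t₀ (h : a + (t₀ : ℝ) * d ∉ K) => exists_polynomial_bump hKc hb0 hc0.ne' hdd ha
      hEp hseg h (η := 1 / ((n : ℝ) + 1) / (T + 1)) (by positivity)
    obtain ⟨δ, ⟨⟨⟨p₁, h1⟩, p₂, h2⟩, p₃, h3⟩, h4, h5⟩ :=
      (((hb t₁ (hoff _ ht₁ (by linarith))).and (hb t₂ (hoff _ (by linarith) (by linarith)))).and
        (hb t₃ (hoff _ (by linarith) ht₃)) |>.and
        (Ioo_mem_nhdsGT (show (0 : ℝ) < 1 / ((n : ℝ) + 1) by positivity))).exists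
    refine ⟨δ, p₁, p₂, p₃, h4, h5, ?_⟩
    intro tp htp
    simp only [List.mem_cons, List.not_mem_nil, or_false] at htp
    rcases htp with rfl | rfl | rfl
    exacts [h1, h2, h3]
  choose δ p₁ p₂ p₃ hδ hδn hp using hbump
  have hp1 := fun n => hp n (t₁, p₁ n) (by simp)
  have hp2 := fun n => hp n (t₂, p₂ n) (by simp)
  have hp3 := fun n => hp n (t₃, p₃ n) (by simp)
  have hδ0 : Tendsto δ atTop (𝓝 0) :=
    squeeze_zero (fun n => (hδ n).le) (fun n => (hδn n).le) tendsto_one_div_add_atTop_nhds_zero_nat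
  let P : ℕ → ℂ → ℂ := fun n z =>
    τ₁ * (p₁ n).eval z + τ₂ * (p₂ n).eval z + τ₃ * (p₃ n).eval z
  -- Dividing by `d ^ 2` makes the added potential equal to `P n` when the equation is written in
  -- the parameter `t`.
  let q : ℕ → ℂ → ℂ := fun n z => qb.eval z + (d ^ 2)⁻¹ * P n z
  have hqd : ∀ n, Differentiable ℂ (q n) := fun n => by
    have h1 : Differentiable ℂ fun z => (p₁ n).eval z := (p₁ n).differentiable
    have h2 : Differentiable ℂ fun z => (p₂ n).eval z := (p₂ n).differentiable
    have h3 : Differentiable ℂ fun z => (p₃ n).eval z := (p₃ n).differentiable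
    fun_prop
  have htri : ∀ {x y z : ℂ} {e : ℝ}, ‖x‖ ≤ e → ‖y‖ ≤ e → ‖z‖ ≤ e →
      ‖τ₁ * x + τ₂ * y + τ₃ * z‖ ≤ T * e := by
    intro x y z e hx hy hz
    refine norm_add₃_le.trans ?_
    rw [norm_mul, norm_mul, norm_mul, hT, add_mul, add_mul]
    gcongr
  have hTn : ∀ n : ℕ, T * (1 / ((n : ℝ) + 1) / (T + 1)) ≤ 1 / ((n : ℝ) + 1) := by
    intro n
    rw [mul_div_assoc', div_le_iff₀ (by positivity)]
    have : 0 ≤ 1 / ((n : ℝ) + 1) := by positivity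
    nlinarith
  have hqK : ∀ n, ∀ z ∈ K, ‖q n z - qb.eval z‖ ≤ ‖(d ^ 2)⁻¹‖ * (1 / ((n : ℝ) + 1)) := by
    intro n z hz
    simp only [q, add_sub_cancel_left, norm_mul]
    gcongr
    exact (htri ((hp1 n).1 z hz) ((hp2 n).1 z hz) ((hp3 n).1 z hz)).trans (hTn n)
  have hqlim : Tendsto (fun n : ℕ => ‖(d ^ 2)⁻¹‖ * (1 / ((n : ℝ) + 1))) atTop (𝓝 0) := by
    have := (tendsto_one_div_add_atTop_nhds_zero_nat (𝕜 := ℝ)).const_mul ‖(d ^ 2)⁻¹‖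
    rwa [mul_zero] at this
  choose U dU hU0 hdU0 hU hdU using fun (n : ℕ) (j : Fin 2) =>
    exists_entire_ode_solution (hqd n) 0 (X₀ 0 j) (X₀ 1 j)
  -- Inside the disc the masses are negligible, so stability carries the data from the centre to
  -- `a`.
  have hstate : ∀ j, Tendsto (fun n => U n j a) atTop (𝓝 (V j a)) ∧
      Tendsto (fun n => dU n j a) atTop (𝓝 (dV j a)) := by
    intro j
    have key : ∀ ε > 0, ∀ᶠ n in atTop, ‖U n j a - V j a‖ ≤ ε ∧ ‖dU n j a - dV j a‖ ≤ ε := by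
      intro ε hε
      obtain ⟨η, hη, hst⟩ := ode_stability (convex_closedBall (0 : ℂ) r) (isCompact_closedBall 0 r)
        (fun z _ => hV j z) (fun z _ => hdV j z) hqbd.continuous.continuousOn
        (mem_closedBall_self hr.le) hε
      filter_upwards [hqlim.eventually (ge_mem_nhds hη)] with n hn
      exact hst (U n j) (dU n j) (q n) (fun z _ => hU n j z) (fun z _ => hdU n j z)
        (fun z hz => (hqK n z (Or.inl hz)).trans hn) (by rw [hU0, hV0]; simpa using hη.le)
        (by rw [hdU0, hdV0]; simpa using hη.le) a haK
    constructor
    · refine Metric.tendsto_nhds.2 fun ε hε => ?_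
      filter_upwards [key (ε / 2) (half_pos hε)] with n hn
      rw [dist_eq_norm]; linarith [hn.1]
    · refine Metric.tendsto_nhds.2 fun ε hε => ?_
      filter_upwards [key (ε / 2) (half_pos hε)] with n hn
      rw [dist_eq_norm]; linarith [hn.2]
  let e : ℕ → ℝ → ℂ := fun n t =>
    τ₁ * ((p₁ n).eval (a + t * d) - smoothBump (δ n) (t - t₁)) +
    τ₂ * ((p₂ n).eval (a + t * d) - smoothBump (δ n) (t - t₂)) +
    τ₃ * ((p₃ n).eval (a + t * d) - smoothBump (δ n) (t - t₃))
  have hec : ∀ n, Continuous (e n) := by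
    intro n
    have h0 : ∀ s : ℝ, Continuous fun t : ℝ => (smoothBump (δ n) (t - s) : ℂ) := fun s =>
      Complex.continuous_ofReal.comp ((continuous_smoothBump (hδ n)).comp (by fun_prop))
    have h1 : ∀ p : ℂ[X], Continuous fun t : ℝ => p.eval (a + t * d) := fun p =>
      p.continuous.comp (by fun_prop)
    exact ((continuous_const.mul ((h1 _).sub (h0 _))).add
      (continuous_const.mul ((h1 _).sub (h0 _)))).add (continuous_const.mul ((h1 _).sub (h0 _)))
  have hline : ∀ t : ℝ, HasDerivAt (fun t : ℝ => a + t * d) d t := by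
    intro t
    refine (((Complex.ofRealCLM.hasDerivAt (x := t)).mul_const d).const_add a).congr_deriv ?_
    simp
  have hend : ∀ j, Tendsto (fun n => U n j b) atTop (𝓝 (B' 0 j)) ∧
      Tendsto (fun n => d * dU n j b) atTop (𝓝 (B' 1 j)) := by
    intro j
    have := hctrl δ hδ hδ0 e (fun n => 1 / ((n : ℝ) + 1)) hec tendsto_one_div_add_atTop_nhds_zero_nat
      (fun n => by rw [div_le_one (by positivity)]; linarith [(Nat.cast_nonneg n : (0 : ℝ) ≤ n)])
      (fun n t ht => (htri ((hp1 n).2 t ht) ((hp2 n).2 t ht) ((hp3 n).2 t ht)).trans (hTn n))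
      j (fun n t => U n j (a + t * d)) (fun n t => d * dU n j (a + t * d))
      (fun n t => ((hU n j _).comp t (hline t)).congr_deriv (mul_comm _ _))
      (fun n t => (((hdU n j _).comp t (hline t)).const_mul d).congr_deriv (by
        simp only [q, P, e]; field_simp; ring))
      (by simpa [hX] using (hstate j).1) (by simpa [hX] using (hstate j).2.const_mul d)
    simpa [had] using this
  have hfin : ∀ j, ∀ᶠ n in atTop, ‖U n j b - B 0 j‖ ≤ ε ∧ ‖dU n j b - B 1 j‖ ≤ ε := by
    intro j
    have h1 := (((hend j).1.sub_const (B' 0 j)).norm).eventually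
      (ge_mem_nhds (by simpa using half_pos hε : ‖B' 0 j - B' 0 j‖ < ε / 2))
    have h2 := (((hend j).2.sub_const (B' 1 j)).norm).eventually
      (ge_mem_nhds (by simpa using mul_pos hdn (half_pos hε) :
        ‖B' 1 j - B' 1 j‖ < ‖d‖ * (ε / 2)))
    filter_upwards [h1, h2] with n h1 h2
    have b0 := (hB' 0 j).trans_le (min_le_left _ _)
    have b1 := (hB' 1 j).trans_le (min_le_right _ _)
    simp only [hB₁, Matrix.of_apply, if_true, one_ne_zero, if_false] at b0 b1
    constructor
    · have := norm_add_le (U n j b - B' 0 j) (B' 0 j - B 0 j)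
      rw [sub_add_sub_cancel] at this
      linarith
    · have := norm_add_le (d * dU n j b - B' 1 j) (B' 1 j - d * B 1 j)
      rw [sub_add_sub_cancel, ← mul_sub, norm_mul] at this
      have h3 : ‖d‖ * ‖dU n j b - B 1 j‖ ≤ ‖d‖ * ε := by linarith
      exact le_of_mul_le_mul_left h3 hdn
  obtain ⟨n, hn, hn0, hn1⟩ := ((hqlim.eventually (ge_mem_nhds (half_pos hε))).and
    ((hfin 0).and (hfin 1))).exists
  have hclose : ∀ z ∈ K, ∀ w : ℂ, ‖qb.eval z - w‖ < ε / 2 → ‖q n z - w‖ ≤ ε := by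
    intro z hz w hw
    have h1 := (hqK n z hz).trans hn
    have h2 := norm_add_le (q n z - qb.eval z) (qb.eval z - w)
    rw [sub_add_sub_cancel] at h2
    linarith
  refine ⟨q n, hqd n, fun z hz => hclose z (Or.inl hz) _ (hqb0 z hz),
    fun z hz => hclose (φ z) (Or.inr ⟨z, hz, rfl⟩) _ (hqb1 z hz), U n, dU n, hU n, hdU n,
    fun j => ⟨hU0 n j, hdU0 n j⟩, ?_⟩
  rw [hζb]
  intro j
  fin_cases j
  · exact hn0
  · exact hn1

end SteeringTheorem
-- Unit pairs and their approximation on two discs.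
section PairSteering
open Set Metric Topology Filter Polynomial
open scoped Matrix

/-- A holomorphic function without zeros on a disc has a holomorphic logarithm there. -/
theorem exists_differentiableOn_exp_eq {g : ℂ → ℂ} {R : ℝ} (hg : DifferentiableOn ℂ g (ball 0 R))
    (h0 : ∀ z ∈ ball (0 : ℂ) R, g z ≠ 0) :
    ∃ l : ℂ → ℂ, DifferentiableOn ℂ l (ball 0 R) ∧ ∀ z ∈ ball (0 : ℂ) R, Complex.exp (l z) = g z := by
  rcases le_or_gt R 0 with hR | hR
  · rw [ball_eq_empty.2 hR]
    exact ⟨0, differentiableOn_empty, by simp⟩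
  have hg' : DifferentiableOn ℂ (deriv g) (ball 0 R) := hg.deriv isOpen_ball
  -- A primitive of `g' / g`, normalised at `0`; the product `exp (-l) * g` has zero derivative.
  obtain ⟨l, hl0, hl⟩ := (DifferentiableOn.isExactOn_ball
    (hg'.div hg h0)).with_val_at 0 (Complex.log (g 0))
  refine ⟨l, fun z hz => (hl z hz).differentiableAt.differentiableWithinAt, ?_⟩
  have hder : ∀ z ∈ ball (0 : ℂ) R, HasDerivAt (fun z => Complex.exp (-l z) * g z) 0 z := by
    intro z hz
    refine (((hl z hz).neg.cexp).mul (hg.differentiableAt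
      (isOpen_ball.mem_nhds hz)).hasDerivAt).congr_deriv ?_
    have := h0 z hz
    simp only [Pi.div_apply]
    field_simp
    ring
  intro z hz
  have h1 := isOpen_ball.is_const_of_deriv_eq_zero (convex_ball (0 : ℂ) R).isPreconnected
    (fun z hz => (hder z hz).differentiableAt.differentiableWithinAt)
    (fun z hz => (hder z hz).deriv) hz (mem_ball_self hR)
  simp only [hl0, Complex.exp_neg, Complex.exp_log (h0 0 (mem_ball_self hR))] at h1
  rw [inv_mul_cancel₀ (h0 0 (mem_ball_self hR))] at h1
  have := Complex.exp_ne_zero (l z)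
  field_simp at h1
  exact h1.symm

/-- A pair of holomorphic functions with Wronskian `1`. -/
def IsUnitPair (S : Set ℂ) (u : Fin 2 → ℂ → ℂ) : Prop :=
  (∀ j, DifferentiableOn ℂ (u j) S) ∧
    ∀ z ∈ S, u 0 z * deriv (u 1) z - deriv (u 0) z * u 1 z = 1

theorem IsUnitPair.mono {S T : Set ℂ} {u : Fin 2 → ℂ → ℂ} (hu : IsUnitPair T u) (h : S ⊆ T) :
    IsUnitPair S u :=
  ⟨fun j => (hu.1 j).mono h, fun z hz => hu.2 z (h hz)⟩

/-- The members of a unit pair solve one and the same equation `u'' = q u`. -/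
theorem IsUnitPair.exists_potential {S : Set ℂ} (hS : IsOpen S) {u : Fin 2 → ℂ → ℂ}
    (hu : IsUnitPair S u) :
    ∃ q : ℂ → ℂ, DifferentiableOn ℂ q S ∧
      ∀ j, ∀ z ∈ S, HasDerivAt (deriv (u j)) (q z * u j z) z := by
  have hd : ∀ j, DifferentiableOn ℂ (deriv (u j)) S := fun j => (hu.1 j).deriv hS
  have hdd : ∀ j, DifferentiableOn ℂ (deriv (deriv (u j))) S := fun j => (hd j).deriv hS
  -- Differentiating the Wronskian gives `u₀ u₁'' = u₀'' u₁`, and with Wronskian `1` this identifies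
  -- the common quotient `uⱼ'' / uⱼ` as the displayed expression.
  refine ⟨fun z => deriv (deriv (u 0)) z * deriv (u 1) z - deriv (u 0) z * deriv (deriv (u 1)) z,
    ((hdd 0).mul (hd 1)).sub ((hd 0).mul (hdd 1)), ?_⟩
  intro j z hz
  have h1 : ∀ j, HasDerivAt (u j) (deriv (u j) z) z := fun j =>
    ((hu.1 j).differentiableAt (hS.mem_nhds hz)).hasDerivAt
  have h2 : ∀ j, HasDerivAt (deriv (u j)) (deriv (deriv (u j)) z) z := fun j =>
    ((hd j).differentiableAt (hS.mem_nhds hz)).hasDerivAt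
  have hW := ((h1 0).mul (h2 1)).sub ((h2 0).mul (h1 1))
  have hW0 := hW.unique ((hasDerivAt_const z (1 : ℂ)).congr_of_eventuallyEq
    ((hS.eventually_mem hz).mono fun w hw => hu.2 w hw))
  refine (h2 j).congr_deriv ?_
  have hw := hu.2 z hz
  fin_cases j
  · simp only [Fin.zero_eta]
    linear_combination -deriv (deriv (u 0)) z * hw + deriv (u 0) z * hW0
  · simp only [Fin.mk_one]
    linear_combination -deriv (deriv (u 1)) z * hw + deriv (u 1) z * hW0

/-- With `s² = φ'` and `m = s' / s²`, the functions `f = (U ∘ φ) / s` solve `f'' = ((q ∘ φ) s⁴ - s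
m') f` whenever `U'' = q U`. Approximating `w` by `f` thus means prescribing `q` on the copy and the
data of `U` at the single point `φ ζ`, which is what steering provides. The last identity says that
densities of pairs transform by pullback. -/
theorem exists_unitPair_near {φ : ℂ → ℂ} {r ρ R : ℝ} (hr : 0 < r) (hrρ : r < ρ) (hρR : ρ < R)
    (hφ : DifferentiableOn ℂ φ (ball 0 R)) (hinj : InjOn φ (ball 0 R))
    (hd : ∀ z ∈ ball (0 : ℂ) R, deriv φ z ≠ 0)
    (hdisj : Disjoint (closedBall 0 r) (φ '' closedBall 0 ρ)) {u w : Fin 2 → ℂ → ℂ}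
    (hu : IsUnitPair (ball 0 R) u) (hw : IsUnitPair (ball 0 R) w) {ε : ℝ} (hε : 0 < ε) :
    ∃ U f : Fin 2 → ℂ → ℂ, IsUnitPair univ U ∧
      ∀ z ∈ closedBall (0 : ℂ) r, ∀ j, ‖U j z - u j z‖ ≤ ε ∧ ‖f j z - w j z‖ ≤ ε ∧
        ‖U j (φ z)‖ ^ 2 = ‖deriv φ z‖ * ‖f j z‖ ^ 2 := by
  have hrR := hrρ.trans hρR
  have hsub : closedBall (0 : ℂ) r ⊆ ball 0 R := closedBall_subset_ball hrR
  have h0R : (0 : ℂ) ∈ ball (0 : ℂ) R := mem_ball_self (hr.trans hrR)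
  have h0r : (0 : ℂ) ∈ closedBall (0 : ℂ) r := mem_closedBall_self hr.le
  obtain ⟨l, hl, hle⟩ := exists_differentiableOn_exp_eq (hφ.deriv isOpen_ball) hd
  set s : ℂ → ℂ := fun z => Complex.exp (l z / 2) with hs
  have hs0 : ∀ z, s z ≠ 0 := fun z => Complex.exp_ne_zero _
  have hsd : DifferentiableOn ℂ s (ball 0 R) := (hl.div_const 2).cexp
  have hss : ∀ z ∈ ball (0 : ℂ) R, deriv φ z = s z ^ 2 := fun z hz => by
    rw [← hle z hz, hs, ← Complex.exp_nat_mul]; congr 1; push_cast; ring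
  set m : ℂ → ℂ := fun z => deriv s z / s z ^ 2 with hm
  have hmd : DifferentiableOn ℂ m (ball 0 R) :=
    (hsd.deriv isOpen_ball).div (hsd.pow 2) fun z _ => pow_ne_zero 2 (hs0 z)
  have hm'd : DifferentiableOn ℂ (deriv m) (ball 0 R) := hmd.deriv isOpen_ball
  obtain ⟨qu, hqu, hu2⟩ := hu.exists_potential isOpen_ball
  obtain ⟨qw, hqw, hw2⟩ := hw.exists_potential isOpen_ball
  obtain ⟨ζ, hζ, hsteer⟩ := exists_steering hr hrρ hρR hφ hinj hd hdisj
  have hζR := hsub hζ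
  have hder : ∀ {g : ℂ → ℂ}, DifferentiableOn ℂ g (ball 0 R) → ∀ z ∈ ball (0 : ℂ) R,
      HasDerivAt g (deriv g z) z := fun hg z hz =>
    (hg.differentiableAt (isOpen_ball.mem_nhds hz)).hasDerivAt
  choose η hη hst using fun j => ode_stability (convex_closedBall (0 : ℂ) r)
    (isCompact_closedBall 0 r) (fun z hz => hder (hu.1 j) z (hsub hz))
    (fun z hz => hu2 j z (hsub hz)) (hqu.continuousOn.mono hsub) h0r hε
  choose θ hθ hst' using fun j => ode_stability (convex_closedBall (0 : ℂ) r)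
    (isCompact_closedBall 0 r) (fun z hz => hder (hw.1 j) z (hsub hz))
    (fun z hz => hw2 j z (hsub hz)) (hqw.continuousOn.mono hsub) hζ hε
  obtain ⟨C, hC⟩ := (isCompact_closedBall (0 : ℂ) r).exists_bound_of_continuousOn
    ((hsd.pow 4).continuousOn.mono hsub)
  set D := |C| + ‖(s ζ)⁻¹‖ + ‖s ζ‖ + ‖m ζ‖ + 1 with hD
  have hD0 : 0 < D := by positivity
  -- `D` dominates the factors `s⁴`, `1 / s ζ` and `|s ζ| + |m ζ|` by which the steering errors grow
  -- when they are expressed in terms of `f`.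
  set e := min (min (η 0) (η 1)) (min (θ 0) (θ 1) / D) with he
  have he0 : 0 < e := lt_min (lt_min (hη 0) (hη 1)) (div_pos (lt_min (hθ 0) (hθ 1)) hD0)
  have heη : ∀ j, e ≤ η j := fun j => by
    fin_cases j
    exacts [(min_le_left _ _).trans (min_le_left _ _), (min_le_left _ _).trans (min_le_right _ _)]
  have heθ : ∀ j, D * e ≤ θ j := fun j => by
    have h1 : D * e ≤ min (θ 0) (θ 1) := by
      rw [mul_comm, ← le_div_iff₀ hD0]; exact min_le_right _ _
    fin_cases j
    exacts [h1.trans (min_le_left _ _), h1.trans (min_le_right _ _)]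
  obtain ⟨q, hq, hq0, hq1, U, dU, hU, hdU, hU0, hUζ⟩ := hsteer qu
    (fun z => (qw z + s z * deriv m z) / s z ^ 4) hqu
    ((hqw.add (hsd.mul hm'd)).div (hsd.pow 4) fun z _ => pow_ne_zero 4 (hs0 z))
    (Matrix.of fun i j => if i = 0 then u j 0 else deriv (u j) 0)
    (Matrix.of fun i j => if i = 0 then s ζ * w j ζ else deriv (w j) ζ / s ζ + w j ζ * m ζ)
    (by
      rw [Matrix.det_fin_two]
      simp only [Matrix.of_apply, if_true, one_ne_zero, if_false]
      linear_combination hu.2 0 h0R)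
    (by
      rw [Matrix.det_fin_two]
      simp only [Matrix.of_apply, if_true, one_ne_zero, if_false]
      have := hs0 ζ
      rw [← hw.2 ζ hζR]
      field_simp
      ring) e he0
  simp only [Matrix.of_apply, if_true, one_ne_zero, if_false] at hU0 hUζ
  have hUd : ∀ j, deriv (U j) = dU j := fun j => funext fun z => (hU j z).deriv
  refine ⟨U, fun j z => U j (φ z) / s z, ⟨fun j z _ => (hU j z).differentiableAt.differentiableWithinAt, ?_⟩,
    fun z hz j => ⟨?_, ?_, ?_⟩⟩
  · intro z _
    rw [hUd, hUd, wronskian_eq (hU 0) (hdU 0) (hU 1) (hdU 1) z 0, (hU0 0).1, (hU0 1).1, (hU0 0).2,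
      (hU0 1).2]
    exact hu.2 0 h0R
  · refine (hst j (U j) (dU j) q (fun z _ => hU j z) (fun z _ => hdU j z)
      (fun z hz => (hq0 z hz).trans (heη j)) ?_ ?_ z hz).1
    · rw [(hU0 j).1, sub_self, norm_zero]; exact (hη j).le
    · rw [(hU0 j).2, sub_self, norm_zero]; exact (hη j).le
  · refine (hst' j (fun z => U j (φ z) / s z) (fun z => dU j (φ z) * s z - U j (φ z) * m z)
      (fun z => q (φ z) * s z ^ 4 - s z * deriv m z) ?_ ?_ ?_ ?_ ?_ z hz).1
    · intro z hz
      have hz' := hsub hz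
      refine (((hU j (φ z)).comp z (hder hφ z hz')).div (hder hsd z hz') (hs0 z)).congr_deriv ?_
      have := hs0 z
      simp only [hss z hz', hm, Function.comp_apply]
      field_simp
    · intro z hz
      have hz' := hsub hz
      refine ((((hdU j (φ z)).comp z (hder hφ z hz')).mul (hder hsd z hz')).sub
        (((hU j (φ z)).comp z (hder hφ z hz')).mul (hder hmd z hz'))).congr_deriv ?_
      have := hs0 z
      simp only [hss z hz', Function.comp_apply]
      have hmm : deriv s z = m z * s z ^ 2 := by simp only [hm]; field_simp
      rw [hmm]
      field_simp
      ring
    · intro z hz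
      have hz' := hsub hz
      have h1 := hq1 z hz
      have h2 : q (φ z) * s z ^ 4 - s z * deriv m z - qw z
          = (q (φ z) - (qw z + s z * deriv m z) / s z ^ 4) * s z ^ 4 := by
        have := hs0 z
        field_simp
        ring
      rw [h2, norm_mul]
      refine le_trans ?_ (heθ j)
      rw [mul_comm]
      refine mul_le_mul ((hC z hz).trans ?_) h1 (norm_nonneg _) hD0.le
      have := le_abs_self C
      have := norm_nonneg (s ζ)⁻¹
      have := norm_nonneg (s ζ)
      have := norm_nonneg (m ζ)
      rw [hD]; linarith
    · have h2 : U j (φ ζ) / s ζ - w j ζ = (s ζ)⁻¹ * (U j (φ ζ) - s ζ * w j ζ) := by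
        have := hs0 ζ
        field_simp
      rw [h2, norm_mul]
      refine le_trans ?_ (heθ j)
      refine mul_le_mul ?_ (hUζ j).1 (norm_nonneg _) hD0.le
      have := abs_nonneg C
      have := norm_nonneg (s ζ)
      have := norm_nonneg (m ζ)
      rw [hD]; linarith
    · have h2 : dU j (φ ζ) * s ζ - U j (φ ζ) * m ζ - deriv (w j) ζ
          = s ζ * (dU j (φ ζ) - (deriv (w j) ζ / s ζ + w j ζ * m ζ))
            - m ζ * (U j (φ ζ) - s ζ * w j ζ) := by
        have := hs0 ζ
        field_simp
        ring
      rw [h2]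
      refine (norm_sub_le _ _).trans (le_trans ?_ (heθ j))
      rw [norm_mul, norm_mul]
      have h3 := mul_le_mul_of_nonneg_left (hUζ j).2 (norm_nonneg (s ζ))
      have h4 := mul_le_mul_of_nonneg_left (hUζ j).1 (norm_nonneg (m ζ))
      have h5 : (‖s ζ‖ + ‖m ζ‖) * e ≤ D * e := by
        refine mul_le_mul_of_nonneg_right ?_ he0.le
        have := abs_nonneg C
        have := norm_nonneg (s ζ)⁻¹
        rw [hD]; linarith
      linarith
  · rw [norm_div, div_pow, hss z (hsub hz), norm_pow]
    have := norm_ne_zero_iff.2 (hs0 z)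
    field_simp

end PairSteering
-- The Laplacian under holomorphic maps, and curvature of the model densities.
section Curvature
open Set Metric Topology Filter

/-- The Laplacian involves only the diagonal values of the Hessian at `1` and `I`, so
differentiation along lines suffices. -/
theorem iteratedFDeriv_two_eq_of_line {f : ℂ → ℝ} {z ω : ℂ} (hf : ContDiffAt ℝ 2 f z) {g : ℝ → ℝ}
    {a : ℝ} (hg : ∀ᶠ t : ℝ in 𝓝 0, HasDerivAt (fun t : ℝ => f (z + t * ω)) (g t) t)
    (ha : HasDerivAt g a 0) : iteratedFDeriv ℝ 2 f z ![ω, ω] = a := by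
  rw [iteratedFDeriv_two_apply]
  simp only [Matrix.cons_val_zero, Matrix.cons_val_one]
  have hline : ∀ t : ℝ, HasDerivAt (fun t : ℝ => z + t * ω) ω t := fun t =>
    (((Complex.ofRealCLM.hasDerivAt (x := t)).mul_const ω).const_add z).congr_deriv (by simp)
  have h1 : HasFDerivAt (fderiv ℝ f) (fderiv ℝ (fderiv ℝ f) z) (z + ((0 : ℝ) : ℂ) * ω) := by
    simpa using ((hf.fderiv_right (m := 1) le_rfl).differentiableAt one_ne_zero).hasFDerivAt
  have hD : HasDerivAt (fun t : ℝ => fderiv ℝ f (z + t * ω)) (fderiv ℝ (fderiv ℝ f) z ω) 0 :=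
    h1.comp_hasDerivAt (0 : ℝ) (hline 0)
  have h2 : HasDerivAt (fun t : ℝ => fderiv ℝ f (z + t * ω) ω) (fderiv ℝ (fderiv ℝ f) z ω ω) 0 :=
    (ContinuousLinearMap.apply ℝ ℝ ω).hasFDerivAt.comp_hasDerivAt (0 : ℝ) hD
  have hev : ∀ᶠ t : ℝ in 𝓝 0, ContDiffAt ℝ 2 f (z + t * ω) := by
    have hc : Tendsto (fun t : ℝ => z + t * ω) (𝓝 0) (𝓝 z) := by
      have := (hline 0).continuousAt.tendsto
      simpa using this
    exact hc.eventually (hf.eventually (by simp))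
  refine h2.unique (ha.congr_of_eventuallyEq ?_)
  filter_upwards [hg, hev] with t h3 h4
  exact ((h4.differentiableAt two_ne_zero).hasFDerivAt.comp_hasDerivAt t (hline t)).unique h3

/-- The first order term of the chain rule carries `φ'' ω²`, which cancels between `ω = 1` and `ω =
I`. Multiplication by `φ'` is a rotation combined with a scaling, so it multiplies the trace of the
Hessian by `‖φ'‖²`. -/
theorem laplacian_comp_of_differentiableAt {f : ℂ → ℝ} {φ : ℂ → ℂ} {S : Set ℂ} (hS : IsOpen S)
    (hφ : DifferentiableOn ℂ φ S) {z : ℂ} (hz : z ∈ S) (hf : ContDiffAt ℝ 2 f (φ z)) :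
    Laplacian.laplacian (fun w => f (φ w)) z =
      ‖deriv φ z‖ ^ 2 * Laplacian.laplacian f (φ z) := by
  have hφc : ContDiffAt ℝ 2 φ z :=
    ((hφ.contDiffOn hS).contDiffAt (hS.mem_nhds hz)).restrict_scalars ℝ
  have hline : ∀ (ω : ℂ) (t : ℝ), HasDerivAt (fun t : ℝ => z + t * ω) ω t := fun ω t =>
    (((Complex.ofRealCLM.hasDerivAt (x := t)).mul_const ω).const_add z).congr_deriv (by simp)
  have hc : ∀ ω, Tendsto (fun t : ℝ => z + t * ω) (𝓝 0) (𝓝 z) := fun ω => by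
    have := (hline ω 0).continuousAt.tendsto
    simpa using this
  have hφ' := hφ.deriv hS
  have key : ∀ ω : ℂ, iteratedFDeriv ℝ 2 (fun w => f (φ w)) z ![ω, ω] =
      fderiv ℝ (fderiv ℝ f) (φ z) (deriv φ z * ω) (deriv φ z * ω) +
        fderiv ℝ f (φ z) (deriv (deriv φ) z * ω * ω) := by
    intro ω
    refine iteratedFDeriv_two_eq_of_line (hf.comp z hφc)
      (g := fun t => fderiv ℝ f (φ (z + t * ω)) (deriv φ (z + t * ω) * ω)) ?_ ?_
    · have h1 : ∀ᶠ w in 𝓝 z, ContDiffAt ℝ 2 f (φ w) :=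
        hφc.continuousAt.eventually (hf.eventually (by simp))
      filter_upwards [(hc ω).eventually h1, (hc ω).eventually (hS.eventually_mem hz)] with t h2 h3
      exact (h2.differentiableAt two_ne_zero).hasFDerivAt.comp_hasDerivAt t
        (((hφ.differentiableAt (hS.mem_nhds h3)).hasDerivAt).comp t (hline ω t))
    · have hz0 : z + ((0 : ℝ) : ℂ) * ω = z := by simp
      have h1 : HasFDerivAt (fderiv ℝ f) (fderiv ℝ (fderiv ℝ f) (φ z))
          (φ (z + ((0 : ℝ) : ℂ) * ω)) := by
        rw [hz0]
        exact ((hf.fderiv_right (m := 1) le_rfl).differentiableAt one_ne_zero).hasFDerivAt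
      have h2 : HasDerivAt φ (deriv φ z) (z + ((0 : ℝ) : ℂ) * ω) := by
        rw [hz0]; exact (hφ.differentiableAt (hS.mem_nhds hz)).hasDerivAt
      have h3 : HasDerivAt (deriv φ) (deriv (deriv φ) z) (z + ((0 : ℝ) : ℂ) * ω) := by
        rw [hz0]; exact (hφ'.differentiableAt (hS.mem_nhds hz)).hasDerivAt
      have h4 : HasDerivAt (fun t : ℝ => φ (z + t * ω)) (deriv φ z * ω) 0 :=
        h2.comp (0 : ℝ) (hline ω 0)
      have h5 : HasDerivAt (fun t : ℝ => deriv φ (z + t * ω)) (deriv (deriv φ) z * ω) 0 :=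
        h3.comp (h₂ := deriv φ) (0 : ℝ) (hline ω 0)
      have h6 : HasDerivAt (fun t : ℝ => fderiv ℝ f (φ (z + t * ω)))
          (fderiv ℝ (fderiv ℝ f) (φ z) (deriv φ z * ω)) 0 := h1.comp_hasDerivAt (0 : ℝ) h4
      have h7 := h6.clm_apply (h5.mul_const ω)
      rw [hz0] at h7
      exact h7
  have hre : ∀ a : ℂ, a = a.re • (1 : ℂ) + a.im • Complex.I := fun a => by
    simp [Complex.re_add_im]
  rw [InnerProductSpace.laplacian_eq_iteratedFDeriv_complexPlane,
    InnerProductSpace.laplacian_eq_iteratedFDeriv_complexPlane]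
  beta_reduce
  rw [key, key, iteratedFDeriv_two_apply, iteratedFDeriv_two_apply]
  simp only [Matrix.cons_val_zero, Matrix.cons_val_one]
  set a := deriv φ z
  have e1 : a * 1 = a.re • (1 : ℂ) + a.im • Complex.I := by rw [mul_one]; exact hre a
  have e2 : a * Complex.I = (-a.im) • (1 : ℂ) + a.re • Complex.I := by
    apply Complex.ext <;> simp
  have e3 : deriv (deriv φ) z * Complex.I * Complex.I = - (deriv (deriv φ) z * 1 * 1) := by
    rw [mul_assoc, Complex.I_mul_I]; ring
  rw [e1, e2, e3, ← Complex.normSq_eq_norm_sq, Complex.normSq_apply]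
  simp only [map_add, map_smul, map_neg, add_apply,
    smul_apply, smul_eq_mul]
  ring

/-- `l` is the density of a conformal metric of constant curvature `c` on the open set `S`. -/
def IsConstCurvatureDensity (S : Opens ℂ) (c : ℝ) (l : ℂ → ℝ) : Prop :=
  IsRegularConformalDensity S l ∧ ∀ z ∈ S, gaussCurvature l z = c

/-- The extra summand `log ‖φ'‖` is harmonic, and both the Laplacian and the squared density acquire
the factor `‖φ'‖²`. -/
theorem IsConstCurvatureDensity.pullback {S T : Opens ℂ} {c : ℝ} {l : ℂ → ℝ}
    (hl : IsConstCurvatureDensity T c l) {φ : ℂ → ℂ} (hφ : DifferentiableOn ℂ φ S)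
    (hm : MapsTo φ S T) (hd : ∀ z ∈ S, deriv φ z ≠ 0) :
    IsConstCurvatureDensity S c fun z => l (φ z) * ‖deriv φ z‖ := by
  have hφ' := hφ.deriv S.isOpen
  have hφr : ContDiffOn ℝ 2 φ S := fun z hz =>
    ((hφ.contDiffOn S.isOpen) z hz).restrict_scalars ℝ
  have hφ'r : ContDiffOn ℝ 2 (deriv φ) S := fun z hz =>
    ((hφ'.contDiffOn S.isOpen) z hz).restrict_scalars ℝ
  refine ⟨⟨fun z hz => mul_pos (hl.1.1 _ (hm hz)) (norm_pos_iff.2 (hd z hz)),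
    (hl.1.2.comp hφr hm).mul (hφ'r.norm ℝ hd)⟩, fun z hz => ?_⟩
  have hlz := hl.1.1 _ (hm hz)
  have hlog : ContDiffAt ℝ 2 (fun w => Real.log (l w)) (φ z) :=
    (hl.1.2.contDiffAt (T.isOpen.mem_nhds (hm hz))).log hlz.ne'
  have hh : InnerProductSpace.HarmonicAt (fun w => Real.log ‖deriv φ w‖) z :=
    AnalyticAt.harmonicAt_log_norm (hφ'.analyticAt (S.isOpen.mem_nhds hz)) (hd z hz)
  have hev : (fun w => Real.log (l (φ w) * ‖deriv φ w‖)) =ᶠ[𝓝 z]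
      (fun w => Real.log (l (φ w))) + fun w => Real.log ‖deriv φ w‖ := by
    filter_upwards [S.isOpen.eventually_mem hz] with w hw
    exact Real.log_mul (hl.1.1 _ (hm hw)).ne' (norm_ne_zero_iff.2 (hd w hw))
  have hcomp : ContDiffAt ℝ 2 (fun w => Real.log (l (φ w))) z :=
    hlog.comp z (hφr.contDiffAt (S.isOpen.mem_nhds hz))
  have hcurv := hl.2 _ (hm hz)
  unfold gaussCurvature at hcurv ⊢
  rw [(InnerProductSpace.laplacian_congr_nhds hev).eq_of_nhds, hcomp.laplacian_add hh.1,
    hh.2.eq_of_nhds, laplacian_comp_of_differentiableAt S.isOpen hφ hz hlog, ← hcurv]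
  have := norm_ne_zero_iff.2 (hd z hz)
  simp only [Pi.zero_apply, add_zero]
  field_simp

theorem isConstCurvatureDensity_exp_re {S : Opens ℂ} {h : ℂ → ℂ} (hh : DifferentiableOn ℂ h S) :
    IsConstCurvatureDensity S 0 fun z => Real.exp (h z).re := by
  have hr : ContDiffOn ℝ 2 (fun z => (h z).re) S := fun z hz =>
    Complex.reCLM.contDiff.contDiffAt.comp_contDiffWithinAt z
      (((hh.contDiffOn S.isOpen) z hz).restrict_scalars ℝ)
  refine ⟨⟨fun z _ => Real.exp_pos _, hr.exp⟩, fun z hz => ?_⟩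
  unfold gaussCurvature
  simp only [Real.log_exp]
  have : InnerProductSpace.HarmonicAt (fun z => (h z).re) z :=
    AnalyticAt.harmonicAt_re (hh.analyticAt (S.isOpen.mem_nhds hz))
  rw [this.2.eq_of_nhds]
  simp

/-- The density of the pullback of the metric of curvature `c` on the sphere under the quotient of
a unit pair. -/
noncomputable def pairDensity (c : ℝ) (u : Fin 2 → ℂ) : ℝ :=
  2 / (√c * (‖u 0‖ ^ 2 + ‖u 1‖ ^ 2))

theorem IsUnitPair.pos {S : Set ℂ} {u : Fin 2 → ℂ → ℂ} (hu : IsUnitPair S u) {z : ℂ}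
    (hz : z ∈ S) : 0 < ‖u 0 z‖ ^ 2 + ‖u 1 z‖ ^ 2 := by
  by_contra! h
  have h0 : u 0 z = 0 := by
    rw [← norm_eq_zero, ← sq_eq_zero_iff]; nlinarith [sq_nonneg ‖u 0 z‖, sq_nonneg ‖u 1 z‖]
  have h1 : u 1 z = 0 := by
    rw [← norm_eq_zero, ← sq_eq_zero_iff]; nlinarith [sq_nonneg ‖u 0 z‖, sq_nonneg ‖u 1 z‖]
  have := hu.2 z hz
  simp [h0, h1] at this

/-- With `v = |u₀|² + |u₁|²` and Wronskian `W`, Lagrange's identity gives `Δ log v = 4 |W|² / v²`,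
and here `W = 1`. -/
theorem IsUnitPair.isConstCurvatureDensity {S : Opens ℂ} {c : ℝ} (hc : 0 < c)
    {u : Fin 2 → ℂ → ℂ} (hu : IsUnitPair S u) :
    IsConstCurvatureDensity S c fun z => pairDensity c fun j => u j z := by
  have hur : ∀ j, ContDiffOn ℝ 2 (u j) S := fun j z hz =>
    (((hu.1 j).contDiffOn S.isOpen) z hz).restrict_scalars ℝ
  have hsc := Real.sqrt_pos.2 hc
  have hcd : ContDiffOn ℝ 2 (fun z => pairDensity c fun j => u j z) S :=
    contDiffOn_const.div (contDiffOn_const.mul (((hur 0).norm_sq ℝ).add ((hur 1).norm_sq ℝ)))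
      fun z hz => (mul_pos hsc (hu.pos hz)).ne'
  have hpos : ∀ z ∈ S, 0 < pairDensity c fun j => u j z := fun z hz =>
    div_pos two_pos (mul_pos hsc (hu.pos hz))
  refine ⟨⟨hpos, hcd⟩, fun z hz => ?_⟩
  have hline : ∀ (ω : ℂ) (t : ℝ), HasDerivAt (fun t : ℝ => z + t * ω) ω t := fun ω t =>
    (((Complex.ofRealCLM.hasDerivAt (x := t)).mul_const ω).const_add z).congr_deriv (by simp)
  have hct : ∀ ω, Tendsto (fun t : ℝ => z + t * ω) (𝓝 0) (𝓝 z) := fun ω => by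
    have := (hline ω 0).continuousAt.tendsto
    simpa using this
  have hd1 : ∀ j (ω : ℂ) (t : ℝ), z + t * ω ∈ S →
      HasDerivAt (fun t : ℝ => u j (z + t * ω)) (deriv (u j) (z + t * ω) * ω) t :=
    fun j ω t h => (((hu.1 j).differentiableAt (S.isOpen.mem_nhds h)).hasDerivAt).comp t (hline ω t)
  have hd2 : ∀ j (ω : ℂ) (t : ℝ), z + t * ω ∈ S →
      HasDerivAt (fun t : ℝ => deriv (u j) (z + t * ω) * ω)
        (deriv (deriv (u j)) (z + t * ω) * ω * ω) t :=
    fun j ω t h => HasDerivAt.mul_const ((((hu.1 j).deriv S.isOpen).differentiableAt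
      (S.isOpen.mem_nhds h)).hasDerivAt.comp (h₂ := deriv (u j)) t (hline ω t)) ω
  have key : ∀ ω : ℂ, iteratedFDeriv ℝ 2 (fun w => Real.log (pairDensity c fun j => u j w)) z
      ![ω, ω] = -(((2 * (inner ℝ (u 0 z) (deriv (deriv (u 0)) z * ω * ω) +
          inner ℝ (deriv (u 0) z * ω) (deriv (u 0) z * ω)) +
          2 * (inner ℝ (u 1 z) (deriv (deriv (u 1)) z * ω * ω) +
          inner ℝ (deriv (u 1) z * ω) (deriv (u 1) z * ω))) * (‖u 0 z‖ ^ 2 + ‖u 1 z‖ ^ 2) -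
          (2 * inner ℝ (u 0 z) (deriv (u 0) z * ω) + 2 * inner ℝ (u 1 z) (deriv (u 1) z * ω)) *
          (2 * inner ℝ (u 0 z) (deriv (u 0) z * ω) + 2 * inner ℝ (u 1 z) (deriv (u 1) z * ω))) /
          (‖u 0 z‖ ^ 2 + ‖u 1 z‖ ^ 2) ^ 2) := by
    intro ω
    refine iteratedFDeriv_two_eq_of_line
      ((hcd.contDiffAt (S.isOpen.mem_nhds hz)).log (hpos z hz).ne')
      (g := fun t => -((2 * inner ℝ (u 0 (z + t * ω)) (deriv (u 0) (z + t * ω) * ω) +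
        2 * inner ℝ (u 1 (z + t * ω)) (deriv (u 1) (z + t * ω) * ω)) /
        (‖u 0 (z + t * ω)‖ ^ 2 + ‖u 1 (z + t * ω)‖ ^ 2))) ?_ ?_
    · filter_upwards [(hct ω).eventually (S.isOpen.eventually_mem hz),
        ((hct ω).eventually (S.isOpen.eventually_mem hz)).eventually_nhds] with t h1 h2
      have h3 := (((hd1 0 ω t h1).norm_sq.add (hd1 1 ω t h1).norm_sq).log
        (hu.pos h1).ne').const_sub (Real.log (2 / √c))
      refine h3.congr_of_eventuallyEq ?_
      filter_upwards [h2] with s hs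
      have := hu.pos hs
      rw [pairDensity, ← div_div, Real.log_div (by positivity) this.ne']
      rfl
    · have h0 : z + ((0 : ℝ) : ℂ) * ω ∈ S := by simpa using hz
      have h1 := ((((hd1 0 ω 0 h0).inner ℝ (hd2 0 ω 0 h0)).const_mul 2).add
        (((hd1 1 ω 0 h0).inner ℝ (hd2 1 ω 0 h0)).const_mul 2)).div
        ((hd1 0 ω 0 h0).norm_sq.add (hd1 1 ω 0 h0).norm_sq) (hu.pos h0).ne'
      refine h1.neg.congr_deriv ?_
      simp
  unfold gaussCurvature
  rw [InnerProductSpace.laplacian_eq_iteratedFDeriv_complexPlane]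
  beta_reduce
  rw [key, key, pairDensity]
  have hv := hu.pos hz
  have hW := hu.2 z hz
  have hre := congrArg Complex.re hW
  have him := congrArg Complex.im hW
  have hcc : √c ^ 2 = c := Real.sq_sqrt hc.le
  simp only [Complex.inner, ← Complex.normSq_eq_norm_sq, Complex.normSq_apply] at hv ⊢
  generalize u 0 z = a at *
  generalize u 1 z = b at *
  generalize deriv (u 0) z = a' at *
  generalize deriv (u 1) z = b' at *
  simp only [Complex.sub_re, Complex.mul_re, Complex.sub_im, Complex.mul_im, Complex.one_re,
    Complex.one_im, Complex.conj_re, Complex.conj_im, Complex.I_re, Complex.I_im] at *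
  rw [div_pow, mul_pow, hcc, ← neg_add, neg_neg, ← add_div, div_div_div_eq]
  rw [div_eq_iff (by positivity)]
  -- The combination inserts `(Re W)² + (Im W)² = 1`, obtained from the real and imaginary parts of
  -- `W = 1`.
  linear_combination (4 * c * (a.re * a.re + a.im * a.im + (b.re * b.re + b.im * b.im)) ^ 2) *
    ((a.re * b'.re - a.im * b'.im - (a'.re * b.re - a'.im * b.im) + 1) * hre +
      (a.re * b'.im + a.im * b'.re - (a'.re * b.im + a'.im * b.re)) * him)

end Curvature
-- Universality by Baire category.
section Universality
open Set Metric Topology Filter Polynomial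

/-- With a logarithm `l` of `φ'` the pullback acts additively on exponents, `p ↦ p ∘ φ + l`; hence
`p ∘ φ` has to approximate `w - l`. -/
theorem exists_polynomial_log_near {φ : ℂ → ℂ} {r ρ R : ℝ} (hr : 0 < r) (hrρ : r < ρ) (hρR : ρ < R)
    (hφ : DifferentiableOn ℂ φ (ball 0 R)) (hinj : InjOn φ (ball 0 R))
    (hd : ∀ z ∈ ball (0 : ℂ) R, deriv φ z ≠ 0)
    (hdisj : Disjoint (closedBall 0 r) (φ '' closedBall 0 ρ)) {u w : ℂ → ℂ}
    (hu : DifferentiableOn ℂ u (ball 0 R)) (hw : DifferentiableOn ℂ w (ball 0 R))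
    {ε : ℝ} (hε : 0 < ε) :
    ∃ (p : ℂ[X]) (f : ℂ → ℂ), ∀ z ∈ closedBall (0 : ℂ) r, ‖p.eval z - u z‖ ≤ ε ∧
      ‖f z - w z‖ ≤ ε ∧ Real.exp (p.eval (φ z)).re * ‖deriv φ z‖ = Real.exp (f z).re := by
  obtain ⟨l, hl, hle⟩ := exists_differentiableOn_exp_eq (hφ.deriv isOpen_ball) hd
  obtain ⟨p, hp0, hp1⟩ := exists_polynomial_pair_approx hr hrρ hρR hφ hinj hd hu (hw.sub hl)
    hdisj hε
  refine ⟨p, fun z => p.eval (φ z) + l z, fun z hz => ⟨(hp0 z hz).le, ?_, ?_⟩⟩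
  · have := (hp1 z hz).le
    rwa [Pi.sub_apply, ← sub_add, sub_add_eq_add_sub] at this
  · rw [← hle z (closedBall_subset_ball (hrρ.trans hρR) hz), Complex.norm_exp, ← Real.exp_add,
      Complex.add_re]

/-- Birkhoff's transitivity argument relative to `S`: for each basic open set meeting `S`, the
points sent into it by some `T n` form an open dense set, and countably many such sets have a common
point. -/
theorem exists_forall_mem_closure_range {X Y : Type*} [TopologicalSpace X] [BaireSpace X]
    [Nonempty X] [TopologicalSpace Y] [SecondCountableTopology Y] {T : ℕ → X → Y}
    (hT : ∀ n, Continuous (T n)) {S : Set Y}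
    (h : ∀ x : X, ∀ V ∈ 𝓝 x, ∀ y ∈ S, ∀ W ∈ 𝓝 y, ∃ n, ∃ x' ∈ V, T n x' ∈ W) :
    ∃ x, S ⊆ closure (range fun n => T n x) := by
  set B := {b ∈ countableBasis Y | (b ∩ S).Nonempty} with hB
  have hBc : B.Countable := (countable_countableBasis Y).mono (sep_subset _ _)
  have hd : Dense (⋂ b ∈ B, ⋃ n, T n ⁻¹' b) := by
    refine dense_biInter_of_isOpen (fun b hb => isOpen_iUnion fun n =>
      (isOpen_of_mem_countableBasis hb.1).preimage (hT n)) hBc fun b hb => ?_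
    obtain ⟨y, hyb, hyS⟩ := hb.2
    refine dense_iff_inter_open.2 fun V hV ⟨x, hx⟩ => ?_
    obtain ⟨n, x', hx', hn⟩ := h x V (hV.mem_nhds hx) y hyS b
      ((isOpen_of_mem_countableBasis hb.1).mem_nhds hyb)
    exact ⟨x', hx', mem_iUnion.2 ⟨n, hn⟩⟩
  obtain ⟨x, hx⟩ := hd.nonempty
  refine ⟨x, fun y hy => ?_⟩
  refine (isBasis_countableBasis Y).mem_closure_iff.2 fun b hb hyb => ?_
  obtain ⟨n, hn⟩ := mem_iUnion.1 (mem_iInter₂.1 hx b ⟨hb, y, hyb, hy⟩)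
  exact ⟨_, hn, n, rfl⟩

theorem exists_compact_forall_norm_sub_lt_of_mem_nhds {α F : Type*} [TopologicalSpace α]
    [SeminormedAddCommGroup F] {u : C(α, F)} {V : Set C(α, F)} (hV : V ∈ 𝓝 u) :
    ∃ K : Set α, IsCompact K ∧ ∃ ε > 0, ∀ v : C(α, F), (∀ z ∈ K, ‖v z - u z‖ < ε) → v ∈ V := by
  have hb := (uniformity_basis_dist (α := F)).compactConvergenceUniformity (α := α)
  obtain ⟨⟨K, ε⟩, ⟨hK, hε⟩, hKV⟩ := (nhds_basis_uniformity' hb).mem_iff.1 hV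
  refine ⟨K, hK, ε, hε, fun v hv => hKV ?_⟩
  intro z hz
  have := hv z hz
  rwa [← dist_eq_norm, dist_comm] at this

/-- The pullback of densities under a holomorphic map. -/
noncomputable def pullbackDensity {S M : Opens ℂ} {f : ℂ → ℂ} (hf : DifferentiableOn ℂ f S)
    (hm : MapsTo f S M) (u : C(M, ℝ)) : C(S, ℝ) where
  toFun z := u ⟨f z, hm z.2⟩ * ‖deriv f z‖
  continuous_toFun :=
    (u.continuous.comp
      ((continuousOn_iff_continuous_domRestrict.mp hf.continuousOn).subtype_mk _)).mul
      (continuousOn_iff_continuous_domRestrict.mp (hf.deriv S.isOpen).continuousOn).norm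

theorem continuous_pullbackDensity {S M : Opens ℂ} {f : ℂ → ℂ} (hf : DifferentiableOn ℂ f S)
    (hm : MapsTo f S M) : Continuous (pullbackDensity hf hm) := by
  have : LocallyCompactSpace M := M.isOpen.locallyCompactSpace
  refine ContinuousMap.continuous_of_continuous_uncurry _ ?_
  have h1 : Continuous fun z : S => (⟨f z, hm z.2⟩ : M) :=
    (continuousOn_iff_continuous_domRestrict.mp hf.continuousOn).subtype_mk _
  have h2 : Continuous fun z : S => deriv f z :=
    continuousOn_iff_continuous_domRestrict.mp (hf.deriv S.isOpen).continuousOn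
  have h3 : Continuous fun p : C(M, ℝ) × S => p.1 ⟨f p.2, hm p.2.2⟩ :=
    continuous_fst.eval (h1.comp continuous_snd)
  exact h3.mul (h2.comp continuous_snd).norm

theorem LocUnivSelfMap.continuous_pullback {M : Opens ℂ} (φ : LocUnivSelfMap M) :
    Continuous (φ.pullback : C(M, ℝ) → C(M, ℝ)) :=
  continuous_pullbackDensity φ.holo φ.mapsTo

/-- The category argument runs in the space `X` of holomorphic data, which is complete because it is
closed. It therefore suffices that the densities `g ∘ w` with `w ∈ X` approximate `S` on compact
sets; no completeness of the set of densities is required. -/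
theorem exists_pullback_dense {F : Type*} [NormedAddCommGroup F] [CompleteSpace F] {M : Opens ℂ}
    {G : Set F} (hG : IsOpen G) {g : F → ℝ} (hg : ContinuousOn g G) {X : Set C(M, F)}
    (hX : IsClosed X) (hXn : X.Nonempty) (hXG : ∀ u ∈ X, ∀ z, u z ∈ G)
    {φ : ℕ → LocUnivSelfMap M} {S : Set C(M, ℝ)}
    (happrox : ∀ l ∈ S, ∀ K : Set M, IsCompact K → ∀ ε > 0, ∃ w ∈ X, ∀ z ∈ K, |g (w z) - l z| < ε)
    (hsteer : ∀ K : Set M, IsCompact K → ∃ n, ∀ u ∈ X, ∀ w ∈ X, ∀ ε > 0, ∃ U ∈ X, ∃ f : M → F,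
      ∀ z ∈ K, ‖U z - u z‖ ≤ ε ∧ ‖f z - w z‖ ≤ ε ∧
        g (U ⟨(φ n).toFun z, (φ n).mapsTo z.2⟩) * ‖deriv (φ n).toFun z‖ = g (f z)) :
    ∃ u ∈ X, ∃ L : C(M, ℝ), (∀ z, L z = g (u z)) ∧
      S ⊆ closure (range fun n => (φ n).pullback L) := by
  have : LocallyCompactSpace M := M.isOpen.locallyCompactSpace
  have : CompleteSpace X := hX.completeSpace_coe
  have : Nonempty X := hXn.to_subtype
  let D : X → C(M, ℝ) := fun u => ⟨fun z => g (u.1 z),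
    continuous_iff_continuousAt.2 fun z => (hg.continuousAt (hG.mem_nhds (hXG _ u.2 z))).comp
      u.1.continuous.continuousAt⟩
  have hD : Continuous D := by
    refine ContinuousMap.continuous_of_continuous_uncurry _ ?_
    refine continuous_iff_continuousAt.2 fun p => ?_
    have h1 : Continuous fun p : X × M => p.1.1 p.2 :=
      (continuous_subtype_val.comp continuous_fst).eval continuous_snd
    exact ContinuousAt.comp (g := g) (f := fun p : X × M => p.1.1 p.2) (x := p)
      (hg.continuousAt (hG.mem_nhds (hXG _ p.1.2 p.2))) h1.continuousAt
  suffices h : ∀ x : X, ∀ V ∈ 𝓝 x, ∀ y ∈ S, ∀ W ∈ 𝓝 y, ∃ n, ∃ x' ∈ V,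
      (φ n).pullback (D x') ∈ W by
    obtain ⟨u, hu⟩ := exists_forall_mem_closure_range
      (fun n => (φ n).continuous_pullback.comp hD) h
    exact ⟨u.1, u.2, D u, fun z => rfl, hu⟩
  intro u V hV l hl W hW
  obtain ⟨V', hV', hVV'⟩ := mem_nhds_subtype _ _ _ |>.1 hV
  obtain ⟨K₁, hK₁, ε₁, hε₁, h₁⟩ := exists_compact_forall_norm_sub_lt_of_mem_nhds hV'
  obtain ⟨K₂, hK₂, ε₂, hε₂, h₂⟩ := exists_compact_forall_norm_sub_lt_of_mem_nhds hW
  obtain ⟨n, hn⟩ := hsteer (K₁ ∪ K₂) (hK₁.union hK₂)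
  obtain ⟨w, hwX, hw⟩ := happrox l hl K₂ hK₂ (ε₂ / 2) (half_pos hε₂)
  -- Uniform continuity of `g` near the compact set `w (K₂)` converts closeness of `f` to `w` into
  -- closeness of the densities.
  have huc := (hK₂.image w.continuous).uniformContinuousAt_of_continuousAt g
    (by rintro _ ⟨z, _, rfl⟩; exact hg.continuousAt (hG.mem_nhds (hXG _ hwX z)))
    (dist_mem_uniformity (half_pos hε₂))
  obtain ⟨δ, hδ, hδs⟩ := Metric.mem_uniformity_dist.1 huc
  obtain ⟨U, hUX, f, hf⟩ := hn u u.2 w hwX (min (ε₁ / 2) (δ / 2)) (by positivity)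
  refine ⟨n, ⟨U, hUX⟩, hVV' (h₁ U fun z hz => ?_), h₂ _ fun z hz => ?_⟩
  · exact (hf z (Or.inl hz)).1.trans_lt ((min_le_left _ _).trans_lt (half_lt_self hε₁))
  · obtain ⟨-, h3, h4⟩ := hf z (Or.inr hz)
    have h5 : dist (w z) (f z) < δ := by
      rw [dist_comm, dist_eq_norm]
      exact h3.trans_lt ((min_le_right _ _).trans_lt (half_lt_self hδ))
    have h6 : dist (g (w z)) (g (f z)) < ε₂ / 2 := hδs h5 (mem_image_of_mem w hz)
    have h7 : (φ n).pullback (D ⟨U, hUX⟩) z = g (f z) := h4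
    rw [h7, Real.norm_eq_abs]
    have h8 := hw z hz
    rw [Real.dist_eq, abs_sub_comm] at h6
    calc |g (f z) - l z| = |(g (f z) - g (w z)) + (g (w z) - l z)| := by ring_nf
      _ ≤ _ := abs_add_le _ _
      _ < ε₂ := by linarith

/-- The restrictions of a convergent sequence of holomorphic functions. -/
theorem exists_differentiableOn_of_tendsto {M : Opens ℂ} {f : ℕ → ℂ → ℂ} {v : ℕ → C(M, ℂ)}
    {v₀ : C(M, ℂ)} (hf : ∀ n, DifferentiableOn ℂ (f n) M) (hv : ∀ n (z : M), v n z = f n z)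
    (h : Tendsto v atTop (𝓝 v₀)) :
    ∃ f₀ : ℂ → ℂ, DifferentiableOn ℂ f₀ M ∧ (∀ z : M, v₀ z = f₀ z) ∧
      ∀ z ∈ M, Tendsto (fun n => f n z) atTop (𝓝 (f₀ z)) ∧
        Tendsto (fun n => deriv (f n) z) atTop (𝓝 (deriv f₀ z)) := by
  classical
  have : LocallyCompactSpace M := M.isOpen.locallyCompactSpace
  set f₀ : ℂ → ℂ := fun z => if hz : z ∈ M then v₀ ⟨z, hz⟩ else 0 with hf₀
  have hv₀ : ∀ z : M, v₀ z = f₀ z := fun z => by simp [hf₀]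
  have hlim : TendstoLocallyUniformlyOn f f₀ atTop M := by
    rw [tendstoLocallyUniformlyOn_iff_tendstoLocallyUniformly_comp_coe]
    have h1 := ContinuousMap.tendsto_iff_tendstoLocallyUniformly.1 h
    have e1 : (fun n (z : M) => v n z) = fun n (z : M) => f n z :=
      funext fun n => funext fun z => hv n z
    have e2 : (v₀ : M → ℂ) = f₀ ∘ ((↑) : M → ℂ) := funext hv₀
    rw [e1, e2] at h1
    exact h1
  have hd := hlim.differentiableOn (Eventually.of_forall hf) M.isOpen
  exact ⟨f₀, hd, hv₀, fun z hz => ⟨hlim.tendsto_at hz,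
    (hlim.deriv (Eventually.of_forall hf) M.isOpen).tendsto_at hz⟩⟩

theorem isClosed_holomorphic (M : Opens ℂ) :
    IsClosed {v : C(M, ℂ) | ∃ f : ℂ → ℂ, DifferentiableOn ℂ f M ∧ ∀ z : M, v z = f z} := by
  have : LocallyCompactSpace M := M.isOpen.locallyCompactSpace
  refine isClosed_of_closure_subset fun v₀ hv₀ => ?_
  obtain ⟨v, hv, hlim⟩ := mem_closure_iff_seq_limit.1 hv₀
  choose f hf hvf using hv
  obtain ⟨f₀, h1, h2, -⟩ := exists_differentiableOn_of_tendsto hf hvf hlim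
  exact ⟨f₀, h1, h2⟩

/-- Locally uniform limits of holomorphic functions also carry along their derivatives, so the
Wronskian identity survives. -/
theorem isClosed_unitPair (M : Opens ℂ) :
    IsClosed {v : C(M, Fin 2 → ℂ) | ∃ u : Fin 2 → ℂ → ℂ, IsUnitPair M u ∧
      ∀ (z : M) j, v z j = u j z} := by
  have : LocallyCompactSpace M := M.isOpen.locallyCompactSpace
  refine isClosed_of_closure_subset fun v₀ hv₀ => ?_
  obtain ⟨v, hv, hlim⟩ := mem_closure_iff_seq_limit.1 hv₀
  choose f hf hvf using hv
  choose f₀ h1 h2 h3 using fun j : Fin 2 => exists_differentiableOn_of_tendsto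
    (v := fun n => (⟨fun x => x j, continuous_apply j⟩ : C(Fin 2 → ℂ, ℂ)).comp (v n))
    (fun n => (hf n).1 j) (fun n z => hvf n z j)
    (((ContinuousMap.continuous_postcomp _).tendsto v₀).comp hlim)
  refine ⟨f₀, ⟨h1, fun z hz => ?_⟩, fun z j => h2 j z⟩
  refine tendsto_nhds_unique ((((h3 0 z hz).1.mul (h3 1 z hz).2).sub
    ((h3 0 z hz).2.mul (h3 1 z hz).1))) ?_
  exact tendsto_const_nhds.congr fun n => ((hf n).2 z hz).symm

end Universality
-- Holomorphy of the Schwarzian under minimal regularity.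
section Schwarzian
open Set Metric Topology Filter Complex MeasureTheory
open scoped ComplexConjugate Interval

theorem intervalIntegral_conj {f : ℝ → ℂ} {a b : ℝ} :
    ∫ x in a..b, conj (f x) = conj (∫ x in a..b, f x) := by
  simp only [intervalIntegral, map_sub, ← integral_conj]

/-- If `p_z̄ = κ` with a real function `κ` such that `κ_z = -2 κ p`, then `p_z + p²` is
holomorphic, although `p` is assumed to be of class `C¹` only. -/
theorem differentiableOn_of_riccati {S : Set ℂ} (hS : IsOpen S) {p : ℂ → ℂ}
    {P : ℂ → ℂ →L[ℝ] ℂ} {κ : ℂ → ℝ} {D : ℂ → ℂ →L[ℝ] ℝ} (hp : ∀ z ∈ S, HasFDerivAt p (P z) z)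
    (hP : ContinuousOn P S) (hκ : ∀ z ∈ S, HasFDerivAt κ (D z) z)
    (h1 : ∀ z ∈ S, P z 1 + I * P z I = 2 * κ z)
    (h2 : ∀ z ∈ S, (D z 1 : ℂ) - I * D z I = -4 * κ z * p z) :
    DifferentiableOn ℂ (fun z => P z 1 - κ z + p z ^ 2) S := by
  have hpc : ContinuousOn p S := fun z hz => (hp z hz).continuousAt.continuousWithinAt
  have hκc : ContinuousOn (fun z => (κ z : ℂ)) S := fun z hz =>
    (Complex.continuous_ofReal.continuousAt.comp (hκ z hz).continuousAt).continuousWithinAt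
  have hp2 : ContinuousOn (fun z => p z ^ 2) S := hpc.pow 2
  have hP1 : ContinuousOn (fun z => P z 1) S := hP.clm_apply continuousOn_const
  have hPI : ContinuousOn (fun z => P z I) S := hP.clm_apply continuousOn_const
  -- Morera's theorem on rectangles is used because `p_z` is only continuous and cannot be
  -- differentiated.
  refine (isConservativeOn_and_continuousOn_iff_isDifferentiableOn hS).1
    ⟨fun z w hR => ?_, (hP1.sub hκc).add (hpc.pow 2)⟩
  rw [← add_eq_zero_iff_eq_neg, wedgeIntegral_add_wedgeIntegral_eq]
  have hR' : [[z.re, w.re]] ×ℂ [[z.im, w.im]] ⊆ S := hR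
  have hmem : ∀ x ∈ [[z.re, w.re]], ∀ y ∈ [[z.im, w.im]], (x : ℂ) + y * I ∈ S := fun x hx y hy =>
    hR' ⟨by simpa using hx, by simpa using hy⟩
  have hH : ∀ {g : ℂ → ℂ}, ContinuousOn g S → ∀ y ∈ [[z.im, w.im]],
      IntervalIntegrable (fun x : ℝ => g (x + y * I)) volume z.re w.re := fun hg y hy =>
    ContinuousOn.intervalIntegrable
      (hg.comp (by fun_prop) fun x hx => hmem x hx y hy)
  have hV : ∀ {g : ℂ → ℂ}, ContinuousOn g S → ∀ x ∈ [[z.re, w.re]],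
      IntervalIntegrable (fun y : ℝ => g (x + y * I)) volume z.im w.im := fun hg x hx =>
    ContinuousOn.intervalIntegrable
      (hg.comp (by fun_prop) fun y hy => hmem x hx y hy)
  have hlx : ∀ x y : ℝ, HasDerivAt (fun x : ℝ => (x : ℂ) + y * I) 1 x := fun x y =>
    ((Complex.ofRealCLM.hasDerivAt (x := x)).add_const _).congr_deriv (by simp)
  have hly : ∀ x y : ℝ, HasDerivAt (fun y : ℝ => (x : ℂ) + y * I) I y := fun x y =>
    (((Complex.ofRealCLM.hasDerivAt (x := y)).mul_const I).const_add _).congr_deriv (by simp)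
  -- On a horizontal side `p_z = p_x - κ` and on a vertical side `p_z = -i p_y + κ`. The derivatives
  -- integrate to corner values that cancel around the rectangle, leaving boundary integrals of `κ`
  -- and `p²`.
  have hor : ∀ y ∈ [[z.im, w.im]],
      ∫ x : ℝ in z.re..w.re, (P (x + y * I) 1 - κ (x + y * I) + p (x + y * I) ^ 2) =
      p (w.re + y * I) - p (z.re + y * I) - (∫ x : ℝ in z.re..w.re, (κ (x + y * I) : ℂ)) +
        ∫ x : ℝ in z.re..w.re, p (x + y * I) ^ 2 := by
    intro y hy
    rw [intervalIntegral.integral_add ((hH hP1 y hy).sub (hH hκc y hy)) (hH hp2 y hy),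
      intervalIntegral.integral_sub (hH hP1 y hy) (hH hκc y hy),
      intervalIntegral.integral_eq_sub_of_hasDerivAt (f := fun x : ℝ => p (x + y * I))
        (fun x hx => (hp _ (hmem x hx y hy)).comp_hasDerivAt x (hlx x y)) (hH hP1 y hy)]
  have ver : ∀ x ∈ [[z.re, w.re]],
      ∫ y : ℝ in z.im..w.im, (P (x + y * I) 1 - κ (x + y * I) + p (x + y * I) ^ 2) =
      -I * (p (x + w.im * I) - p (x + z.im * I)) + (∫ y : ℝ in z.im..w.im, (κ (x + y * I) : ℂ)) +
        ∫ y : ℝ in z.im..w.im, p (x + y * I) ^ 2 := by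
    intro x hx
    have : ∫ y : ℝ in z.im..w.im, (P (x + y * I) 1 - κ (x + y * I) + p (x + y * I) ^ 2) =
        ∫ y : ℝ in z.im..w.im, (-I * P (x + y * I) I + κ (x + y * I) + p (x + y * I) ^ 2) :=
      intervalIntegral.integral_congr fun y hy => by
        linear_combination h1 _ (hmem x hx y hy)
    rw [this, intervalIntegral.integral_add (((hV hPI x hx).const_mul (-I)).add (hV hκc x hx))
        (hV hp2 x hx),
      intervalIntegral.integral_add ((hV hPI x hx).const_mul (-I)) (hV hκc x hx),
      intervalIntegral.integral_const_mul,
      intervalIntegral.integral_eq_sub_of_hasDerivAt (f := fun y : ℝ => p (x + y * I))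
        (fun y hy => (hp _ (hmem x hx y hy)).comp_hasDerivAt y (hly x y)) (hV hPI x hx)]
  have hsub : Ioo (min z.re w.re) (max z.re w.re) ×ℂ Ioo (min z.im w.im) (max z.im w.im) ⊆ S :=
    fun x hx => hR' ⟨Ioo_subset_Icc_self hx.1, Ioo_subset_Icc_self hx.2⟩
  have hint : ∀ {g : ℂ → ℂ}, ContinuousOn g S →
      IntegrableOn g ([[z.re, w.re]] ×ℂ [[z.im, w.im]]) := fun hg =>
    (hg.mono hR').integrableOn_compact (isCompact_uIcc.reProdIm isCompact_uIcc)
  have hG : ContinuousOn (fun z => 4 * I * κ z * p z) S :=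
    (continuousOn_const.mul hκc).mul hpc
  have e1 : ∀ z ∈ S, I • ((2 * p z) • P z) 1 - ((2 * p z) • P z) I = 4 * I * κ z * p z := by
    intro z hz
    simp only [smul_apply, smul_eq_mul]
    linear_combination 2 * p z * I * h1 z hz + 2 * p z * P z I * (-Complex.I_sq)
  have e2 : ∀ z ∈ S, I • (ofRealCLM.comp (D z)) 1 - (ofRealCLM.comp (D z)) I =
      conj (4 * I * κ z * p z) := by
    intro z hz
    have := congrArg conj (h2 z hz)
    simp only [map_sub, map_mul, conj_I, conj_ofReal, map_neg, map_ofNat] at this ⊢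
    simp only [ContinuousLinearMap.comp_apply, ofRealCLM_apply, smul_eq_mul]
    linear_combination I * this - (D z I : ℂ) * I_sq
  -- By Green's formula the boundary integrals of `p²` and of `κ` are the area integrals of `4iκp`
  -- and of its conjugate. As `κ` is real, conjugating the second relation makes the two
  -- contributions cancel.
  have g1 := integral_boundary_rect_of_continuousOn_of_hasFDerivAt_real (fun z => p z ^ 2)
    (fun z => (2 * p z) • P z) z w (hp2.mono hR') (fun x hx => by
      refine ((hp x (hsub hx)).pow 2).congr_fderiv ?_
      ext v
      simp) ((hint hG).congr_fun (fun x hx => (e1 x (hR' hx)).symm)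
        (isCompact_uIcc.reProdIm isCompact_uIcc).measurableSet)
  have g2 := integral_boundary_rect_of_continuousOn_of_hasFDerivAt_real (fun z => (κ z : ℂ))
    (fun z => ofRealCLM.comp (D z)) z w (hκc.mono hR')
    (fun x hx => ofRealCLM.hasFDerivAt.comp x (hκ x (hsub hx)))
    ((hint (Complex.continuous_conj.comp_continuousOn hG)).congr_fun
      (fun x hx => (e2 x (hR' hx)).symm) (isCompact_uIcc.reProdIm isCompact_uIcc).measurableSet)
  rw [intervalIntegral.integral_congr (g := fun x : ℝ => ∫ y : ℝ in z.im..w.im,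
    4 * I * κ (x + y * I) * p (x + y * I)) fun x hx =>
      intervalIntegral.integral_congr fun y hy => e1 _ (hmem x hx y hy)] at g1
  have g2' : ∫ x : ℝ in z.re..w.re, ∫ y : ℝ in z.im..w.im,
      (I • (ofRealCLM.comp (D (x + y * I))) 1 - (ofRealCLM.comp (D (x + y * I))) I) =
      conj (∫ x : ℝ in z.re..w.re, ∫ y : ℝ in z.im..w.im,
        4 * I * κ (x + y * I) * p (x + y * I)) := by
    rw [← intervalIntegral_conj]
    refine intervalIntegral.integral_congr fun x hx => ?_
    rw [← intervalIntegral_conj]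
    exact intervalIntegral.integral_congr fun y hy => e2 _ (hmem x hx y hy)
  rw [g2'] at g2
  rw [← g1] at g2
  have g3 := congrArg conj g2
  simp only [conj_conj, map_sub, map_add, smul_eq_mul, map_mul, map_neg, neg_neg, conj_I, ← intervalIntegral_conj,
    conj_ofReal] at g3
  rw [hor _ left_mem_uIcc, hor _ right_mem_uIcc, ver _ left_mem_uIcc, ver _ right_mem_uIcc]
  simp only [smul_eq_mul]
  linear_combination -g3 - (p (w.re + w.im * I) - p (w.re + z.im * I) -
    p (z.re + w.im * I) + p (z.re + z.im * I)) * I_sq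

end Schwarzian
-- The Schwarzian of a density and its linear system.
section Liouville
open Set Metric Topology Filter Complex
open scoped ComplexConjugate

/-- The Schwarzian of a metric of constant curvature: with `p = -∂ log l`, the function
`q = ∂p + p²` is holomorphic and `∂̄p = c l² / 4`. -/
theorem IsConstCurvatureDensity.exists_schwarzian {S : Opens ℂ} {c : ℝ} {l : ℂ → ℝ}
    (hl : IsConstCurvatureDensity S c l) :
    ∃ p q : ℂ → ℂ, DifferentiableOn ℂ q S ∧ ∀ z ∈ S,
      (∃ A : ℂ →L[ℝ] ℝ, HasFDerivAt l A z ∧ ∀ ω, A ω = -2 * l z * (p z * ω).re) ∧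
      ∃ P : ℂ →L[ℝ] ℂ, HasFDerivAt p P z ∧
        ∀ ω, P ω = (q z - p z ^ 2) * ω + (c / 4 * l z ^ 2 : ℝ) * conj ω := by
  obtain ⟨⟨hpos, hcd⟩, hcurv⟩ := hl
  set f : ℂ → ℝ := fun w => Real.log (l w) with hf
  have hfc : ∀ z ∈ S, ContDiffAt ℝ 2 f z := fun z hz =>
    (hcd.contDiffAt (S.isOpen.mem_nhds hz)).log (hpos z hz).ne'
  have hD : ∀ z ∈ S, HasFDerivAt (fderiv ℝ f) (fderiv ℝ (fderiv ℝ f) z) z := fun z hz =>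
    (((hfc z hz).fderiv_right (m := 1) le_rfl).differentiableAt one_ne_zero).hasFDerivAt
  have hD2c : ContinuousOn (fderiv ℝ (fderiv ℝ f)) S := fun z hz =>
    (((hfc z hz).fderiv_right (m := 1) le_rfl).fderiv_right (m := 0)
      le_rfl).continuousAt.continuousWithinAt
  have hld : ∀ z ∈ S, HasFDerivAt l (l z • fderiv ℝ f z) z := by
    intro z hz
    have h1 := ((hcd.contDiffAt (S.isOpen.mem_nhds hz)).differentiableAt two_ne_zero).hasFDerivAt
    have h2 : fderiv ℝ f z = (l z)⁻¹ • fderiv ℝ l z := (h1.log (hpos z hz).ne').fderiv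
    rw [h2, smul_smul, mul_inv_cancel₀ (hpos z hz).ne', one_smul]
    exact h1
  -- `T` is the operator `-∂` on differentials, so that `p = -∂ log l`.
  let T : (ℂ →L[ℝ] ℝ) →L[ℝ] ℂ := (-(1 / 2) : ℂ) •
    (ofRealCLM.comp (ContinuousLinearMap.apply ℝ ℝ (1 : ℂ)) -
      I • ofRealCLM.comp (ContinuousLinearMap.apply ℝ ℝ I))
  have hT : ∀ A : ℂ →L[ℝ] ℝ, T A = -(1 / 2) * (A 1 - I * A I) := fun A => rfl
  set p : ℂ → ℂ := fun z => T (fderiv ℝ f z) with hp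
  set P : ℂ → ℂ →L[ℝ] ℂ := fun z => T.comp (fderiv ℝ (fderiv ℝ f) z) with hP
  have hpP : ∀ z ∈ S, HasFDerivAt p (P z) z := fun z hz => T.hasFDerivAt.comp z (hD z hz)
  have hPc : ContinuousOn P S := continuousOn_const.clm_comp hD2c
  -- The left side is `2 ∂̄p = -Δ(log l) / 2`, where symmetry of the second derivative removes the
  -- mixed terms; the curvature equation evaluates it.
  have h1 : ∀ z ∈ S, P z 1 + I * P z I = 2 * (c / 4 * l z ^ 2 : ℝ) := by
    intro z hz
    have h2 := hcurv z hz
    have hlz := (hpos z hz).ne'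
    unfold gaussCurvature at h2
    rw [InnerProductSpace.laplacian_eq_iteratedFDeriv_complexPlane] at h2
    beta_reduce at h2
    rw [iteratedFDeriv_two_apply, iteratedFDeriv_two_apply, div_eq_iff (pow_ne_zero 2 hlz)] at h2
    simp only [Matrix.cons_val_zero, Matrix.cons_val_one] at h2
    have hsym := (hfc z hz).isSymmSndFDerivAt (by simp) 1 I
    have h3 := congrArg ((↑) : ℝ → ℂ) h2
    have h4 := congrArg ((↑) : ℝ → ℂ) hsym
    simp only [hP, ContinuousLinearMap.comp_apply, hT]
    push_cast at h3 ⊢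
    linear_combination (1 / 2) * h3 + (I / 2) * h4 +
      (1 / 2) * (fderiv ℝ (fderiv ℝ f) z I I : ℂ) * I_sq
  have hκ : ∀ z ∈ S, HasFDerivAt (fun z => c / 4 * l z ^ 2)
      ((2 * (c / 4 * l z ^ 2)) • fderiv ℝ f z) z := by
    intro z hz
    refine (((hld z hz).pow 2).const_mul (c / 4)).congr_fderiv ?_
    ext v
    simp
    ring
  refine ⟨p, fun z => P z 1 - (c / 4 * l z ^ 2 : ℝ) + p z ^ 2,
    differentiableOn_of_riccati S.isOpen hpP hPc hκ h1 fun z hz => ?_,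
    fun z hz => ⟨⟨_, hld z hz, fun ω => ?_⟩, P z, hpP z hz, fun ω => ?_⟩⟩
  · simp only [smul_apply, smul_eq_mul, hp, hT]
    push_cast
    ring
  · have hω : ω = ω.re • (1 : ℂ) + ω.im • I := by simp [re_add_im]
    have hA : fderiv ℝ f z ω = ω.re * fderiv ℝ f z 1 + ω.im * fderiv ℝ f z I := by
      conv_lhs => rw [hω]
      simp only [map_add, map_smul, smul_eq_mul]
    simp only [smul_apply, smul_eq_mul, hA, hp, hT]
    simp
    ring
  · have hω : ω = ω.re • (1 : ℂ) + ω.im • I := by simp [re_add_im]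
    have hA : P z ω = ω.re * P z 1 + ω.im * P z I := by
      conv_lhs => rw [hω]
      simp only [map_add, map_smul]
      simp only [real_smul]
    have hc : conj ω = ω.re - ω.im * I := by
      apply Complex.ext <;> simp
    have hω' : ω = ω.re + ω.im * I := (re_add_im ω).symm
    rw [hA, hc]
    linear_combination -ω.im * I * h1 z hz + ω.im * P z I * I_sq -
      (P z 1 - (c / 4 * l z ^ 2 : ℝ)) * hω'

/-- For a density, `v = 1 / l`, `a = p / l` and `w = |p|² / l + c l / 4` satisfy this system along
rays with `q` the Schwarzian; for solutions of `u'' = q u`, so do the Hermitian sums of `u ū`, `u'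
ū` and `u' ū'`. Grönwall's inequality thus compares a density with a pair whose potential is nearly
`q`. -/
theorem abs_sub_le_of_linear_system {ω : ℂ} {r Q B η : ℝ} (hω : ‖ω‖ ≤ r)
    {q q' a a' : ℝ → ℂ} {v v' w w' : ℝ → ℝ}
    (hv : ∀ t ∈ Icc (0 : ℝ) 1, HasDerivAt v (2 * (a t * ω).re) t)
    (ha : ∀ t ∈ Icc (0 : ℝ) 1, HasDerivAt a (q t * v t * ω + w t * conj ω) t)
    (hw : ∀ t ∈ Icc (0 : ℝ) 1, HasDerivAt w (2 * (q t * ω * conj (a t)).re) t)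
    (hv' : ∀ t ∈ Icc (0 : ℝ) 1, HasDerivAt v' (2 * (a' t * ω).re) t)
    (ha' : ∀ t ∈ Icc (0 : ℝ) 1, HasDerivAt a' (q' t * v' t * ω + w' t * conj ω) t)
    (hw' : ∀ t ∈ Icc (0 : ℝ) 1, HasDerivAt w' (2 * (q' t * ω * conj (a' t)).re) t)
    (hq' : ∀ t ∈ Icc (0 : ℝ) 1, ‖q' t‖ ≤ Q) (hq : ∀ t ∈ Icc (0 : ℝ) 1, ‖q' t - q t‖ ≤ η)
    (hvB : ∀ t ∈ Icc (0 : ℝ) 1, |v t| ≤ B) (haB : ∀ t ∈ Icc (0 : ℝ) 1, ‖a t‖ ≤ B)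
    (h0 : v' 0 = v 0) (h0' : a' 0 = a 0) (h0'' : w' 0 = w 0) :
    |v' 1 - v 1| ≤ 2 * r * η * B * Real.exp (r * (2 * Q + 2) + 1) := by
  have m0 : (0 : ℝ) ∈ Icc (0 : ℝ) 1 := left_mem_Icc.2 zero_le_one
  have hr0 : 0 ≤ r := (norm_nonneg _).trans hω
  have hQ0 : 0 ≤ Q := (norm_nonneg _).trans (hq' 0 m0)
  have hη0 : 0 ≤ η := (norm_nonneg _).trans (hq 0 m0)
  have hB0 : 0 ≤ B := (norm_nonneg _).trans (haB 0 m0)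
  have key := norm_le_of_norm_deriv_le (F := ℝ × ℂ × ℝ)
    (f := fun t => (v' t - v t, a' t - a t, w' t - w t)) (a := 0) (b := 1) (δ := 0)
    (K := r * (2 * Q + 2) + 1) (ε := 2 * r * η * B) zero_le_one
    (fun t ht => ((hv' t ht).sub (hv t ht)).prodMk (((ha' t ht).sub (ha t ht)).prodMk
      ((hw' t ht).sub (hw t ht)))) (by nlinarith [mul_nonneg hr0 hQ0]) (by positivity)
    (by simp [h0, h0', h0'']) ?_
  · rw [sub_zero, mul_one, zero_add] at key
    exact (norm_fst_le _).trans key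
  intro t ht
  set N := ‖((v' t - v t, a' t - a t, w' t - w t) : ℝ × ℂ × ℝ)‖ with hN
  have n0 : 0 ≤ N := norm_nonneg _
  have n1 : |v' t - v t| ≤ N := norm_fst_le ((v' t - v t, a' t - a t, w' t - w t) : ℝ × ℂ × ℝ)
  have n23 := norm_snd_le ((v' t - v t, a' t - a t, w' t - w t) : ℝ × ℂ × ℝ)
  have n2 : ‖a' t - a t‖ ≤ N := (norm_fst_le (a' t - a t, w' t - w t)).trans n23
  have n3 : |w' t - w t| ≤ N := (norm_snd_le (a' t - a t, w' t - w t)).trans n23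
  have hre : ∀ x y : ℂ, |2 * x.re - 2 * y.re| ≤ 2 * ‖x - y‖ := fun x y => by
    rw [← mul_sub, abs_mul, abs_two, ← sub_re]
    exact mul_le_mul_of_nonneg_left (abs_re_le_norm _) two_pos.le
  have hrN : 0 ≤ r * N := mul_nonneg hr0 n0
  have hrQN : 0 ≤ r * Q * N := mul_nonneg (mul_nonneg hr0 hQ0) n0
  have hrηB : 0 ≤ r * η * B := by positivity
  refine norm_prod_le_iff.2 ⟨?_, norm_prod_le_iff.2 ⟨?_, ?_⟩⟩
  · refine (hre _ _).trans ?_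
    rw [← sub_mul, norm_mul]
    have := mul_le_mul n2 hω (norm_nonneg _) n0
    nlinarith
  · have e : q' t * v' t * ω + w' t * conj ω - (q t * v t * ω + w t * conj ω) =
        q' t * ω * ((v' t - v t : ℝ) : ℂ) + (q' t - q t) * ω * (v t : ℂ) +
          ((w' t - w t : ℝ) : ℂ) * conj ω := by push_cast; ring
    change ‖q' t * v' t * ω + w' t * conj ω - (q t * v t * ω + w t * conj ω)‖ ≤ _
    rw [e]
    refine norm_add₃_le.trans ?_
    simp only [norm_mul, Complex.norm_real, RCLike.norm_conj, Real.norm_eq_abs]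
    have h1 : ‖q' t‖ * ‖ω‖ * |v' t - v t| ≤ Q * r * N := by
      gcongr
      exact hq' t ht
    have h2 : ‖q' t - q t‖ * ‖ω‖ * |v t| ≤ η * r * B := by
      gcongr
      exacts [hq t ht, hvB t ht]
    have h3 : |w' t - w t| * ‖ω‖ ≤ N * r := by gcongr
    nlinarith
  · refine (hre _ _).trans ?_
    have e : q' t * ω * conj (a' t) - q t * ω * conj (a t) =
        q' t * ω * conj (a' t - a t) + (q' t - q t) * ω * conj (a t) := by
      rw [map_sub]; ring
    rw [e]
    have h1 : ‖q' t * ω * conj (a' t - a t)‖ ≤ Q * r * N := by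
      rw [norm_mul, norm_mul, RCLike.norm_conj]
      gcongr
      exact hq' t ht
    have h2 : ‖(q' t - q t) * ω * conj (a t)‖ ≤ η * r * B := by
      rw [norm_mul, norm_mul, RCLike.norm_conj]
      gcongr
      exacts [hq t ht, haB t ht]
    have := norm_add_le (q' t * ω * conj (a' t - a t)) ((q' t - q t) * ω * conj (a t))
    nlinarith

end Liouville
-- Approximation of positively curved densities by unit pairs.
section Liouville
open Set Metric Topology Filter Complex
open scoped ComplexConjugate

/-- Every density of constant positive curvature is, on a disc, a limit of densities which come
from unit pairs of entire functions. -/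
theorem IsConstCurvatureDensity.exists_unitPair_near {S : Opens ℂ} {c : ℝ} (hc : 0 < c)
    {l : ℂ → ℝ} (hl : IsConstCurvatureDensity S c l) {r R : ℝ} (hr : 0 < r) (hrR : r < R)
    (hRS : ball (0 : ℂ) R ⊆ S) {ε : ℝ} (hε : 0 < ε) :
    ∃ u : Fin 2 → ℂ → ℂ, IsUnitPair univ u ∧
      ∀ z ∈ closedBall (0 : ℂ) r, |pairDensity c (fun j => u j z) - l z| < ε := by
  obtain ⟨p, q, hq, hpq⟩ := hl.exists_schwarzian
  have hsub : closedBall (0 : ℂ) r ⊆ S := (closedBall_subset_ball hrR).trans hRS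
  have h0S : (0 : ℂ) ∈ S := hsub (mem_closedBall_self hr.le)
  have hpos := hl.1.1
  have hlc : ContinuousOn l (closedBall (0 : ℂ) r) := hl.1.2.continuousOn.mono hsub
  have hpc : ContinuousOn p (closedBall (0 : ℂ) r) := fun z hz => by
    obtain ⟨-, P, hP, -⟩ := hpq z (hsub hz)
    exact hP.continuousAt.continuousWithinAt
  have hvc : ContinuousOn (fun z => (l z)⁻¹) (closedBall (0 : ℂ) r) :=
    hlc.inv₀ fun z hz => (hpos z (hsub hz)).ne'
  obtain ⟨Q, hQ⟩ := (isCompact_closedBall (0 : ℂ) r).exists_bound_of_continuousOn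
    (hq.continuousOn.mono hsub)
  obtain ⟨B₁, hB₁⟩ := (isCompact_closedBall (0 : ℂ) r).exists_bound_of_continuousOn hvc
  obtain ⟨B₂, hB₂⟩ := (isCompact_closedBall (0 : ℂ) r).exists_bound_of_continuousOn
    ((continuous_ofReal.comp_continuousOn hvc).mul hpc)
  obtain ⟨B₃, hB₃⟩ := (isCompact_closedBall (0 : ℂ) r).exists_bound_of_continuousOn hlc
  set B := |B₁| + |B₂| with hB
  have hB0 : 0 ≤ B := by positivity
  have hB₃0 : 0 < B₃ := (norm_pos_iff.2 (hpos 0 h0S).ne').trans_le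
    (hB₃ 0 (mem_closedBall_self hr.le))
  -- If the reciprocals differ by at most `δ`, the first term gives `V ≥ 1 / (2 l)`, and then `|1 /
  -- V - l| ≤ 2 l² δ ≤ ε / 2`.
  set δ := min (1 / (2 * B₃)) (ε / (4 * B₃ ^ 2)) with hδ
  have hδ0 : 0 < δ := by positivity
  set E := Real.exp (r * (2 * (Q + 1) + 2) + 1) with hE
  have hE0 : 0 < E := Real.exp_pos _
  set η := min 1 (δ / (2 * r * B * E + 1)) with hη
  have hη0 : 0 < η := by positivity
  have hηδ : 2 * r * η * B * E ≤ δ := by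
    have h1 : η * (2 * r * B * E + 1) ≤ δ := by
      rw [← le_div_iff₀ (by positivity)]; exact min_le_right _ _
    nlinarith
  obtain ⟨g, hg⟩ := exists_polynomial_closedBall_approx hr hrR (hq.mono hRS) hη0
  have hgQ : ∀ z ∈ closedBall (0 : ℂ) r, ‖g.eval z‖ ≤ Q + 1 := fun z hz => by
    have h1 := norm_add_le (g.eval z - q z) (q z)
    rw [sub_add_cancel] at h1
    linarith [(hg z hz).le.trans (min_le_left _ _), hQ z hz]
  -- With this `k`, the reciprocal of the density of a pair is `k (|u₀|² + |u₁|²)`.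
  set k := √c / 2 with hk
  have hk0 : 0 < k := half_pos (Real.sqrt_pos.2 hc)
  have hk2 : k ^ 2 = c / 4 := by rw [hk, div_pow, Real.sq_sqrt hc.le]; norm_num
  -- The data `(α, α p 0)` and `(0, 1 / α)` have Wronskian `1` and make all three quantities agree
  -- at `0`; the third because `k / α² = k² l 0 = c l 0 / 4`.
  set α := √((l 0)⁻¹ / k) with hα
  have hv0 : 0 < (l 0)⁻¹ := inv_pos.2 (hpos 0 h0S)
  have hα0 : 0 < α := Real.sqrt_pos.2 (div_pos hv0 hk0)
  have hkα : k * α ^ 2 = (l 0)⁻¹ := by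
    rw [hα, Real.sq_sqrt (div_pos hv0 hk0).le]; field_simp
  obtain ⟨u₀, d₀, hu₀, hd₀, hud₀, hdd₀⟩ := exists_entire_ode_solution
    (q := fun z => g.eval z) g.differentiable 0 α (α * p 0)
  obtain ⟨u₁, d₁, hu₁, hd₁, hud₁, hdd₁⟩ := exists_entire_ode_solution
    (q := fun z => g.eval z) g.differentiable 0 0 (α : ℂ)⁻¹
  have hαc : (α : ℂ) ≠ 0 := by exact_mod_cast hα0.ne'
  have hpair : IsUnitPair univ ![u₀, u₁] := by
    refine ⟨fun j => ?_, fun z _ => ?_⟩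
    · fin_cases j
      exacts [fun z _ => (hud₀ z).differentiableAt.differentiableWithinAt,
        fun z _ => (hud₁ z).differentiableAt.differentiableWithinAt]
    · simp only [Matrix.cons_val_zero, Matrix.cons_val_one, (hud₀ z).deriv, (hud₁ z).deriv]
      rw [wronskian_eq hud₀ hdd₀ hud₁ hdd₁ z 0, hu₀, hu₁, hd₁, mul_zero, sub_zero,
        mul_inv_cancel₀ hαc]
  refine ⟨![u₀, u₁], hpair, fun z hz => ?_⟩
  have hzr : ‖z‖ ≤ r := mem_closedBall_zero_iff.1 hz
  have htz : ∀ t ∈ Icc (0 : ℝ) 1, (t : ℂ) * z ∈ closedBall (0 : ℂ) r := fun t ht => by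
    rw [mem_closedBall_zero_iff, norm_mul, norm_real, Real.norm_of_nonneg ht.1]
    exact (mul_le_of_le_one_left (norm_nonneg _) ht.2).trans hzr
  have hline : ∀ t : ℝ, HasDerivAt (fun t : ℝ => (t : ℂ) * z) z t := fun t =>
    ((ofRealCLM.hasDerivAt (x := t)).mul_const z).congr_deriv (by simp)
  have hlt : ∀ t ∈ Icc (0 : ℝ) 1, HasDerivAt (fun t : ℝ => l (t * z))
      (-2 * l (t * z) * (p (t * z) * z).re) t := fun t ht => by
    obtain ⟨⟨A, hA, hA'⟩, -⟩ := hpq _ (hsub (htz t ht))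
    exact (hA.comp_hasDerivAt t (hline t)).congr_deriv (hA' z)
  have hpt : ∀ t ∈ Icc (0 : ℝ) 1, HasDerivAt (fun t : ℝ => p (t * z))
      ((q (t * z) - p (t * z) ^ 2) * z + (c / 4 * l (t * z) ^ 2 : ℝ) * conj z) t := fun t ht => by
    obtain ⟨-, P, hP, hP'⟩ := hpq _ (hsub (htz t ht))
    exact (hP.comp_hasDerivAt t (hline t)).congr_deriv (hP' z)
  have hl0 : ∀ t ∈ Icc (0 : ℝ) 1, l (t * z) ≠ 0 := fun t ht =>
    (hpos _ (hsub (htz t ht))).ne'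
  have hit : ∀ t ∈ Icc (0 : ℝ) 1, HasDerivAt (fun t : ℝ => (l (t * z))⁻¹)
      (2 * (l (t * z))⁻¹ * (p (t * z) * z).re) t := fun t ht => by
    refine ((hlt t ht).fun_inv (hl0 t ht)).congr_deriv ?_
    have := hl0 t ht
    field_simp
  have hu₀t : ∀ t : ℝ, HasDerivAt (fun t : ℝ => u₀ (t * z)) (d₀ (t * z) * z) t := fun t =>
    (hud₀ _).comp t (hline t)
  have hu₁t : ∀ t : ℝ, HasDerivAt (fun t : ℝ => u₁ (t * z)) (d₁ (t * z) * z) t := fun t =>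
    (hud₁ _).comp t (hline t)
  have hd₀t : ∀ t : ℝ, HasDerivAt (fun t : ℝ => d₀ (t * z))
      (g.eval (t * z) * u₀ (t * z) * z) t := fun t => (hdd₀ _).comp t (hline t)
  have hd₁t : ∀ t : ℝ, HasDerivAt (fun t : ℝ => d₁ (t * z))
      (g.eval (t * z) * u₁ (t * z) * z) t := fun t => (hdd₁ _).comp t (hline t)
  have key := abs_sub_le_of_linear_system (ω := z) (r := r) (Q := Q + 1) (B := B) (η := η) hzr
    (q := fun t => q (t * z)) (q' := fun t => g.eval (t * z))
    (a := fun t => ((l (t * z))⁻¹ : ℝ) * p (t * z))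
    (a' := fun t => k * (d₀ (t * z) * conj (u₀ (t * z)) + d₁ (t * z) * conj (u₁ (t * z))))
    (v := fun t => (l (t * z))⁻¹)
    (v' := fun t => k * (‖u₀ (t * z)‖ ^ 2 + ‖u₁ (t * z)‖ ^ 2))
    (w := fun t => ‖p (t * z)‖ ^ 2 * (l (t * z))⁻¹ + c / 4 * l (t * z))
    (w' := fun t => k * (‖d₀ (t * z)‖ ^ 2 + ‖d₁ (t * z)‖ ^ 2))
    ?_ ?_ ?_ ?_ ?_ ?_ (fun t ht => hgQ _ (htz t ht)) (fun t ht => (hg _ (htz t ht)).le)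
    (fun t ht => (hB₁ _ (htz t ht)).trans ((le_abs_self B₁).trans
      (le_add_of_nonneg_right (abs_nonneg _))))
    (fun t ht => (hB₂ _ (htz t ht)).trans ((le_abs_self B₂).trans
      (le_add_of_nonneg_left (abs_nonneg _)))) ?_ ?_ ?_
  · simp only [ofReal_one, one_mul] at key
    have hlz := hpos z (hsub hz)
    have hlB : l z ≤ B₃ := (le_abs_self _).trans (hB₃ z hz)
    set V := k * (‖u₀ z‖ ^ 2 + ‖u₁ z‖ ^ 2) with hV
    have hden : pairDensity c (fun j => (![u₀, u₁] : Fin 2 → ℂ → ℂ) j z) = V⁻¹ := by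
      simp only [pairDensity, Matrix.cons_val_zero, Matrix.cons_val_one, hV, hk]
      rw [div_mul_eq_mul_div, inv_div]
    have hkey : |V - (l z)⁻¹| ≤ δ := key.trans hηδ
    have hδ1 : δ ≤ (l z)⁻¹ / 2 := by
      refine (min_le_left _ _).trans ?_
      rw [div_le_div_iff₀ (by positivity) two_pos, one_mul]
      have : 1 ≤ (l z)⁻¹ * B₃ := by rw [inv_mul_eq_div, one_le_div hlz]; exact hlB
      linarith
    have hVl : (l z)⁻¹ / 2 ≤ V := by linarith [(abs_le.1 hkey).1]
    have hli := inv_pos.2 hlz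
    have hV0 : 0 < V := by linarith
    have e : V⁻¹ - l z = -(V⁻¹ * l z) * (V - (l z)⁻¹) := by field_simp; ring
    rw [hden, e, abs_mul, abs_neg, abs_of_pos (by positivity)]
    have hVi : V⁻¹ ≤ 2 * l z := by
      rw [inv_le_comm₀ hV0 (by positivity), mul_inv]
      linarith
    calc V⁻¹ * l z * |V - (l z)⁻¹| ≤ 2 * B₃ * B₃ * (ε / (4 * B₃ ^ 2)) := by
          refine mul_le_mul ?_ (hkey.trans (min_le_right _ _)) (abs_nonneg _) (by positivity)
          exact mul_le_mul (by linarith) hlB hlz.le (by positivity)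
      _ = ε / 2 := by field_simp; ring
      _ < ε := half_lt_self hε
  · intro t ht
    refine (hit t ht).congr_deriv ?_
    rw [mul_assoc (Complex.ofReal _), re_ofReal_mul]
    ring
  · intro t ht
    refine ((hit t ht).ofReal_comp.mul (hpt t ht)).congr_deriv ?_
    have h1 : (l (t * z) : ℂ) ≠ 0 := by exact_mod_cast hl0 t ht
    have h2 : ((p (t * z) * z).re : ℂ) = (p (t * z) * z + conj (p (t * z)) * conj z) / 2 := by
      rw [re_eq_add_conj, map_mul]
    have h3 : (‖p (t * z)‖ : ℂ) ^ 2 = p (t * z) * conj (p (t * z)) := by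
      rw [mul_conj, normSq_eq_norm_sq]; push_cast; rfl
    push_cast
    rw [h2, h3]
    field_simp
    ring
  · intro t ht
    refine (((hpt t ht).norm_sq.mul (hit t ht)).add
      ((hlt t ht).const_mul (c / 4))).congr_deriv ?_
    have := hl0 t ht
    simp only [Complex.inner, ← normSq_eq_norm_sq, normSq_apply]
    generalize p (t * z) = x
    generalize q (t * z) = y
    simp only [pow_two, mul_re, mul_im, add_re, add_im, sub_re, sub_im, conj_re, conj_im, ofReal_re,
      ofReal_im, map_mul, conj_ofReal]
    field_simp
    ring
  · intro t _
    refine (((hu₀t t).norm_sq.add (hu₁t t).norm_sq).const_mul k).congr_deriv ?_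
    simp only [Complex.inner]
    rw [mul_assoc (Complex.ofReal _), re_ofReal_mul]
    simp only [add_mul, add_re, mul_re, mul_im, conj_re, conj_im]
    ring
  · intro t _
    refine ((((hd₀t t).mul ((hu₀t t).star)).add
      ((hd₁t t).mul ((hu₁t t).star))).const_mul (k : ℂ)).congr_deriv ?_
    simp only [star_def, map_mul, ← normSq_eq_norm_sq]
    push_cast
    rw [← mul_conj, ← mul_conj, ← mul_conj, ← mul_conj]
    ring
  · intro t _
    refine (((hd₀t t).norm_sq.add (hd₁t t).norm_sq).const_mul k).congr_deriv ?_
    simp only [Complex.inner, map_mul, map_add, conj_ofReal, conj_conj]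
    simp only [add_re, add_im, mul_re, mul_im, conj_re, conj_im, ofReal_re, ofReal_im]
    ring
  · simp [hu₀, hu₁, hkα, abs_of_pos hα0]
  · simp only [ofReal_zero, zero_mul, hu₀, hu₁, hd₀, conj_ofReal, map_zero, mul_zero, add_zero]
    rw [← hkα]
    push_cast
    ring
  · simp only [ofReal_zero, zero_mul, hd₀, hd₁, norm_mul, norm_inv, norm_real, Real.norm_of_nonneg
      hα0.le]
    have h1 : l 0 = (k * α ^ 2)⁻¹ := by rw [hkα, inv_inv]
    rw [h1, ← hk2]
    field_simp

end Liouville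
-- Universal densities on the disc and the plane.
section Model
open Set Metric Topology Filter Polynomial

/-- For curvature zero `log l` is harmonic, hence on the disc the real part of a holomorphic
function, which polynomials approximate. -/
theorem IsConstCurvatureDensity.exists_polynomial_near {S : Opens ℂ} {l : ℂ → ℝ}
    (hl : IsConstCurvatureDensity S 0 l) {r R : ℝ} (hr : 0 < r) (hrR : r < R)
    (hRS : ball (0 : ℂ) R ⊆ S) {ε : ℝ} (hε : 0 < ε) :
    ∃ p : ℂ[X], ∀ z ∈ closedBall (0 : ℂ) r, |Real.exp (p.eval z).re - l z| < ε := by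
  obtain ⟨⟨hpos, hcd⟩, hcurv⟩ := hl
  have hlap : ∀ z ∈ S, Laplacian.laplacian (fun w => Real.log (l w)) z = 0 := fun z hz => by
    have := hcurv z hz
    unfold gaussCurvature at this
    rwa [div_eq_zero_iff, or_iff_left (pow_ne_zero 2 (hpos z hz).ne'), neg_eq_zero] at this
  have hharm : InnerProductSpace.HarmonicOnNhd (fun w => Real.log (l w)) (ball (0 : ℂ) R) :=
    fun z hz => ⟨(hcd.contDiffAt (S.isOpen.mem_nhds (hRS hz))).log (hpos z (hRS hz)).ne',
      (S.isOpen.eventually_mem (hRS hz)).mono hlap⟩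
  obtain ⟨F, hF, hFl⟩ := hharm.exists_analyticOnNhd_ball_re_eq
  have hsub : closedBall (0 : ℂ) r ⊆ ball 0 R := closedBall_subset_ball hrR
  have huc := ((isCompact_closedBall (0 : ℂ) r).image_of_continuousOn
    (hF.continuousOn.mono hsub)).uniformContinuousAt_of_continuousAt
    (fun z : ℂ => Real.exp z.re) (fun z _ => by fun_prop) (dist_mem_uniformity hε)
  obtain ⟨δ, hδ, hδs⟩ := Metric.mem_uniformity_dist.1 huc
  obtain ⟨p, hp⟩ := exists_polynomial_closedBall_approx hr hrR hF.differentiableOn hδ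
  refine ⟨p, fun z hz => ?_⟩
  have h1 : dist (F z) (p.eval z) < δ := by
    rw [dist_comm, dist_eq_norm]; exact hp z hz
  have h2 : dist (Real.exp (F z).re) (Real.exp (p.eval z).re) < ε :=
    hδs h1 (mem_image_of_mem F hz)
  have h3 : (F z).re = Real.log (l z) := hFl (hsub hz)
  rwa [h3, Real.exp_log (hpos z (hRS (hsub hz))), Real.dist_eq, abs_sub_comm] at h2

/-- A run-away sequence leaves a given compact set at arbitrarily late times. -/
theorem IsRunAway.exists_ge {M : Opens ℂ} {φ : ℕ → LocUnivSelfMap M} (hφ : IsRunAway φ) {z₀ : ℂ}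
    (hz₀ : z₀ ∈ M) {K : Set ℂ} (hK : K ⊆ M) (hKc : IsCompact K) (N : ℕ) :
    ∃ n ≥ N, Disjoint ((φ n).toFun '' K) K := by
  -- Adding `z₀` and its images under the first `N` maps to the compact set rules out the indices
  -- below `N`.
  set F : Set ℂ := (fun n => (φ n).toFun z₀) '' Iio N with hF
  have hFc : IsCompact F := ((finite_Iio N).image _).isCompact
  have hFM : F ⊆ M := by
    rintro _ ⟨n, -, rfl⟩
    exact (φ n).mapsTo hz₀
  obtain ⟨n, hn⟩ := hφ (K ∪ (insert z₀ F)) (union_subset hK (insert_subset hz₀ hFM))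
    (hKc.union (hFc.insert z₀))
  have hd := disjoint_iff_inter_eq_empty.2 hn
  refine ⟨n, ?_, hd.mono (image_mono subset_union_left) subset_union_left⟩
  by_contra! h
  exact hd.le_bot ⟨mem_image_of_mem _ (Or.inr (mem_insert z₀ F)),
    Or.inr (mem_insert_of_mem _ ⟨n, h, rfl⟩)⟩

/-- Injectivity holds only from some index on, so the run-away property is used at a late index. The
radii beyond `r` leave room for a Cauchy integral over a circle of radius `ρ`. -/
theorem exists_disc_of_isRunAway {M : Opens ℂ}
    (hM : ∀ K : Set ℂ, K ⊆ M → IsCompact K →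
      ∃ r R, 0 < r ∧ r < R ∧ K ⊆ closedBall 0 r ∧ ball (0 : ℂ) R ⊆ M)
    {φ : ℕ → LocUnivSelfMap M} (hrun : IsRunAway φ) (hinj : IsEventuallyInjective φ)
    {K : Set ℂ} (hK : K ⊆ M) (hKc : IsCompact K) :
    ∃ n r ρ R, 0 < r ∧ r < ρ ∧ ρ < R ∧ K ⊆ closedBall 0 r ∧ ball (0 : ℂ) R ⊆ M ∧
      InjOn (φ n).toFun (ball 0 R) ∧ Disjoint (closedBall 0 r) ((φ n).toFun '' closedBall 0 ρ) := by
  obtain ⟨r, R, hr, hrR, hKr, hRM⟩ := hM K hK hKc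
  obtain ⟨R', hrR', hR'R⟩ := exists_between hrR
  obtain ⟨ρ, hrρ, hρR'⟩ := exists_between hrR'
  have hsub : closedBall (0 : ℂ) R' ⊆ M := (closedBall_subset_ball hR'R).trans hRM
  obtain ⟨N, hN⟩ := hinj _ hsub (isCompact_closedBall 0 R')
  obtain ⟨n, hn, hd⟩ := hrun.exists_ge (hRM (mem_ball_self (hr.trans hrR))) hsub
    (isCompact_closedBall 0 R') N
  exact ⟨n, r, ρ, R', hr, hrρ, hρR', hKr, (ball_subset_ball hR'R.le).trans hRM,
    (hN n hn).mono ball_subset_closedBall, (hd.mono (image_mono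
      (closedBall_subset_closedBall hρR'.le)) (closedBall_subset_closedBall hrR'.le)).symm⟩

/-- For `c = 0` the data are holomorphic functions, for `c > 0` unit pairs, viewed as maps into the
vectors where `pairDensity` is continuous. -/
theorem exists_pullbacks_dense {M : Opens ℂ}
    (hM : ∀ K : Set ℂ, K ⊆ M → IsCompact K →
      ∃ r R, 0 < r ∧ r < R ∧ K ⊆ closedBall 0 r ∧ ball (0 : ℂ) R ⊆ M) {c : ℝ} (hc : 0 ≤ c)
    {φ : ℕ → LocUnivSelfMap M} (hrun : IsRunAway φ) (hinj : IsEventuallyInjective φ) :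
    ∃ L ∈ constCurvatureDensities M c,
      constCurvatureDensities M c ⊆ closure (range fun n => (φ n).pullback L) := by
  have himg : ∀ K : Set M, ((↑) '' K : Set ℂ) ⊆ M := by
    rintro K _ ⟨z, -, rfl⟩
    exact z.2
  have hcpt : ∀ K : Set M, IsCompact K → IsCompact ((↑) '' K : Set ℂ) := fun K hK =>
    hK.image continuous_subtype_val
  have hcont : ∀ {f : ℂ → ℂ}, Differentiable ℂ f → Continuous fun z : M => f z := fun hf =>
    hf.continuous.comp continuous_subtype_val
  rcases hc.eq_or_lt with rfl | hc
  · refine Exists.elim (exists_pullback_dense (F := ℂ) (φ := φ) isOpen_univ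
      (g := fun z => Real.exp z.re) (by fun_prop) (isClosed_holomorphic M)
      ⟨0, 0, differentiableOn_const 0, fun z => rfl⟩ (fun _ _ _ => mem_univ _)
      (S := constCurvatureDensities M 0) ?_ ?_) ?_
    · rintro l ⟨l', hl', hl⟩ K hK ε hε
      obtain ⟨r, R, hr, hrR, hKr, hRM⟩ := hM _ (himg K) (hcpt K hK)
      obtain ⟨p, hp⟩ := IsConstCurvatureDensity.exists_polynomial_near hl hr hrR hRM hε
      refine ⟨⟨fun z => p.eval (z : ℂ), hcont p.differentiable⟩,
        ⟨fun z => p.eval z, p.differentiable.differentiableOn, fun z => rfl⟩, fun z hz => ?_⟩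
      rw [hl']
      exact hp z (hKr ⟨z, hz, rfl⟩)
    · intro K hK
      obtain ⟨n, r, ρ, R, hr, hrρ, hρR, hKr, hRM, hi, hd⟩ :=
        exists_disc_of_isRunAway hM hrun hinj (himg K) (hcpt K hK)
      refine ⟨n, ?_⟩
      rintro u ⟨u', hu', hu⟩ w ⟨w', hw', hw⟩ ε hε
      obtain ⟨p, f, hpf⟩ := exists_polynomial_log_near hr hrρ hρR ((φ n).holo.mono hRM) hi
        (fun z hz => (φ n).deriv_ne_zero z (hRM hz)) hd (hu'.mono hRM) (hw'.mono hRM) hε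
      refine ⟨⟨fun z => p.eval (z : ℂ), hcont p.differentiable⟩,
        ⟨fun z => p.eval z, p.differentiable.differentiableOn, fun z => rfl⟩,
        fun z => f z, fun z hz => ?_⟩
      rw [hu, hw]
      exact hpf z (hKr ⟨z, hz, rfl⟩)
    · rintro u ⟨⟨h, hh, hu⟩, L, hL, hdense⟩
      exact ⟨L, ⟨_, fun z => (hL z).trans (by rw [hu]), isConstCurvatureDensity_exp_re hh⟩, hdense⟩
  · have hG : IsOpen {x : Fin 2 → ℂ | 0 < ‖x 0‖ ^ 2 + ‖x 1‖ ^ 2} :=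
      isOpen_lt continuous_const (by fun_prop)
    have hg : ContinuousOn (pairDensity c) {x : Fin 2 → ℂ | 0 < ‖x 0‖ ^ 2 + ‖x 1‖ ^ 2} :=
      continuousOn_const.div (by fun_prop) fun x hx =>
        (mul_pos (Real.sqrt_pos.2 hc) hx).ne'
    refine Exists.elim (exists_pullback_dense (φ := φ) hG hg (isClosed_unitPair M) ?_ ?_
      (S := constCurvatureDensities M c) ?_ ?_) ?_
    -- The pair `(1, z)`, with Wronskian `1`, shows that unit pairs exist.
    · refine ⟨⟨fun z => ![1, (z : ℂ)], by fun_prop⟩, ![fun _ => 1, fun z => z], ⟨fun j => ?_,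
        fun z _ => by simp⟩, fun z j => ?_⟩
      · fin_cases j
        exacts [differentiableOn_const 1, differentiableOn_id]
      · fin_cases j <;> rfl
    · rintro u ⟨u', hu', hu⟩ z
      have := hu'.pos z.2
      rwa [← hu, ← hu] at this
    · rintro l ⟨l', hl', hl⟩ K hK ε hε
      obtain ⟨r, R, hr, hrR, hKr, hRM⟩ := hM _ (himg K) (hcpt K hK)
      obtain ⟨w, hw, hwl⟩ := IsConstCurvatureDensity.exists_unitPair_near hc hl hr hrR hRM hε
      refine ⟨⟨fun z j => w j z, continuous_pi fun j => hcont (differentiableOn_univ.1 (hw.1 j))⟩,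
        ⟨w, hw.mono (subset_univ _), fun z j => rfl⟩, fun z hz => ?_⟩
      rw [hl']
      exact hwl z (hKr ⟨z, hz, rfl⟩)
    · intro K hK
      obtain ⟨n, r, ρ, R, hr, hrρ, hρR, hKr, hRM, hi, hd⟩ :=
        exists_disc_of_isRunAway hM hrun hinj (himg K) (hcpt K hK)
      refine ⟨n, ?_⟩
      rintro u ⟨u', hu', hu⟩ w ⟨w', hw', hw⟩ ε hε
      obtain ⟨U, f, hU, hUf⟩ := exists_unitPair_near hr hrρ hρR ((φ n).holo.mono hRM) hi
        (fun z hz => (φ n).deriv_ne_zero z (hRM hz)) hd (hu'.mono hRM) (hw'.mono hRM) hε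
      refine ⟨⟨fun z j => U j z, continuous_pi fun j => hcont (differentiableOn_univ.1 (hU.1 j))⟩,
        ⟨U, hU.mono (subset_univ _), fun z j => rfl⟩, fun z j => f j z, fun z hz => ?_⟩
      have hz' := hUf z (hKr ⟨z, hz, rfl⟩)
      refine ⟨(pi_norm_le_iff_of_nonneg hε.le).2 fun j => ?_,
        (pi_norm_le_iff_of_nonneg hε.le).2 fun j => ?_, ?_⟩
      · rw [Pi.sub_apply, hu]; exact (hz' j).1
      · rw [Pi.sub_apply, hw]; exact (hz' j).2.1
      · have hd0 := norm_ne_zero_iff.2 ((φ n).deriv_ne_zero z z.2)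
        simp only [pairDensity, ContinuousMap.coe_mk, (hz' _).2.2]
        rw [← mul_add, mul_left_comm, mul_comm, ← mul_div_assoc, mul_div_mul_left _ _ hd0]
    · rintro u ⟨⟨u', hu', hu⟩, L, hL, hdense⟩
      refine ⟨L, ⟨_, fun z => (hL z).trans ?_, hu'.isConstCurvatureDensity hc⟩, hdense⟩
      exact congrArg _ (funext fun j => hu z j)

end Model
-- Normal families and Möbius maps for the Riemann mapping theorem.
section RiemannMapping
open Set Metric Topology Filter
open scoped ComplexConjugate

/-- **Montel's theorem** for sequences of holomorphic functions bounded by `1`. -/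
theorem exists_subseq_tendstoLocallyUniformlyOn {M : Opens ℂ} {f : ℕ → ℂ → ℂ}
    (hf : ∀ n, DifferentiableOn ℂ (f n) M) (hb : ∀ n, ∀ z ∈ M, ‖f n z‖ ≤ 1) :
    ∃ (ψ : ℕ → ℕ) (f₀ : ℂ → ℂ), StrictMono ψ ∧
      TendstoLocallyUniformlyOn (fun n => f (ψ n)) f₀ atTop M := by
  classical
  have : LocallyCompactSpace M := M.isOpen.locallyCompactSpace
  let v : ℕ → C(M, ℂ) := fun n => ⟨fun z => f n z,
    continuousOn_iff_continuous_domRestrict.mp (hf n).continuousOn⟩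
  have : T2Space (UniformOnFun M ℂ {K : Set M | IsCompact K}) :=
    UniformOnFun.t2Space_of_covering (eq_univ_iff_forall.2 fun z =>
      mem_sUnion_of_mem (mem_singleton z) isCompact_singleton)
  have hcomp : IsCompact (closure (range v)) := by
    refine ArzelaAscoli.isCompact_closure_of_isClosedEmbedding (𝔖 := {K : Set M | IsCompact K})
      (F := fun u : C(M, ℂ) => (u : M → ℂ)) (fun K hK => hK)
      ContinuousMap.isUniformEmbedding_toUniformOnFunIsCompact.isClosedEmbedding ?_ ?_
    · intro K _
      refine Equicontinuous.equicontinuousOn (fun z => ?_) K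
      obtain ⟨r, hr, hrM⟩ := Metric.isOpen_iff.1 M.isOpen z z.2
      refine Metric.equicontinuousAt_iff.2 fun ε hε => ?_
      refine ⟨min r (ε * r / 3), by positivity, fun x hx => ?_⟩
      rintro ⟨_, n, rfl⟩
      have hxz : dist (x : ℂ) z < min r (ε * r / 3) := hx
      have h1 : MapsTo (f n) (ball (z : ℂ) r) (closedBall (f n z) 2) := fun y hy => by
        rw [mem_closedBall, dist_eq_norm]
        have := norm_sub_le (f n y) (f n z)
        linarith [hb n y (hrM hy), hb n z z.2]
      -- Equicontinuity comes from the Schwarz lemma on a disc inside `M`.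
      have h2 := Complex.dist_le_div_mul_dist_of_mapsTo_ball ((hf n).mono hrM) h1
        (hxz.trans_le (min_le_left _ _))
      change dist (f n z) (f n x) < ε
      rw [dist_comm]
      refine h2.trans_lt ?_
      have h3 := hxz.trans_le (min_le_right _ _)
      calc 2 / r * dist (x : ℂ) z ≤ 2 / r * (ε * r / 3) := by gcongr
        _ = 2 / 3 * ε := by field_simp
        _ < ε := by linarith
    · refine fun K _ z _ => ⟨closedBall 0 1, isCompact_closedBall 0 1, ?_⟩
      rintro _ ⟨n, rfl⟩
      exact mem_closedBall_zero_iff.2 (hb n z z.2)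
  obtain ⟨v₀, -, ψ, hψ, hlim⟩ := hcomp.tendsto_subseq (x := v)
    (fun n => subset_closure (mem_range_self n))
  set f₀ : ℂ → ℂ := fun z => if hz : z ∈ M then v₀ ⟨z, hz⟩ else 0 with hf₀
  have hv₀ : (v₀ : M → ℂ) = f₀ ∘ ((↑) : M → ℂ) := funext fun z => by simp [hf₀]
  refine ⟨ψ, f₀, hψ, ?_⟩
  rw [tendstoLocallyUniformlyOn_iff_tendstoLocallyUniformly_comp_coe]
  have h := ContinuousMap.tendsto_iff_tendstoLocallyUniformly.1 hlim
  rw [hv₀] at h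
  exact h

/-- **Hurwitz's theorem**: zeros of a limit of functions without zeros are not isolated. -/
theorem ne_zero_of_tendstoLocallyUniformlyOn {V : Set ℂ} (hV : IsOpen V) {g : ℕ → ℂ → ℂ}
    {g₀ : ℂ → ℂ} (hg : ∀ n, DifferentiableOn ℂ (g n) V)
    (hlim : TendstoLocallyUniformlyOn g g₀ atTop V) (h0 : ∀ n, ∀ z ∈ V, g n z ≠ 0) {b : ℂ}
    (hb : b ∈ V) (hne : ¬ ∀ᶠ z in 𝓝 b, g₀ z = 0) : g₀ b ≠ 0 := by
  intro hb0
  have hg₀ : DifferentiableOn ℂ g₀ V := hlim.differentiableOn (Eventually.of_forall hg) hV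
  have hiso := ((hg₀.analyticAt (hV.mem_nhds hb)).eventually_eq_zero_or_eventually_ne_zero).resolve_left
    hne
  obtain ⟨ρ, hρ, hρs⟩ := Metric.nhds_basis_closedBall.mem_iff.1
    ((eventually_nhdsWithin_iff.1 hiso).and (hV.mem_nhds hb))
  have hsph : ∀ z ∈ sphere b ρ, g₀ z ≠ 0 := fun z hz =>
    (hρs (sphere_subset_closedBall hz)).1 (ne_of_mem_sphere hz hρ.ne')
  have hcV : closedBall b ρ ⊆ V := fun z hz => (hρs hz).2
  obtain ⟨z₁, hz₁, hmin⟩ := (isCompact_sphere b ρ).exists_isMinOn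
    (NormedSpace.sphere_nonempty.2 hρ.le)
    ((hg₀.continuousOn.mono (sphere_subset_closedBall.trans hcV)).norm)
  set m := ‖g₀ z₁‖ with hm
  have hm0 : 0 < m := norm_pos_iff.2 (hsph z₁ hz₁)
  have huni := (tendstoLocallyUniformlyOn_iff_forall_isCompact hV).1 hlim _ hcV
    (isCompact_closedBall b ρ)
  obtain ⟨n, hn⟩ := (Metric.tendstoUniformlyOn_iff.1 huni (m / 3) (by positivity)).exists
  have hcl : closure (ball b ρ) = closedBall b ρ := closure_ball b hρ.ne'
  -- The maximum principle for `1 / g n` bounds `|g n b|` below by its size on the circle, about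
  -- `m`, while it should be near `g₀ b = 0`.
  have hinv : DiffContOnCl ℂ (fun z => (g n z)⁻¹) (ball b ρ) := by
    refine DifferentiableOn.diffContOnCl ?_
    rw [hcl]
    exact ((hg n).mono hcV).inv fun z hz => h0 n z (hcV hz)
  have hmax := Complex.norm_le_of_forall_mem_frontier_norm_le isBounded_ball hinv
    (C := (2 * m / 3)⁻¹) (fun z hz => ?_) (hcl.symm ▸ mem_closedBall_self hρ.le : b ∈ closure (ball b ρ))
  · rw [norm_inv, inv_le_inv₀ (norm_pos_iff.2 (h0 n b hb)) (by positivity)] at hmax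
    have := hn b (mem_closedBall_self hρ.le)
    rw [hb0, dist_zero_left] at this
    linarith
  · rw [frontier_ball b hρ.ne'] at hz
    have h1 := hn z (sphere_subset_closedBall hz)
    have h2 : m ≤ ‖g₀ z‖ := hmin hz
    rw [norm_inv]
    refine inv_anti₀ (by positivity) ?_
    rw [dist_eq_norm] at h1
    have := norm_sub_norm_le (g₀ z) (g n z)
    linarith

/-- The Möbius transformation of the unit disc which maps `w` to `0`. -/
noncomputable def mobius (w z : ℂ) : ℂ := (z - w) / (1 - conj w * z)

theorem one_sub_conj_mul_ne_zero {w z : ℂ} (hw : ‖w‖ < 1) (hz : ‖z‖ < 1) :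
    1 - conj w * z ≠ 0 := by
  intro h
  have h1 : ‖conj w * z‖ < 1 := by
    rw [norm_mul, RCLike.norm_conj]
    exact mul_lt_one_of_nonneg_of_lt_one_left (norm_nonneg _) hw hz.le
  rw [← sub_eq_zero.1 h, norm_one] at h1
  exact h1.false

theorem norm_mobius_lt_one {w z : ℂ} (hw : ‖w‖ < 1) (hz : ‖z‖ < 1) : ‖mobius w z‖ < 1 := by
  have h0 := norm_pos_iff.2 (one_sub_conj_mul_ne_zero hw hz)
  rw [mobius, norm_div, div_lt_one h0, ← sq_lt_sq₀ (norm_nonneg _) h0.le]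
  have h1 : (1 - ‖w‖ ^ 2) * (1 - ‖z‖ ^ 2) = ‖1 - conj w * z‖ ^ 2 - ‖z - w‖ ^ 2 := by
    simp only [← Complex.normSq_eq_norm_sq, Complex.normSq_apply, Complex.sub_re, Complex.sub_im,
      Complex.mul_re, Complex.mul_im, Complex.conj_re, Complex.conj_im, Complex.one_re,
      Complex.one_im]
    ring
  have h2 : 0 < (1 - ‖w‖ ^ 2) * (1 - ‖z‖ ^ 2) := by
    refine mul_pos ?_ ?_ <;> nlinarith [norm_nonneg w, norm_nonneg z]
  linarith

theorem hasDerivAt_mobius {w z : ℂ} (hw : ‖w‖ < 1) (hz : ‖z‖ < 1) :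
    HasDerivAt (mobius w) ((1 - ‖w‖ ^ 2) / (1 - conj w * z) ^ 2) z := by
  have h := ((hasDerivAt_id z).sub_const w).div
    (((hasDerivAt_id z).const_mul (conj w)).const_sub 1) (one_sub_conj_mul_ne_zero hw hz)
  refine h.congr_deriv ?_
  have h1 : (‖w‖ : ℂ) ^ 2 = w * conj w := by
    rw [Complex.mul_conj, Complex.normSq_eq_norm_sq]; push_cast; rfl
  rw [h1]
  simp only [id]
  ring

theorem injOn_mobius {w : ℂ} (hw : ‖w‖ < 1) : InjOn (mobius w) (ball 0 1) := by
  intro x hx y hy h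
  rw [mem_ball_zero_iff] at hx hy
  rw [mobius, mobius, div_eq_div_iff (one_sub_conj_mul_ne_zero hw hx)
    (one_sub_conj_mul_ne_zero hw hy)] at h
  have h1 : (x - y) * (1 - conj w * w) = 0 := by linear_combination h
  exact sub_eq_zero.1 ((mul_eq_zero.1 h1).resolve_right (one_sub_conj_mul_ne_zero hw hw))

/-- A continuous square root of a holomorphic function without zeros is holomorphic. -/
theorem hasDerivAt_of_sq_eq {U : Set ℂ} (hU : IsOpen U) {g F : ℂ → ℂ} (hg : ContinuousOn g U)
    (hF : DifferentiableOn ℂ F U) (hgF : ∀ z, g z ^ 2 = F z) {z : ℂ} (hz : z ∈ U)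
    (h0 : g z ≠ 0) : HasDerivAt g (deriv F z / (2 * g z)) z := by
  have hgc := hg.continuousAt (hU.mem_nhds hz)
  have hFd := (hF.differentiableAt (hU.mem_nhds hz)).hasDerivAt
  rw [hasDerivAt_iff_tendsto_slope] at hFd ⊢
  have h1 : Tendsto (fun w => g w + g z) (𝓝[≠] z) (𝓝 (2 * g z)) := by
    rw [two_mul]
    exact (hgc.tendsto.mono_left nhdsWithin_le_nhds).add_const _
  have h2 : (2 * g z) ≠ 0 := mul_ne_zero two_ne_zero h0
  refine (hFd.div h1 h2).congr' ?_
  filter_upwards [h1.eventually_ne h2, self_mem_nhdsWithin] with w hw hwz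
  have hwz' : w - z ≠ 0 := sub_ne_zero.2 hwz
  rw [Pi.div_apply, slope_def_field, slope_def_field, ← hgF, ← hgF]
  field_simp
  ring

end RiemannMapping
-- The Riemann mapping theorem by an extremal problem.
section RiemannMapping
open Set Metric Topology Filter
open scoped ComplexConjugate

/-- Holomorphic embeddings of `U` into the unit disc which map `z₀` to `0`. -/
structure IsDiscEmbedding (U : Set ℂ) (z₀ : ℂ) (f : ℂ → ℂ) : Prop where
  holo : DifferentiableOn ℂ f U
  norm_lt : ∀ z ∈ U, ‖f z‖ < 1
  inj : InjOn f U
  deriv_ne_zero : ∀ z ∈ U, deriv f z ≠ 0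
  map_base : f z₀ = 0

/-- Here `f` is a square root of `z - a` with `a ∉ U`. If both `x` and `-x` were values of `f` on
`U`, they would have the same preimage and `f` would vanish there; so a disc inside `f (U)` reflects
to a disc that `f` omits. -/
theorem exists_injective_disjoint_ball {U : Set ℂ} (hUo : IsOpen U) (hU : IsSimplyConnected U)
    (hne : U ≠ univ) :
    ∃ f : ℂ → ℂ, Function.Injective f ∧ (∀ z ∈ U, deriv f z ≠ 0) ∧
      ∃ x, ∃ ε > 0, ∀ z ∈ U, ε ≤ ‖f z - x‖ := by
  obtain ⟨a, ha⟩ := (ne_univ_iff_exists_notMem U).1 hne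
  have hFd : DifferentiableOn ℂ (fun z => z - a) U := by fun_prop
  obtain ⟨f, hfc, hf⟩ := Complex.exists_continuousOn_pow_eq hU hUo hFd.continuousOn
    (by rintro ⟨z, hz, h⟩; exact ha (sub_eq_zero.1 h ▸ hz)) two_ne_zero
  have hinj : Function.Injective f := fun x y h => by
    have : x - a = y - a := by rw [← hf, ← hf, h]
    exact sub_left_injective this
  have hf0 : ∀ z ∈ U, f z ≠ 0 := fun z hz h => by
    have := hf z
    rw [h, zero_pow two_ne_zero, eq_comm, sub_eq_zero] at this
    exact ha (this ▸ hz)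
  have hfd : ∀ z ∈ U, HasDerivAt f (1 / (2 * f z)) z := fun z hz =>
    (hasDerivAt_of_sq_eq hUo hfc hFd hf hz (hf0 z hz)).congr_deriv (by simp)
  have hd0 : ∀ z ∈ U, deriv f z ≠ 0 := fun z hz => by
    rw [(hfd z hz).deriv]
    exact div_ne_zero one_ne_zero (mul_ne_zero two_ne_zero (hf0 z hz))
  obtain ⟨z₀, hz₀⟩ := hU.nonempty
  have hopen := isOpen_image_of_deriv_ne_zero hUo
    (fun z hz => (hfd z hz).differentiableAt.differentiableWithinAt) hd0
  obtain ⟨ε, hε, hεs⟩ := Metric.isOpen_iff.1 hopen (f z₀) ⟨z₀, hz₀, rfl⟩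
  refine ⟨f, hinj, hd0, -f z₀, ε, hε, fun z hz => ?_⟩
  by_contra! h
  obtain ⟨y, hy, hyz⟩ := hεs (show -f z ∈ ball (f z₀) ε by
    rw [mem_ball, dist_eq_norm, ← norm_neg]
    rwa [show -(-f z - f z₀) = f z - -f z₀ by ring])
  have h2 : y - a = z - a := by rw [← hf, ← hf, hyz, neg_sq]
  rw [sub_left_injective h2] at hyz
  exact hf0 z hz (self_eq_neg.1 hyz)

theorem exists_mapsTo_ball_injOn_deriv_ne_zero {U : Set ℂ} (hUo : IsOpen U)
    (hU : IsSimplyConnected U) (hne : U ≠ univ) :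
    ∃ f : ℂ → ℂ, MapsTo f U (ball 0 1) ∧ InjOn f U ∧ ∀ z ∈ U, deriv f z ≠ 0 := by
  obtain ⟨f, hinj, hd, x, ε, hε, hx⟩ := exists_injective_disjoint_ball hUo hU hne
  have h0 : ∀ z ∈ U, f z - x ≠ 0 := fun z hz => norm_pos_iff.1 (hε.trans_le (hx z hz))
  have hε2 : ((ε / 2 : ℝ) : ℂ) ≠ 0 := by exact_mod_cast (half_pos hε).ne'
  refine ⟨fun z => ((ε / 2 : ℝ) : ℂ) / (f z - x), fun z hz => ?_, fun y hy z hz h => ?_,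
    fun z hz => ?_⟩
  · rw [mem_ball_zero_iff, norm_div, Complex.norm_real, Real.norm_of_nonneg (half_pos hε).le,
      div_lt_one (hε.trans_le (hx z hz))]
    linarith [hx z hz]
  · beta_reduce at h
    rw [div_eq_div_iff (h0 y hy) (h0 z hz)] at h
    exact hinj (sub_left_injective (mul_left_cancel₀ hε2 h)).symm
  · have hdz := (differentiableAt_of_deriv_ne_zero (hd z hz)).hasDerivAt
    rw [((hasDerivAt_const z ((ε / 2 : ℝ) : ℂ)).fun_div (hdz.sub_const x) (h0 z hz)).deriv]
    refine div_ne_zero ?_ (pow_ne_zero 2 (h0 z hz))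
    rw [zero_mul, zero_sub, neg_ne_zero]
    exact mul_ne_zero hε2 (hd z hz)

theorem exists_isDiscEmbedding {U : Set ℂ} (hUo : IsOpen U) (hU : IsSimplyConnected U)
    (hne : U ≠ univ) {z₀ : ℂ} (hz₀ : z₀ ∈ U) : ∃ f, IsDiscEmbedding U z₀ f := by
  obtain ⟨f, hm, hi, hd⟩ := exists_mapsTo_ball_injOn_deriv_ne_zero hUo hU hne
  have hn : ∀ z ∈ U, ‖f z‖ < 1 := fun z hz => mem_ball_zero_iff.1 (hm hz)
  have hder : ∀ z ∈ U, HasDerivAt (fun z => mobius (f z₀) (f z))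
      ((1 - ‖f z₀‖ ^ 2) / (1 - conj (f z₀) * f z) ^ 2 * deriv f z) z := fun z hz =>
    (hasDerivAt_mobius (hn z₀ hz₀) (hn z hz)).comp z
      (differentiableAt_of_deriv_ne_zero (hd z hz)).hasDerivAt
  refine ⟨fun z => mobius (f z₀) (f z), fun z hz => (hder z hz).differentiableAt.differentiableWithinAt,
    fun z hz => norm_mobius_lt_one (hn z₀ hz₀) (hn z hz),
    fun x hx y hy h => hi hx hy (injOn_mobius (hn z₀ hz₀) (hm hx) (hm hy) h), fun z hz => ?_, ?_⟩
  · rw [(hder z hz).deriv]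
    refine mul_ne_zero (div_ne_zero ?_ (pow_ne_zero 2
      (one_sub_conj_mul_ne_zero (hn z₀ hz₀) (hn z hz)))) (hd z hz)
    have h1 : 1 - ‖f z₀‖ ^ 2 ≠ 0 := by nlinarith [hn z₀ hz₀, norm_nonneg (f z₀)]
    exact_mod_cast h1
  · simp [mobius]

/-- An embedding into the disc which omits a value is not extremal. -/
theorem IsDiscEmbedding.exists_norm_deriv_lt {U : Set ℂ} (hUo : IsOpen U)
    (hU : IsSimplyConnected U) {z₀ : ℂ} (hz₀ : z₀ ∈ U) {f : ℂ → ℂ} (hf : IsDiscEmbedding U z₀ f)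
    {w : ℂ} (hw : ‖w‖ < 1) (hwf : w ∉ f '' U) :
    ∃ h, IsDiscEmbedding U z₀ h ∧ ‖deriv f z₀‖ < ‖deriv h z₀‖ := by
  have hfd : ∀ z ∈ U, HasDerivAt f (deriv f z) z := fun z hz =>
    (hf.holo.differentiableAt (hUo.mem_nhds hz)).hasDerivAt
  have hFd : ∀ z ∈ U, HasDerivAt (fun z => mobius w (f z))
      ((1 - ‖w‖ ^ 2) / (1 - conj w * f z) ^ 2 * deriv f z) z := fun z hz =>
    (hasDerivAt_mobius hw (hf.norm_lt z hz)).comp z (hfd z hz)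
  have hFdiff : DifferentiableOn ℂ (fun z => mobius w (f z)) U := fun z hz =>
    (hFd z hz).differentiableAt.differentiableWithinAt
  have hF0 : ∀ z ∈ U, mobius w (f z) ≠ 0 := fun z hz h => by
    rw [mobius, div_eq_zero_iff, or_iff_left (one_sub_conj_mul_ne_zero hw (hf.norm_lt z hz)),
      sub_eq_zero] at h
    exact hwf ⟨z, hz, h⟩
  have hw2 : 0 < 1 - ‖w‖ ^ 2 := by nlinarith [norm_nonneg w]
  have hw2c : (1 - (‖w‖ : ℂ) ^ 2) ≠ 0 := by exact_mod_cast hw2.ne'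
  -- Koebe's trick: the omitted value is moved to `0`, a square root is taken, and the base point is
  -- moved back to `0`.
  obtain ⟨g, hgc, hgF⟩ := Complex.exists_continuousOn_pow_eq hU hUo hFdiff.continuousOn
    (by rintro ⟨z, hz, h⟩; exact hF0 z hz h) two_ne_zero
  have hg0 : ∀ z ∈ U, g z ≠ 0 := fun z hz h => hF0 z hz (by rw [← hgF, h, zero_pow two_ne_zero])
  have hgd := fun z hz => hasDerivAt_of_sq_eq hUo hgc hFdiff hgF hz (hg0 z hz)
  have hgn : ∀ z ∈ U, ‖g z‖ < 1 := fun z hz => by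
    have h1 := norm_mobius_lt_one hw (hf.norm_lt z hz)
    rw [← hgF, norm_pow] at h1
    exact (sq_lt_one_iff₀ (norm_nonneg _)).1 h1
  set a := g z₀ with ha
  have han : ‖a‖ < 1 := hgn z₀ hz₀
  have ha0 : 0 < ‖a‖ := norm_pos_iff.2 (hg0 z₀ hz₀)
  have ha2 : 0 < 1 - ‖a‖ ^ 2 := by nlinarith
  have ha2c : (1 - (‖a‖ : ℂ) ^ 2) ≠ 0 := by exact_mod_cast ha2.ne'
  have hhd : ∀ z ∈ U, HasDerivAt (fun z => mobius a (g z))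
      ((1 - ‖a‖ ^ 2) / (1 - conj a * g z) ^ 2 * (deriv (fun z => mobius w (f z)) z / (2 * g z))) z :=
    fun z hz => (hasDerivAt_mobius han (hgn z hz)).comp z (hgd z hz)
  refine ⟨fun z => mobius a (g z), ⟨fun z hz => (hhd z hz).differentiableAt.differentiableWithinAt,
    fun z hz => norm_mobius_lt_one han (hgn z hz), fun x hx y hy h => ?_, fun z hz => ?_, ?_⟩, ?_⟩
  · have h1 := injOn_mobius han (mem_ball_zero_iff.2 (hgn x hx)) (mem_ball_zero_iff.2 (hgn y hy)) h
    have h2 : mobius w (f x) = mobius w (f y) := by rw [← hgF, ← hgF, h1]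
    exact hf.inj hx hy (injOn_mobius hw (mem_ball_zero_iff.2 (hf.norm_lt x hx))
      (mem_ball_zero_iff.2 (hf.norm_lt y hy)) h2)
  · rw [(hhd z hz).deriv, (hFd z hz).deriv]
    exact mul_ne_zero (div_ne_zero ha2c (pow_ne_zero 2
      (one_sub_conj_mul_ne_zero han (hgn z hz)))) (div_ne_zero (mul_ne_zero (div_ne_zero hw2c
      (pow_ne_zero 2 (one_sub_conj_mul_ne_zero hw (hf.norm_lt z hz)))) (hf.deriv_ne_zero z hz))
      (mul_ne_zero two_ne_zero (hg0 z hz)))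
  · simp [mobius, ha]
  · rw [(hhd z₀ hz₀).deriv, (hFd z₀ hz₀).deriv, hf.map_base, ← ha]
    have hwa : ‖w‖ = ‖a‖ ^ 2 := by
      rw [← norm_pow, ha, hgF, hf.map_base]
      simp [mobius]
    have hca : conj a * a = (‖a‖ ^ 2 : ℝ) := by
      rw [mul_comm, Complex.mul_conj, Complex.normSq_eq_norm_sq]
    have hd0 : 0 < ‖deriv f z₀‖ := norm_pos_iff.2 (hf.deriv_ne_zero z₀ hz₀)
    have e1 : ‖(1 - (‖w‖ : ℂ) ^ 2)‖ = 1 - ‖w‖ ^ 2 := by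
      have : (1 - (‖w‖ : ℂ) ^ 2) = ((1 - ‖w‖ ^ 2 : ℝ) : ℂ) := by push_cast; ring
      rw [this, Complex.norm_real, Real.norm_of_nonneg hw2.le]
    have e2 : ‖(1 - (‖a‖ : ℂ) ^ 2)‖ = 1 - ‖a‖ ^ 2 := by
      have : (1 - (‖a‖ : ℂ) ^ 2) = ((1 - ‖a‖ ^ 2 : ℝ) : ℂ) := by push_cast; ring
      rw [this, Complex.norm_real, Real.norm_of_nonneg ha2.le]
    rw [hca]
    push_cast
    simp only [mul_zero, sub_zero, one_pow, div_one, norm_mul, norm_div, norm_pow, e1, e2,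
      Complex.norm_ofNat]
    rw [hwa]
    -- Since `‖w‖ = ‖a‖²`, the derivative at the base point grows by `(1 + ‖a‖²) / (2‖a‖)`, which
    -- exceeds `1` as `‖a‖ < 1`.
    have : (1 - ‖a‖ ^ 2) / (1 - ‖a‖ ^ 2) ^ 2 * ((1 - (‖a‖ ^ 2) ^ 2) * ‖deriv f z₀‖ / (2 * ‖a‖)) =
        (1 + ‖a‖ ^ 2) / (2 * ‖a‖) * ‖deriv f z₀‖ := by
      field_simp
      ring
    rw [this]
    refine lt_mul_of_one_lt_left hd0 ?_
    rw [one_lt_div (by positivity)]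
    nlinarith [sq_pos_of_pos (sub_pos.2 han)]

/-- An extremal embedding into the disc exists. -/
theorem exists_isDiscEmbedding_norm_deriv_ge {U : Opens ℂ} (hU : IsPreconnected (U : Set ℂ))
    {z₀ : ℂ} (hz₀ : z₀ ∈ U) (hne : ∃ f, IsDiscEmbedding U z₀ f) :
    ∃ f, IsDiscEmbedding U z₀ f ∧
      ∀ h, IsDiscEmbedding U z₀ h → ‖deriv h z₀‖ ≤ ‖deriv f z₀‖ := by
  set A : Set ℝ := (fun f => ‖deriv f z₀‖) '' {f | IsDiscEmbedding U z₀ f} with hA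
  have hAne : A.Nonempty := hne.elim fun f hf => ⟨_, f, hf, rfl⟩
  obtain ⟨r, hr, hrU⟩ := Metric.isOpen_iff.1 U.isOpen z₀ hz₀
  have hAb : BddAbove A := by
    refine ⟨2 / r, ?_⟩
    rintro _ ⟨f, hf, rfl⟩
    refine Complex.norm_deriv_le_div_of_mapsTo_ball (hf.holo.mono hrU) (fun z hz => ?_) hr
    rw [hf.map_base, mem_closedBall_zero_iff]
    linarith [hf.norm_lt z (hrU hz)]
  obtain ⟨s, -, hs, hsA⟩ := exists_seq_tendsto_sSup hAne hAb
  choose f hf hfs using hsA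
  obtain ⟨ψ, f₀, hψ, hlim⟩ := exists_subseq_tendstoLocallyUniformlyOn (fun n => (hf n).holo)
    (fun n z hz => ((hf n).norm_lt z hz).le)
  have hholo : ∀ᶠ n in atTop, DifferentiableOn ℂ (f (ψ n)) U :=
    Eventually.of_forall fun n => (hf (ψ n)).holo
  have hf₀ := hlim.differentiableOn hholo U.isOpen
  have hlim' := hlim.deriv hholo U.isOpen
  have hdf₀ := hf₀.deriv U.isOpen
  have hsup : ‖deriv f₀ z₀‖ = sSup A := by
    refine tendsto_nhds_unique (hlim'.tendsto_at hz₀).norm ?_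
    refine (hs.comp hψ.tendsto_atTop).congr fun n => ?_
    exact (hfs (ψ n)).symm
  obtain ⟨f₁, hf₁⟩ := hne
  have hpos : 0 < ‖deriv f₀ z₀‖ := by
    rw [hsup]
    exact (norm_pos_iff.2 (hf₁.deriv_ne_zero z₀ hz₀)).trans_le
      (le_csSup hAb ⟨f₁, hf₁, rfl⟩)
  have hdz : deriv f₀ z₀ ≠ 0 := norm_pos_iff.1 hpos
  have hder : ∀ z ∈ U, deriv f₀ z ≠ 0 := by
    intro b hb
    refine ne_zero_of_tendstoLocallyUniformlyOn U.isOpen (g := fun n => deriv (f (ψ n)))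
      (fun n => (hf (ψ n)).holo.deriv U.isOpen) hlim' (fun n z hz => (hf (ψ n)).deriv_ne_zero z hz)
      hb fun h => hdz ?_
    exact (hdf₀.analyticOnNhd U.isOpen).eqOn_zero_of_preconnected_of_eventuallyEq_zero hU hb h hz₀
  have hinj : InjOn f₀ U := by
    intro a ha b hb hab
    by_contra hne
    -- Away from `a` the functions `f (ψ n) - f (ψ n) a` have no zeros, so by Hurwitz neither has
    -- their limit, which is not locally constant.
    have hV : IsOpen ((U : Set ℂ) \ {a}) := U.isOpen.sdiff isClosed_singleton
    have hlima : TendstoLocallyUniformlyOn (fun n z => f (ψ n) z - f (ψ n) a)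
        (fun z => f₀ z - f₀ a) atTop ((U : Set ℂ) \ {a}) := by
      refine (hlim.mono sdiff_subset).sub ?_
      have := hlim.tendsto_at ha
      exact this.tendstoUniformlyOn_const _ |>.tendstoLocallyUniformlyOn
    refine ne_zero_of_tendstoLocallyUniformlyOn hV
      (fun n => ((hf (ψ n)).holo.mono sdiff_subset).sub_const _) hlima
      (fun n z hz h => hz.2 ((hf (ψ n)).inj hz.1 ha (sub_eq_zero.1 h))) ⟨hb, fun h => hne h.symm⟩
      (fun h => hder b hb ?_) (sub_eq_zero.2 hab.symm)
    have : f₀ =ᶠ[𝓝 b] fun _ => f₀ a := h.mono fun z hz => sub_eq_zero.1 hz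
    rw [this.deriv_eq, deriv_const]
  have hcl : ∀ z ∈ U, ‖f₀ z‖ ≤ 1 := fun z hz =>
    le_of_tendsto (hlim.tendsto_at hz).norm
      (Eventually.of_forall fun n => ((hf (ψ n)).norm_lt z hz).le)
  refine ⟨f₀, ⟨hf₀, fun z hz => ?_, hinj, hder, ?_⟩, fun h hh => ?_⟩
  -- The limit only satisfies `‖f₀‖ ≤ 1`; the open mapping property makes the inequality strict.
  · have h1 : f₀ '' U ⊆ interior (closedBall 0 1) :=
      interior_maximal (by rintro _ ⟨z, hz, rfl⟩; exact mem_closedBall_zero_iff.2 (hcl z hz))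
        (isOpen_image_of_deriv_ne_zero U.isOpen hf₀ hder)
    rw [interior_closedBall _ one_ne_zero] at h1
    exact mem_ball_zero_iff.1 (h1 ⟨z, hz, rfl⟩)
  · exact tendsto_nhds_unique (hlim.tendsto_at hz₀)
      (tendsto_const_nhds.congr fun n => ((hf (ψ n)).map_base).symm)
  · rw [hsup]
    exact le_csSup hAb ⟨h, hh, rfl⟩

/-- The **Riemann mapping theorem**. -/
theorem exists_riemann_map {U : Opens ℂ} (hU : IsSimplyConnected (U : Set ℂ))
    (hne : (U : Set ℂ) ≠ univ) :
    ∃ f g : ℂ → ℂ, DifferentiableOn ℂ f U ∧ MapsTo f U (ball 0 1) ∧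
      DifferentiableOn ℂ g (ball 0 1) ∧ MapsTo g (ball 0 1) U ∧ (∀ z ∈ U, g (f z) = z) ∧
      ∀ z ∈ ball (0 : ℂ) 1, f (g z) = z := by
  obtain ⟨z₀, hz₀⟩ := hU.nonempty
  obtain ⟨f, hf, hmax⟩ := exists_isDiscEmbedding_norm_deriv_ge hU.isPathConnected.isConnected.isPreconnected
    hz₀ (exists_isDiscEmbedding U.isOpen hU hne hz₀)
  have hsurj : ∀ w ∈ ball (0 : ℂ) 1, ∃ z ∈ U, f z = w := by
    intro w hw
    by_contra h
    obtain ⟨k, hk, hlt⟩ := hf.exists_norm_deriv_lt U.isOpen hU hz₀ (mem_ball_zero_iff.1 hw)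
      (fun ⟨z, hz, hzw⟩ => h ⟨z, hz, hzw⟩)
    exact (hmax k hk).not_gt hlt
  choose! g hgU hfg using hsurj
  have hgf : ∀ z ∈ U, g (f z) = z := fun z hz =>
    have h1 : f z ∈ ball (0 : ℂ) 1 := mem_ball_zero_iff.2 (hf.norm_lt z hz)
    hf.inj (hgU _ h1) hz (hfg _ h1)
  refine ⟨f, g, hf.holo, fun z hz => mem_ball_zero_iff.2 (hf.norm_lt z hz), fun w hw => ?_, hgU,
    hgf, hfg⟩
  have hz := hgU w hw
  have hst := (hf.holo.analyticAt (U.isOpen.mem_nhds hz)).hasStrictDerivAt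
  have hcont : ContinuousAt g w := by
    have hmap := hst.map_nhds_eq (hf.deriv_ne_zero _ hz)
    rw [hfg w hw] at hmap
    intro V hV
    rw [mem_map, ← hmap, mem_map]
    filter_upwards [hV, U.isOpen.mem_nhds hz] with z hzV hzU
    rw [mem_preimage, mem_preimage, hgf z hzU]
    exact hzV
  exact (HasDerivAt.of_local_left_inverse hcont hst.hasDerivAt (hf.deriv_ne_zero _ hz)
    ((isOpen_ball.eventually_mem hw).mono hfg)).differentiableAt.differentiableWithinAt

end RiemannMapping
-- Transfer along a conformal equivalence, and the conclusion.
section Transfer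
open Set Metric Topology Filter

theorem deriv_mul_deriv_eq_one {S T : Set ℂ} (hS : IsOpen S) (hT : IsOpen T) {f g : ℂ → ℂ}
    (hf : DifferentiableOn ℂ f S) (hg : DifferentiableOn ℂ g T) (hm : MapsTo f S T)
    (hgf : ∀ z ∈ S, g (f z) = z) {z : ℂ} (hz : z ∈ S) : deriv g (f z) * deriv f z = 1 := by
  have h1 := ((hg.differentiableAt (hT.mem_nhds (hm hz))).hasDerivAt).comp z
    (hf.differentiableAt (hS.mem_nhds hz)).hasDerivAt
  exact h1.unique ((hasDerivAt_id z).congr_of_eventuallyEq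
    ((hS.eventually_mem hz).mono fun w hw => hgf w hw))

/-- If `Ω` is conformally equivalent to a domain which is exhausted by concentric discs, then
universal densities exist on `Ω`. -/
theorem exists_isUniversalDensity_of_equiv {Ω M : Opens ℂ} {f g : ℂ → ℂ}
    (hM : ∀ K : Set ℂ, K ⊆ M → IsCompact K →
      ∃ r R, 0 < r ∧ r < R ∧ K ⊆ closedBall 0 r ∧ ball (0 : ℂ) R ⊆ M)
    (hf : DifferentiableOn ℂ f Ω) (hfm : MapsTo f Ω M) (hg : DifferentiableOn ℂ g M)
    (hgm : MapsTo g M Ω) (hgf : ∀ z ∈ Ω, g (f z) = z) (hfg : ∀ z ∈ M, f (g z) = z)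
    {c : ℝ} (hc : 0 ≤ c) {Φ : Set (LocUnivSelfMap Ω)} {φ : ℕ → LocUnivSelfMap Ω}
    (hφ : ∀ n, φ n ∈ Φ) (hrun : IsRunAway φ) (hinj : IsEventuallyInjective φ) :
    ∃ L : C(Ω, ℝ), IsUniversalDensity Ω c Φ L := by
  have hgf' : ∀ z ∈ Ω, deriv g (f z) * deriv f z = 1 := fun z hz =>
    deriv_mul_deriv_eq_one Ω.isOpen M.isOpen hf hg hfm hgf hz
  have hfg' : ∀ z ∈ M, deriv f (g z) * deriv g z = 1 := fun z hz =>
    deriv_mul_deriv_eq_one M.isOpen Ω.isOpen hg hf hgm hfg hz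
  have hf0 : ∀ z ∈ Ω, deriv f z ≠ 0 := fun z hz => right_ne_zero_of_mul_eq_one (hgf' z hz)
  have hg0 : ∀ z ∈ M, deriv g z ≠ 0 := fun z hz => right_ne_zero_of_mul_eq_one (hfg' z hz)
  have hder : ∀ n, ∀ z ∈ M, HasDerivAt (fun z => f ((φ n).toFun (g z)))
      (deriv f ((φ n).toFun (g z)) * (deriv (φ n).toFun (g z) * deriv g z)) z := fun n z hz =>
    ((hf.differentiableAt (Ω.isOpen.mem_nhds ((φ n).mapsTo (hgm hz)))).hasDerivAt).comp z
      ((((φ n).holo.differentiableAt (Ω.isOpen.mem_nhds (hgm hz))).hasDerivAt).comp z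
        (hg.differentiableAt (M.isOpen.mem_nhds hz)).hasDerivAt)
  -- The maps are conjugated to `M`; images of compact sets under `g` transport both hypotheses.
  let φ' : ℕ → LocUnivSelfMap M := fun n =>
    { toFun := fun z => f ((φ n).toFun (g z))
      holo := fun z hz => (hder n z hz).differentiableAt.differentiableWithinAt
      mapsTo := fun z hz => hfm ((φ n).mapsTo (hgm hz))
      deriv_ne_zero := fun z hz => by
        rw [(hder n z hz).deriv]
        exact mul_ne_zero (hf0 _ ((φ n).mapsTo (hgm hz)))
          (mul_ne_zero ((φ n).deriv_ne_zero _ (hgm hz)) (hg0 z hz)) }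
  have hcomp : ∀ K : Set ℂ, K ⊆ M → IsCompact K → IsCompact (g '' K) := fun K hK hKc =>
    hKc.image_of_continuousOn (hg.continuousOn.mono hK)
  have hrun' : IsRunAway φ' := by
    intro K hK hKc
    obtain ⟨n, hn⟩ := hrun (g '' K) (hgm.mono_left hK).image_subset (hcomp K hK hKc)
    refine ⟨n, eq_empty_iff_forall_notMem.2 ?_⟩
    rintro w ⟨⟨z, hz, hzw⟩, hw⟩
    refine (eq_empty_iff_forall_notMem.1 hn) (g w) ⟨⟨g z, ⟨z, hz, rfl⟩, ?_⟩, ⟨w, hw, rfl⟩⟩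
    rw [← hzw]
    exact (hgf _ ((φ n).mapsTo (hgm (hK hz)))).symm
  have hinj' : IsEventuallyInjective φ' := by
    intro K hK hKc
    obtain ⟨N, hN⟩ := hinj (g '' K) (hgm.mono_left hK).image_subset (hcomp K hK hKc)
    refine ⟨N, fun n hn x hx y hy hxy => ?_⟩
    have h1 : (φ n).toFun (g x) = (φ n).toFun (g y) := by
      rw [← hgf _ ((φ n).mapsTo (hgm (hK hx))), ← hgf _ ((φ n).mapsTo (hgm (hK hy)))]
      exact congrArg g hxy
    have h2 := hN n hn ⟨x, hx, rfl⟩ ⟨y, hy, rfl⟩ h1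
    rw [← hfg x (hK hx), h2, hfg y (hK hy)]
  obtain ⟨L, ⟨l, hLl, hl⟩, hdense⟩ := exists_pullbacks_dense hM hc hrun' hinj'
  have hl' := IsConstCurvatureDensity.pullback hl hf hfm hf0
  refine ⟨pullbackDensity hf hfm L, ⟨_, fun z => ?_, hl'⟩, ?_, ?_⟩
  · exact congrArg (· * ‖deriv f z‖) (hLl _)
  · rintro _ ⟨ψ, -, rfl⟩
    refine ⟨_, fun z => ?_, hl'.pullback ψ.holo ψ.mapsTo ψ.deriv_ne_zero⟩
    exact congrArg (· * ‖deriv f (ψ.toFun z)‖ * ‖deriv ψ.toFun z‖) (hLl _)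
  · rintro u ⟨v, huv, hv⟩
    have hmem : pullbackDensity hg hgm u ∈ constCurvatureDensities M c :=
      ⟨_, fun z => congrArg (· * ‖deriv g z‖) (huv _),
        IsConstCurvatureDensity.pullback hv hg hgm hg0⟩
    have hback : pullbackDensity hf hfm (pullbackDensity hg hgm u) = u := by
      ext z
      change u ⟨g (f z), _⟩ * ‖deriv g (f z)‖ * ‖deriv f z‖ = u z
      rw [mul_assoc, ← norm_mul, hgf' z z.2, norm_one, mul_one]
      exact congrArg u (Subtype.ext (hgf z z.2))
    -- The target is the image under the continuous pullback by `f` of a density on `M`, and that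
    -- pullback carries the orbit of `L` on `M` into the orbit on `Ω`.
    rw [← hback]
    refine closure_mono ?_ (image_closure_subset_closure_image
      (continuous_pullbackDensity hf hfm) ⟨_, hdense hmem, rfl⟩)
    rintro _ ⟨_, ⟨n, rfl⟩, rfl⟩
    refine ⟨φ n, hφ n, ?_⟩
    ext z
    change L ⟨f ((φ n).toFun z), _⟩ * ‖deriv f ((φ n).toFun z)‖ * ‖deriv (φ n).toFun z‖ =
      L ⟨f ((φ n).toFun (g (f z))), _⟩ * ‖deriv (fun z => f ((φ n).toFun (g z))) (f z)‖ *
        ‖deriv f z‖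
    have hz := z.2
    rw [(hder n (f z) (hfm hz)).deriv]
    simp only [hgf z hz]
    rw [mul_assoc, mul_assoc, ← norm_mul, ← norm_mul]
    congr 2
    linear_combination -(deriv f ((φ n).toFun z) * deriv (φ n).toFun z) * hgf' z hz

end Transfer

/-- The plane is already exhausted by concentric discs and is its own model; any other simply
connected domain is mapped to the unit disc. -/
theorem mainTheorem10 (Ω : TopologicalSpace.Opens ℂ) (hΩ : IsSimplyConnected (Ω : Set ℂ))
    (c : ℝ) (hc : 0 ≤ c) (Φ : Set (LocUnivSelfMap Ω))
    (hΦ : ∃ φ : ℕ → LocUnivSelfMap Ω,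
      (∀ n, φ n ∈ Φ) ∧ IsRunAway φ ∧ IsEventuallyInjective φ) :
    ∃ L : C(Ω, ℝ), IsUniversalDensity Ω c Φ L := by
  obtain ⟨φ, hφ, hrun, hinj⟩ := hΦ
  by_cases hne : (Ω : Set ℂ) = Set.univ
  · refine exists_isUniversalDensity_of_equiv (M := Ω) (f := id) (g := id) (fun K _ hK => ?_)
      differentiableOn_id (Set.mapsTo_id _) differentiableOn_id (Set.mapsTo_id _)
      (fun _ _ => rfl) (fun _ _ => rfl) hc hφ hrun hinj
    obtain ⟨r, hr, hKr⟩ := hK.isBounded.subset_closedBall_lt 0 0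
    exact ⟨r, r + 1, hr, lt_add_one r, hKr, by rw [hne]; exact Set.subset_univ _⟩
  · obtain ⟨f, g, hf, hfm, hg, hgm, hgf, hfg⟩ := exists_riemann_map hΩ hne
    refine exists_isUniversalDensity_of_equiv (M := ⟨Metric.ball 0 1, Metric.isOpen_ball⟩)
      (fun K hK hKc => ?_) hf hfm hg hgm hgf hfg hc hφ hrun hinj
    obtain ⟨r, hr, hKr⟩ := exists_pos_lt_subset_ball one_pos hKc.isClosed hK
    exact ⟨r, 1, hr.1, hr.2, hKr.trans Metric.ball_subset_closedBall, subset_rfl⟩
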